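/- Let $n\ge 1$, and let $\mathrm{Y}(n)$ be the Yangian of $\mathfrak{gl}_n$: the unital associative algebra over $\mathbb{C}$ with generators $t_{ij}^{(r)}$ ($1\le i,j\le n$, $r\ge 1$) and defining relations $$[t^{(r+1)}_{ij},t^{(s)}_{kl}]-[t^{(r)}_{ij},t^{(s+1)}_{kl}]=t^{(r)}_{kj}t^{(s)}_{il}-t^{(s)}_{kj}t^{(r)}_{il},\qquad r,s\ge 0,\quad t^{(0)}_{ij}=\delta_{ij}.$$ Put $t_{ij}(u)=\sum_{r\ge 0}t_{ij}^{(r)}u^{-r}$ and $T(u)=(t_{ij}(u))_{i,j=1}^n$. This matrix of formal series in $u^{-1}$ has an inverse, $T^{-1}(u)$. The algebra $\mathrm{Y}(n)$ is a Hopf algebra with coproduct $\Delta: t_{ij}(u)\mapsto\sum_a t_{ia}(u)\otimes t_{aj}(u)$, counit $\epsilon: T(u)\mapsto 1$ and antipode $\mathrm{S}: T(u)\mapsto T^{-1}(u)$. A series $f(u+a)$ with $a\in\mathbb{C}$ is always expanded in powers of $u^{-1}$. Let $T_a(u)$ denote $T(u)$ acting in the $a$-th factor of $(\mathbb{C}^n)^{\otimes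 n}$, and let $A_n$ be the antisymmetrizer $e_{i_1}\otimes\cdots\otimes e_{i_n}\mapsto\sum_{\sigma\in\mathfrak{S}_n}\operatorname{sgn}\sigma\cdot e_{i_{\sigma(1)}}\otimes\cdots\otimes e_{i_{\sigma(n)}}$. There is a unique series $\operatorname{qdet}T(u)\in\mathrm{Y}(n)[[u^{-1}]]$, the quantum determinant, such that $$A_n\,T_1(u)\,T_2(u-1)\cdots T_n(u-n+1)=A_n\operatorname{qdet}T(u),$$ and its constant term is $1$. Define the series $z(u)$ with coefficients in $\mathrm{Y}(n)$ by $$z(u)^{-1}=\frac1n\operatorname{tr}\bigl(T(u)\,T^{-1}(u-n)\bigr).$$ **Theorem.** 1. (Quantum Liouville formula) $$z(u)=\frac{\operatorname{qdet}T(u-1)}{\operatorname{qdet}T(u)},$$ where the numerator may be multiplied by the inverse of the denominator on either side. 2. We have $z(u)=1+z_2u^{-2}+z_3u^{-3}+\cdots$, and the coefficients $z_2,z_3,\dots$ are algebraically independent (over $\mathbb{C}$) generators of the center of $\mathrm{Y}(n)$. 3. The square $\mathrm{S}^2$ of the antipode is the algebra automorphism of $\mathrm{Y}(n)$ given by $T(u)\mapsto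 z(u+n)\,T(u+n)$. In particular, $\operatorname{qdet}T(u)$ is stable under $\mathrm{S}^2$. -/

import Mathlib

noncomputable section

open PowerSeries TensorProduct

namespace GLYangian

/-! ### The Yangian for `gl_n` -/

/-- The symbols `t_{ij}^{(r)}`, `r ≥ 0`, in the free algebra on the generators `(i, j, r)`,
which stands for `t_{ij}^{(r+1)}`; here `t_{ij}^{(0)} = δ_{ij}`. -/
def freeGen {n : ℕ} (i j : Fin n) : ℕ → FreeAlgebra ℂ (Fin n × Fin n × ℕ)
  | 0 => if i = j then 1 else 0
  | r + 1 => FreeAlgebra.ι ℂ (i, j, r)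

/-- The defining relations of the Yangian. -/
inductive Rel (n : ℕ) : FreeAlgebra ℂ (Fin n × Fin n × ℕ) → FreeAlgebra ℂ (Fin n × Fin n × ℕ) → Prop
  | mk (i j k l : Fin n) (r s : ℕ) : Rel n
      ((freeGen i j (r + 1) * freeGen k l s - freeGen k l s * freeGen i j (r + 1)) -
        (freeGen i j r * freeGen k l (s + 1) - freeGen k l (s + 1) * freeGen i j r))
      (freeGen k j r * freeGen i l s - freeGen k j s * freeGen i l r)

/-- The Yangian `Y(n) = Y(gl_n)`. -/
def Yangian (n : ℕ) : Type := RingQuot (Rel n)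

instance (n : ℕ) : Ring (Yangian n) := inferInstanceAs (Ring (RingQuot (Rel n)))

instance (n : ℕ) : Algebra ℂ (Yangian n) := inferInstanceAs (Algebra ℂ (RingQuot (Rel n)))

/-- The quotient map from the free algebra. -/
def proj (n : ℕ) : FreeAlgebra ℂ (Fin n × Fin n × ℕ) →ₐ[ℂ] Yangian n :=
  RingQuot.mkAlgHom ℂ (Rel n)

/-- The element `t_{ij}^{(r)}` of the Yangian, with `t_{ij}^{(0)} = δ_{ij}`. -/
def t {n : ℕ} (i j : Fin n) (r : ℕ) : Yangian n := proj n (freeGen i j r)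

theorem t_zero {n : ℕ} (i j : Fin n) : t i j 0 = if i = j then 1 else 0 := by
  unfold t freeGen; split_ifs <;> simp

theorem t_rel {n : ℕ} (i j k l : Fin n) (r s : ℕ) :
    (t i j (r + 1) * t k l s - t k l s * t i j (r + 1)) -
      (t i j r * t k l (s + 1) - t k l (s + 1) * t i j r) =
    t k j r * t i l s - t k j s * t i l r := by
  have h := RingQuot.mkAlgHom_rel ℂ (Rel.mk i j k l r s)
  change proj n _ = proj n _ at h
  unfold t
  simpa only [map_sub, map_mul] using h

/-- The generating matrix `T(u)`, with entries the series
`t_{ij}(u) = δ_{ij} + t_{ij}^{(1)} u⁻¹ + ⋯`; the variable `X` of the power series is `u⁻¹`. -/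
def T (n : ℕ) : Matrix (Fin n) (Fin n) (Yangian n)⟦X⟧ :=
  Matrix.of fun i j => PowerSeries.mk fun r => t i j r

/-- The series `f(u + a)` for a formal series `f(u) = ∑ f_r u^{-r}`: every `u⁻¹` is replaced by
`(u + a)⁻¹ = u⁻¹ (1 + a u⁻¹)⁻¹`. -/
def shift {A : Type*} [Ring A] [Algebra ℂ A] (a : ℂ) (f : A⟦X⟧) : A⟦X⟧ :=
  PowerSeries.mk fun m => ∑ r ∈ Finset.range (m + 1),
    PowerSeries.coeff m ((X * (1 + PowerSeries.C a * X)⁻¹ : ℂ⟦X⟧) ^ r) • PowerSeries.coeff r f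

/-- The inverse matrix `T⁻¹(u)`. It is a two-sided inverse by `isUnit_T`. -/
def Tinv (n : ℕ) : Matrix (Fin n) (Fin n) (Yangian n)⟦X⟧ := Ring.inverse (T n)

/-- The series `(1/n) tr (T(u) T⁻¹(u - n))`. -/
def zInv (n : ℕ) : (Yangian n)⟦X⟧ :=
  (1 / n : ℂ) • (T n * (Tinv n).map (shift (-(n : ℂ)))).trace

/-- The series `z(u)`, the inverse of `zInv n`; see `isUnit_zInv`. -/
def z (n : ℕ) : (Yangian n)⟦X⟧ := Ring.inverse (zInv n)

/-! ### The quantum determinant -/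

/-- The matrix `M` acting on the `a`-th copy of `ℂⁿ` in the `m`-fold tensor power of `ℂⁿ`, in the
basis `e_I = e_{I 0} ⊗ ⋯ ⊗ e_{I (m-1)}`. -/
def leg {n m : ℕ} {R : Type*} [Zero R] (a : Fin m) (M : Matrix (Fin n) (Fin n) R) :
    Matrix (Fin m → Fin n) (Fin m → Fin n) R :=
  open Classical in
  Matrix.of fun I J => if ∀ b, b ≠ a → I b = J b then M (I a) (J a) else 0

/-- The antisymmetrizer `e_I ↦ ∑_σ sgn σ • e_{I ∘ σ}` on the `m`-fold tensor power of `ℂⁿ`. -/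
def antisymmetrizer (n m : ℕ) (R : Type*) [Ring R] :
    Matrix (Fin m → Fin n) (Fin m → Fin n) R :=
  Matrix.of fun K I => ∑ σ : Equiv.Perm (Fin m),
    if K = I ∘ σ then (((Equiv.Perm.sign σ : ℤˣ) : ℤ) : R) else 0

/-- The operator `A_m T_1(u) T_2(u - 1) ⋯ T_m(u - m + 1)`. -/
def antisymT (n m : ℕ) : Matrix (Fin m → Fin n) (Fin m → Fin n) (Yangian n)⟦X⟧ :=
  antisymmetrizer n m (Yangian n)⟦X⟧ *
    (List.ofFn fun a : Fin m => leg a ((T n).map (shift (-((a : ℕ) : ℂ))))).prod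

/-- `d` is a quantum determinant of `T(u)`: the operator `A_n T_1(u) ⋯ T_n(u - n + 1)` equals
`A_n d(u)`. -/
def IsQuantumDeterminant (n : ℕ) (d : (Yangian n)⟦X⟧) : Prop :=
  antisymT n n = antisymmetrizer n n (Yangian n)⟦X⟧ * Matrix.diagonal fun _ => d

/-- The only candidate for the quantum determinant: the diagonal matrix element of
`A_n T_1(u) ⋯ T_n(u - n + 1)` at `e_1 ⊗ ⋯ ⊗ e_n`. -/
def qdet (n : ℕ) : (Yangian n)⟦X⟧ := antisymT n n id id

theorem IsQuantumDeterminant.eq_qdet {n : ℕ} {d : (Yangian n)⟦X⟧}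
    (h : IsQuantumDeterminant n d) : d = qdet n := by
  unfold qdet
  rw [h, Matrix.mul_diagonal]
  have : antisymmetrizer n n (Yangian n)⟦X⟧ id id = 1 := by
    simp only [antisymmetrizer, Matrix.of_apply]
    rw [Finset.sum_eq_single 1]
    · simp
    · intro σ _ hσ
      rw [if_neg]
      intro hh
      apply hσ
      ext i
      simpa using congrArg Fin.val (congrFun hh i).symm
    · simp
  rw [this, one_mul]

/-! ### Invertibility of the series -/

/-- A matrix of series as a series of matrices. -/
def matSeriesEquiv (n : ℕ) (A : Type*) [Ring A] :
    Matrix (Fin n) (Fin n) A⟦X⟧ ≃+* (Matrix (Fin n) (Fin n) A)⟦X⟧ where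
  toFun M := PowerSeries.mk fun r => M.map (PowerSeries.coeff r)
  invFun f := Matrix.of fun i j => PowerSeries.mk fun r => PowerSeries.coeff r f i j
  left_inv M := by ext i j r; simp
  right_inv f := by ext r i j; simp
  map_add' M N := by ext r i j; simp
  map_mul' M N := by
    ext r i j
    simp only [PowerSeries.coeff_mk, Matrix.map_apply, Matrix.mul_apply, map_sum,
      PowerSeries.coeff_mul, Matrix.sum_apply]
    exact Finset.sum_comm

theorem isUnit_of_constantCoeff {n : ℕ} {A : Type*} [Ring A] (M : Matrix (Fin n) (Fin n) A⟦X⟧)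
    (h : M.map PowerSeries.constantCoeff = 1) : IsUnit M := by
  have : IsUnit (matSeriesEquiv n A M) := by
    rw [PowerSeries.isUnit_iff_constantCoeff]
    have h2 : PowerSeries.constantCoeff (matSeriesEquiv n A M) = 1 := by
      rw [← h, ← PowerSeries.coeff_zero_eq_constantCoeff_apply]
      simp [matSeriesEquiv]
    rw [h2]
    exact isUnit_one
  exact (MulEquiv.isUnit_map (matSeriesEquiv n A)).1 this

theorem T_map_constantCoeff (n : ℕ) : (T n).map PowerSeries.constantCoeff = 1 := by
  ext i j
  rw [Matrix.map_apply, ← PowerSeries.coeff_zero_eq_constantCoeff_apply, T, Matrix.of_apply,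
    PowerSeries.coeff_mk, t_zero, Matrix.one_apply]

theorem isUnit_T (n : ℕ) : IsUnit (T n) := isUnit_of_constantCoeff _ (T_map_constantCoeff n)

theorem T_mul_Tinv (n : ℕ) : T n * Tinv n = 1 := Ring.mul_inverse_cancel _ (isUnit_T n)

theorem Tinv_mul_T (n : ℕ) : Tinv n * T n = 1 := Ring.inverse_mul_cancel _ (isUnit_T n)

theorem Tinv_map_constantCoeff (n : ℕ) : (Tinv n).map PowerSeries.constantCoeff = 1 := by
  have h := congrArg (fun M => M.map (PowerSeries.constantCoeff (R := Yangian n))) (T_mul_Tinv n)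
  simpa only [Matrix.map_mul, T_map_constantCoeff, one_mul,
    Matrix.map_one _ (map_zero _) (map_one _)] using h

theorem constantCoeff_shift {A : Type*} [Ring A] [Algebra ℂ A] (a : ℂ) (f : A⟦X⟧) :
    PowerSeries.constantCoeff (shift a f) = PowerSeries.constantCoeff f := by
  rw [← PowerSeries.coeff_zero_eq_constantCoeff_apply]
  simp [shift]

theorem constantCoeff_zInv (n : ℕ) (hn : 0 < n) : PowerSeries.constantCoeff (zInv n) = 1 := by
  have h1 : (PowerSeries.constantCoeff (zInv n)) =
      (1 / n : ℂ) • ((T n * (Tinv n).map (shift (-(n : ℂ)))).map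
        (PowerSeries.constantCoeff (R := Yangian n))).trace := by
    rw [zInv, ← PowerSeries.coeff_zero_eq_constantCoeff_apply, PowerSeries.coeff_smul]
    simp only [Matrix.trace, Matrix.diag, map_sum, Matrix.map_apply,
      PowerSeries.coeff_zero_eq_constantCoeff_apply]
  have h2 : ((Tinv n).map (shift (-(n : ℂ)))).map (PowerSeries.constantCoeff (R := Yangian n)) =
      1 := by
    rw [← Tinv_map_constantCoeff]
    ext i j
    simp [constantCoeff_shift]
  rw [h1, Matrix.map_mul, T_map_constantCoeff, h2, one_mul, Matrix.trace_one, Fintype.card_fin]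
  have : (n : Yangian n) = (n : ℂ) • (1 : Yangian n) := by
    rw [Nat.cast_smul_eq_nsmul]; simp
  rw [this, smul_smul, one_div, inv_mul_cancel₀ (by exact_mod_cast hn.ne'), one_smul]

theorem isUnit_zInv (n : ℕ) (hn : 0 < n) : IsUnit (zInv n) := by
  rw [PowerSeries.isUnit_iff_constantCoeff, constantCoeff_zInv n hn]
  exact isUnit_one
/-! ### The Hopf algebra structure -/

/-- The homomorphism out of the Yangian given by the images of the generators. -/
def lift {n : ℕ} {A : Type*} [Ring A] [Algebra ℂ A] (g : Fin n → Fin n → ℕ → A)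
    (h0 : ∀ i j, g i j 0 = if i = j then 1 else 0)
    (h : ∀ i j k l r s, (g i j (r + 1) * g k l s - g k l s * g i j (r + 1)) -
      (g i j r * g k l (s + 1) - g k l (s + 1) * g i j r) =
        g k j r * g i l s - g k j s * g i l r) : Yangian n →ₐ[ℂ] A :=
  RingQuot.liftAlgHom ℂ ⟨FreeAlgebra.lift ℂ fun p => g p.1 p.2.1 (p.2.2 + 1), by
    have key : ∀ i j r, FreeAlgebra.lift ℂ (fun p : Fin n × Fin n × ℕ => g p.1 p.2.1 (p.2.2 + 1))
        (freeGen i j r) = g i j r := by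
      intro i j r
      cases r with
      | zero => rw [h0, freeGen]; split_ifs <;> simp
      | succ r => simp [freeGen]
    rintro _ _ ⟨i, j, k, l, r, s⟩
    simp only [map_sub, map_mul, key, h]⟩

theorem lift_t {n : ℕ} {A : Type*} [Ring A] [Algebra ℂ A] (g : Fin n → Fin n → ℕ → A)
    (h0) (h) (i j : Fin n) (r : ℕ) : lift g h0 h (t i j r) = g i j r := by
  unfold lift t proj
  refine (RingQuot.liftAlgHom_mkAlgHom_apply _ _ _ _).trans ?_
  cases r with
  | zero => rw [h0, freeGen]; split_ifs <;> simp
  | succ r => simp [freeGen]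

theorem algHom_ext {n : ℕ} {A : Type*} [Ring A] [Algebra ℂ A] {f g : Yangian n →ₐ[ℂ] A}
    (h : ∀ i j r, f (t i j r) = g (t i j r)) : f = g := by
  apply RingQuot.ringQuot_ext'
  apply FreeAlgebra.hom_ext
  funext ⟨i, j, r⟩
  exact h i j (r + 1)

theorem t_induction {n : ℕ} (S : Subalgebra ℂ (Yangian n)) (h : ∀ i j r, t i j r ∈ S)
    (x : Yangian n) : x ∈ S := by
  obtain ⟨y, rfl⟩ := RingQuot.mkAlgHom_surjective ℂ (Rel n) x
  induction y using FreeAlgebra.induction with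
  | grade0 c => rw [AlgHom.commutes]; exact S.algebraMap_mem c
  | grade1 p => exact h p.1 p.2.1 (p.2.2 + 1)
  | mul a b ha hb => rw [map_mul]; exact S.mul_mem ha hb
  | add a b ha hb => rw [map_add]; exact S.add_mem ha hb

section RTT

variable {n : ℕ} {B : Type*} [Ring B]

/-- `D [U_{ij}, V_{kl}] = E (U_{kj} V_{il} - V_{kj} U_{il})`. -/
def RTT (D E : B) (U V : Matrix (Fin n) (Fin n) B) : Prop :=
  ∀ i j k l, D * (U i j * V k l - V k l * U i j) = E * (U k j * V i l - V k j * U i l)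

/-- `U` on the first tensor factor. -/
def leg1 (U : Matrix (Fin n) (Fin n) B) : Matrix (Fin n × Fin n) (Fin n × Fin n) B :=
  Matrix.of fun p q => if p.2 = q.2 then U p.1 q.1 else 0

/-- `U` on the second tensor factor. -/
def leg2 (U : Matrix (Fin n) (Fin n) B) : Matrix (Fin n × Fin n) (Fin n × Fin n) B :=
  Matrix.of fun p q => if p.1 = q.1 then U p.2 q.2 else 0

/-- The `R`-matrix, with denominators cleared. -/
def Rmat (n : ℕ) (D E : B) : Matrix (Fin n × Fin n) (Fin n × Fin n) B :=
  Matrix.of fun p q => (if p = q then D else 0) - (if p = q.swap then E else 0)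

theorem leg1_mul_apply (U : Matrix (Fin n) (Fin n) B) 
    (M : Matrix (Fin n × Fin n) (Fin n × Fin n) B) (p q : Fin n × Fin n) :
    (leg1 U * M) p q = ∑ a, U p.1 a * M (a, p.2) q := by
  simp only [leg1, Matrix.mul_apply, Fintype.sum_prod_type, Matrix.of_apply]
  simp

theorem leg2_mul_apply (U : Matrix (Fin n) (Fin n) B) 
    (M : Matrix (Fin n × Fin n) (Fin n × Fin n) B) (p q : Fin n × Fin n) :
    (leg2 U * M) p q = ∑ a, U p.2 a * M (p.1, a) q := by
  simp only [leg2, Matrix.mul_apply, Fintype.sum_prod_type, Matrix.of_apply]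
  simp

theorem leg1_mul (U V : Matrix (Fin n) (Fin n) B) : leg1 (U * V) = leg1 U * leg1 V := by
  ext p q
  rw [leg1_mul_apply]
  simp only [leg1, Matrix.of_apply, Matrix.mul_apply]
  split_ifs <;> simp

theorem leg2_mul (U V : Matrix (Fin n) (Fin n) B) : leg2 (U * V) = leg2 U * leg2 V := by
  ext p q
  rw [leg2_mul_apply]
  simp only [leg2, Matrix.of_apply, Matrix.mul_apply]
  split_ifs <;> simp

theorem leg1_one : leg1 (1 : Matrix (Fin n) (Fin n) B) = 1 := by
  ext p q
  simp only [leg1, Matrix.of_apply, Matrix.one_apply, Prod.ext_iff]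
  split_ifs <;> simp_all

theorem leg2_one : leg2 (1 : Matrix (Fin n) (Fin n) B) = 1 := by
  ext p q
  simp only [leg2, Matrix.of_apply, Matrix.one_apply, Prod.ext_iff]
  split_ifs <;> simp_all

theorem leg1_leg2 (U V : Matrix (Fin n) (Fin n) B) (p q) :
    (leg1 U * leg2 V) p q = U p.1 q.1 * V p.2 q.2 := by
  rw [leg1_mul_apply]; simp [leg2]

theorem leg2_leg1 (U V : Matrix (Fin n) (Fin n) B) (p q) :
    (leg2 V * leg1 U) p q = V p.2 q.2 * U p.1 q.1 := by
  rw [leg2_mul_apply]; simp [leg1]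

theorem Rmat_mul (D E : B) (M : Matrix (Fin n × Fin n) (Fin n × Fin n) B) (p q) :
    (Rmat n D E * M) p q = D * M p q - E * M p.swap q := by
  simp only [Rmat, Matrix.mul_apply, Matrix.of_apply, sub_mul, Finset.sum_sub_distrib, ite_mul,
    zero_mul, Finset.sum_ite_eq, Finset.mem_univ, if_true]
  congr 1
  rw [Finset.sum_eq_single p.swap]
  · simp
  · intro b _ hb
    rw [if_neg]
    rintro rfl
    simp at hb
  · simp

theorem mul_Rmat (D E : B) (M : Matrix (Fin n × Fin n) (Fin n × Fin n) B) (p q) :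
    (M * Rmat n D E) p q = M p q * D - M p q.swap * E := by
  simp only [Rmat, Matrix.mul_apply, Matrix.of_apply, mul_sub, Finset.sum_sub_distrib, mul_ite,
    mul_zero, Finset.sum_ite_eq', Finset.mem_univ, if_true]

theorem RTT_iff {D E : B} (hD : ∀ b, D * b = b * D) (hE : ∀ b, E * b = b * E)
    (U V : Matrix (Fin n) (Fin n) B) :
    RTT D E U V ↔ Rmat n D E * (leg1 U * leg2 V) = leg2 V * leg1 U * Rmat n D E := by
  have key : ∀ i j k l, (D * (U i j * V k l - V k l * U i j) = E * (U k j * V i l - V k j * U i l))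
      ↔ (D * (U i j * V k l) - E * (U k j * V i l) =
        V k l * U i j * D - V k j * U i l * E) := by
    intro i j k l
    rw [← hD, ← hE, mul_sub, mul_sub, sub_eq_sub_iff_sub_eq_sub]
  constructor
  · intro h
    ext ⟨i, k⟩ ⟨j, l⟩
    rw [Rmat_mul, mul_Rmat]
    simp only [leg1_leg2, leg2_leg1, Prod.swap]
    exact (key i j k l).1 (h i j k l)
  · intro h i j k l
    have := congrFun (congrFun h (i, k)) (j, l)
    rw [Rmat_mul, mul_Rmat] at this
    simp only [leg1_leg2, leg2_leg1, Prod.swap] at this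
    exact (key i j k l).2 this

theorem RTT.mul {D E : B} (hD : ∀ b, D * b = b * D) (hE : ∀ b, E * b = b * E)
    {U V U' V' : Matrix (Fin n) (Fin n) B} (h : RTT D E U V) (h' : RTT D E U' V')
    (h1 : ∀ i j k l, U' i j * V k l = V k l * U' i j)
    (h2 : ∀ i j k l, U i j * V' k l = V' k l * U i j) : RTT D E (U * U') (V * V') := by
  rw [RTT_iff hD hE] at h h' ⊢
  have c1 : leg1 U' * leg2 V = leg2 V * leg1 U' := by
    ext p q; rw [leg1_leg2, leg2_leg1, h1]
  have c2 : leg1 U * leg2 V' = leg2 V' * leg1 U := by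
    ext p q; rw [leg1_leg2, leg2_leg1, h2]
  calc Rmat n D E * (leg1 (U * U') * leg2 (V * V'))
      = Rmat n D E * (leg1 U * (leg1 U' * leg2 V) * leg2 V') := by
        rw [leg1_mul, leg2_mul]; simp only [mul_assoc]
    _ = (Rmat n D E * (leg1 U * leg2 V)) * (leg1 U' * leg2 V') := by
        rw [c1]; simp only [mul_assoc]
    _ = leg2 V * leg1 U * (Rmat n D E * (leg1 U' * leg2 V')) := by
        rw [h]; simp only [mul_assoc]
    _ = leg2 V * (leg1 U * leg2 V') * leg1 U' * Rmat n D E := by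
        rw [h']; simp only [mul_assoc]
    _ = leg2 (V * V') * leg1 (U * U') * Rmat n D E := by
        rw [c2, leg1_mul, leg2_mul]; simp only [mul_assoc]

theorem RTT.inv {D E : B} (hD : ∀ b, D * b = b * D) (hE : ∀ b, E * b = b * E)
    {U V U' V' : Matrix (Fin n) (Fin n) B} (h : RTT D E U V)
    (hU : U * U' = 1) (hU' : U' * U = 1) (hV : V * V' = 1) (hV' : V' * V = 1) (i j k l : Fin n) :
    D * (V' k l * U' i j - U' i j * V' k l) = E * (V' i l * U' k j - U' i l * V' k j) := by
  rw [RTT_iff hD hE] at h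
  have e1 : leg1 U * leg1 U' = 1 := by rw [← leg1_mul, hU, leg1_one]
  have e1' : leg1 U' * leg1 U = 1 := by rw [← leg1_mul, hU', leg1_one]
  have e2 : leg2 V * leg2 V' = 1 := by rw [← leg2_mul, hV, leg2_one]
  have e2' : leg2 V' * leg2 V = 1 := by rw [← leg2_mul, hV', leg2_one]
  have H : leg1 U' * leg2 V' * Rmat n D E = Rmat n D E * (leg2 V' * leg1 U') := by
    calc leg1 U' * leg2 V' * Rmat n D E
        = leg1 U' * leg2 V' * (Rmat n D E * (leg1 U * ((leg2 V * leg2 V') * leg1 U'))) := by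
          rw [e2, one_mul, e1, mul_one]
      _ = leg1 U' * leg2 V' * (Rmat n D E * (leg1 U * leg2 V)) * (leg2 V' * leg1 U') := by
          simp only [mul_assoc]
      _ = leg1 U' * (leg2 V' * leg2 V) * leg1 U * Rmat n D E * (leg2 V' * leg1 U') := by
          rw [h]; simp only [mul_assoc]
      _ = Rmat n D E * (leg2 V' * leg1 U') := by rw [e2', mul_one, e1', one_mul]
  have := congrFun (congrFun H (i, k)) (j, l)
  rw [Rmat_mul, mul_Rmat] at this
  simp only [leg1_leg2, leg2_leg1, Prod.swap] at this
  rw [← hD, ← hE] at this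
  rw [mul_sub, mul_sub, sub_eq_sub_iff_sub_eq_sub]
  exact this.symm

end RTT

section TwoVar

variable {A : Type*} [Ring A]

/-- A series in `u⁻¹` as a series in two variables. -/
def inU : A⟦X⟧ →+* A⟦X⟧⟦X⟧ := PowerSeries.C

/-- A series in `v⁻¹` as a series in two variables. -/
def inV : A⟦X⟧ →+* A⟦X⟧⟦X⟧ := PowerSeries.map PowerSeries.C

/-- `v⁻¹ - u⁻¹`. -/
def dd (A : Type*) [Ring A] : A⟦X⟧⟦X⟧ := X - PowerSeries.C X

/-- `u⁻¹ v⁻¹`. -/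
def ee (A : Type*) [Ring A] : A⟦X⟧⟦X⟧ := X * PowerSeries.C X

theorem X_comm (b : A⟦X⟧⟦X⟧) : X * b = b * X := (PowerSeries.commute_X b).symm.eq

theorem CX_comm (b : A⟦X⟧⟦X⟧) : PowerSeries.C X * b = b * PowerSeries.C X := by
  ext q p
  rw [PowerSeries.coeff_C_mul, PowerSeries.coeff_mul_C, (PowerSeries.commute_X _).eq]

theorem dd_comm (b : A⟦X⟧⟦X⟧) : dd A * b = b * dd A := by
  rw [dd, sub_mul, mul_sub, X_comm, CX_comm]

theorem ee_comm (b : A⟦X⟧⟦X⟧) : ee A * b = b * ee A := by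
  rw [ee, mul_assoc, CX_comm, ← mul_assoc, X_comm, mul_assoc]

theorem coeff_uv (f g : A⟦X⟧) (p q : ℕ) :
    PowerSeries.coeff p (PowerSeries.coeff q (inU f * inV g)) =
      PowerSeries.coeff p f * PowerSeries.coeff q g := by
  simp [inU, inV, PowerSeries.coeff_C_mul, PowerSeries.coeff_mul_C]

theorem coeff_vu (f g : A⟦X⟧) (p q : ℕ) :
    PowerSeries.coeff p (PowerSeries.coeff q (inV g * inU f)) =
      PowerSeries.coeff q g * PowerSeries.coeff p f := by
  simp [inU, inV, PowerSeries.coeff_C_mul, PowerSeries.coeff_mul_C]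

/-- The relations of the Yangian in terms of coefficients. -/
def CoeffRel {n : ℕ} (g : Fin n → Fin n → ℕ → A) : Prop :=
  ∀ i j k l r s, (g i j (r + 1) * g k l s - g k l s * g i j (r + 1)) -
    (g i j r * g k l (s + 1) - g k l (s + 1) * g i j r) = g k j r * g i l s - g k j s * g i l r

theorem coeff_dd_zero_right (b : A⟦X⟧⟦X⟧) (p : ℕ) :
    PowerSeries.coeff (p + 1) (PowerSeries.coeff 0 (dd A * b)) =
      - PowerSeries.coeff p (PowerSeries.coeff 0 b) := by
  simp [dd, sub_mul, PowerSeries.coeff_C_mul, PowerSeries.coeff_succ_X_mul]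

theorem coeff_dd_zero_left (b : A⟦X⟧⟦X⟧) (q : ℕ) :
    PowerSeries.coeff 0 (PowerSeries.coeff (q + 1) (dd A * b)) =
      PowerSeries.coeff 0 (PowerSeries.coeff q b) := by
  simp [dd, sub_mul, PowerSeries.coeff_C_mul, PowerSeries.coeff_succ_X_mul]

theorem coeff_dd_zero (b : A⟦X⟧⟦X⟧) :
    PowerSeries.coeff 0 (PowerSeries.coeff 0 (dd A * b)) = 0 := by
  simp [dd, sub_mul]

theorem coeff_dd (b : A⟦X⟧⟦X⟧) (p q : ℕ) :
    PowerSeries.coeff (p + 1) (PowerSeries.coeff (q + 1) (dd A * b)) =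
      PowerSeries.coeff (p + 1) (PowerSeries.coeff q b) -
        PowerSeries.coeff p (PowerSeries.coeff (q + 1) b) := by
  simp [dd, sub_mul, PowerSeries.coeff_C_mul, PowerSeries.coeff_succ_X_mul]

theorem coeff_ee (b : A⟦X⟧⟦X⟧) (p q : ℕ) :
    PowerSeries.coeff (p + 1) (PowerSeries.coeff (q + 1) (ee A * b)) =
      PowerSeries.coeff p (PowerSeries.coeff q b) := by
  simp [ee, mul_assoc, PowerSeries.coeff_C_mul, PowerSeries.coeff_succ_X_mul]

theorem coeff_ee_zero_right (b : A⟦X⟧⟦X⟧) (p : ℕ) :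
    PowerSeries.coeff p (PowerSeries.coeff 0 (ee A * b)) = 0 := by
  simp [ee, mul_assoc]

theorem coeff_ee_zero_left (b : A⟦X⟧⟦X⟧) (q : ℕ) :
    PowerSeries.coeff 0 (PowerSeries.coeff q (ee A * b)) = 0 := by
  rw [ee, X_comm, mul_assoc, PowerSeries.coeff_C_mul]
  simp

theorem coeffRel_iff {n : ℕ} (M : Matrix (Fin n) (Fin n) A⟦X⟧)
    (h0 : M.map PowerSeries.constantCoeff = 1) :
    CoeffRel (fun i j r => PowerSeries.coeff r (M i j)) ↔
      RTT (dd A) (ee A) (M.map inU) (M.map inV) := by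
  have h0' : ∀ i j, PowerSeries.coeff 0 (M i j) = if i = j then 1 else 0 := by
    intro i j
    simpa [Matrix.one_apply] using congrFun (congrFun h0 i) j
  constructor
  · intro h i j k l
    ext q p
    simp only [Matrix.map_apply]
    rcases q with _ | q <;> rcases p with _ | p
    · rw [coeff_dd_zero, coeff_ee_zero_right]
    · rw [coeff_dd_zero_right, coeff_ee_zero_right, map_sub, map_sub, coeff_uv, coeff_vu, h0']
      split_ifs <;> simp
    · rw [coeff_dd_zero_left, coeff_ee_zero_left, map_sub, map_sub, coeff_uv, coeff_vu, h0']
      split_ifs <;> simp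
    · rw [coeff_dd, coeff_ee]
      simp only [map_sub, coeff_uv, coeff_vu]
      exact h i j k l p q
  · intro h i j k l p q
    have := congrArg (fun b => PowerSeries.coeff (p + 1) (PowerSeries.coeff (q + 1) b)) (h i j k l)
    simp only [Matrix.map_apply, coeff_dd, coeff_ee] at this
    simpa only [map_sub, coeff_uv, coeff_vu] using this

end TwoVar

theorem coeff_T {n : ℕ} (i j : Fin n) (r : ℕ) : PowerSeries.coeff r (T n i j) = t i j r := by
  simp [T]

theorem rtt_T (n : ℕ) :
    RTT (dd (Yangian n)) (ee (Yangian n)) ((T n).map inU) ((T n).map inV) := by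
  rw [← coeffRel_iff _ (T_map_constantCoeff n)]
  intro i j k l r s
  simp only [coeff_T]
  exact t_rel i j k l r s

/-- The matrix series `T_{[1]}(u) T_{[2]}(u)` over `Y(n) ⊗ Y(n)`. -/
def T12 (n : ℕ) : Matrix (Fin n) (Fin n) (Yangian n ⊗[ℂ] Yangian n)⟦X⟧ :=
  (T n).map (PowerSeries.map
    (Algebra.TensorProduct.includeLeft : Yangian n →ₐ[ℂ] Yangian n ⊗[ℂ] Yangian n).toRingHom) *
  (T n).map (PowerSeries.map
    (Algebra.TensorProduct.includeRight : Yangian n →ₐ[ℂ] Yangian n ⊗[ℂ] Yangian n).toRingHom)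

theorem map_series_constantCoeff {n : ℕ} {A : Type*} [Ring A] (f : Yangian n →+* A) :
    ((T n).map (PowerSeries.map f)).map PowerSeries.constantCoeff = 1 := by
  ext i j
  have := congrFun (congrFun (T_map_constantCoeff n) i) j
  simp only [Matrix.map_apply] at this ⊢
  simp only [← PowerSeries.coeff_zero_eq_constantCoeff_apply, PowerSeries.coeff_map] at this ⊢
  rw [this, Matrix.one_apply, Matrix.one_apply]
  split_ifs <;> simp

theorem rtt_map {n : ℕ} {A : Type*} [Ring A] (f : Yangian n →+* A) :
    RTT (dd A) (ee A) (((T n).map (PowerSeries.map f)).map inU)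
      (((T n).map (PowerSeries.map f)).map inV) := by
  rw [← coeffRel_iff _ (map_series_constantCoeff f)]
  intro i j k l r s
  simp only [Matrix.map_apply, PowerSeries.coeff_map, coeff_T]
  simpa only [map_sub, map_mul] using congrArg f (t_rel i j k l r s)

theorem T12_constantCoeff (n : ℕ) : (T12 n).map PowerSeries.constantCoeff = 1 := by
  rw [T12, Matrix.map_mul, map_series_constantCoeff, map_series_constantCoeff, one_mul]

theorem coeffRel_T12 (n : ℕ) : CoeffRel fun i j r => PowerSeries.coeff r (T12 n i j) := by
  rw [coeffRel_iff _ (T12_constantCoeff n), T12, Matrix.map_mul, Matrix.map_mul]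
  refine RTT.mul dd_comm ee_comm (rtt_map _) (rtt_map _) ?_ ?_ <;>
  · intro i j k l
    ext q p
    simp only [Matrix.map_apply, coeff_uv, coeff_vu, PowerSeries.coeff_map]
    simp

/-- The coproduct `t_{ij}(u) ↦ ∑_a t_{ia}(u) ⊗ t_{aj}(u)`. -/
def comulHom (n : ℕ) : Yangian n →ₐ[ℂ] Yangian n ⊗[ℂ] Yangian n :=
  lift (fun i j r => PowerSeries.coeff r (T12 n i j))
    (fun i j => by
      simpa [Matrix.one_apply] using congrFun (congrFun (T12_constantCoeff n) i) j)
    (coeffRel_T12 n)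

theorem comulHom_t {n : ℕ} (i j : Fin n) (r : ℕ) : comulHom n (t i j r) =
    ∑ a, ∑ p ∈ Finset.HasAntidiagonal.antidiagonal r, t i a p.1 ⊗ₜ[ℂ] t a j p.2 := by
  refine (lift_t _ _ _ i j r).trans ?_
  simp [T12, Matrix.mul_apply, PowerSeries.coeff_mul, coeff_T]

/-- The counit `T(u) ↦ 1`. -/
def counitHom (n : ℕ) : Yangian n →ₐ[ℂ] ℂ :=
  lift (fun i j r => if r = 0 then (if i = j then 1 else 0) else 0) (fun i j => by simp)
    (fun i j k l r s => by
      have hc : ∀ a b : ℂ, a * b - b * a = 0 := fun a b => by ring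
      rw [hc, hc, sub_zero]
      rcases r with _ | r <;> rcases s with _ | s <;> simp)

theorem counitHom_t {n : ℕ} (i j : Fin n) (r : ℕ) : counitHom n (t i j r) =
    if r = 0 then (if i = j then 1 else 0) else 0 := by
  rw [counitHom, lift_t]

/-- The antipode `T(u) ↦ T⁻¹(u)`, as a homomorphism into the opposite algebra. -/
def antipodeHom (n : ℕ) : Yangian n →ₐ[ℂ] (Yangian n)ᵐᵒᵖ :=
  lift (fun i j r => MulOpposite.op (PowerSeries.coeff r (Tinv n i j)))
    (fun i j => by
      have := congrFun (congrFun (Tinv_map_constantCoeff n) i) j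
      simp only [Matrix.map_apply, Matrix.one_apply] at this
      rw [PowerSeries.coeff_zero_eq_constantCoeff_apply, this]
      split_ifs <;> simp)
    (fun i j k l r s => by
      have key : ∀ i j k l, dd (Yangian n) * ((Tinv n).map inV k l * (Tinv n).map inU i j -
          (Tinv n).map inU i j * (Tinv n).map inV k l) = ee (Yangian n) *
          ((Tinv n).map inV i l * (Tinv n).map inU k j -
          (Tinv n).map inU i l * (Tinv n).map inV k j) := by
        refine RTT.inv dd_comm ee_comm (rtt_T n) ?_ ?_ ?_ ?_ <;>
        · rw [← Matrix.map_mul]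
          first
          | rw [T_mul_Tinv]
          | rw [Tinv_mul_T]
          simp
      have := congrArg (fun b => PowerSeries.coeff (r + 1) (PowerSeries.coeff (s + 1) b))
        (key i j k l)
      simp only [Matrix.map_apply, coeff_dd, coeff_ee] at this
      simp only [map_sub, coeff_uv, coeff_vu] at this
      simp only [← MulOpposite.op_mul, ← MulOpposite.op_sub]
      exact congrArg MulOpposite.op this)

/-- The antipode as a linear map. -/
def antipodeLin (n : ℕ) : Yangian n →ₗ[ℂ] Yangian n :=
  (MulOpposite.opLinearEquiv ℂ).symm.toLinearMap ∘ₗ (antipodeHom n).toLinearMap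

theorem antipodeLin_t {n : ℕ} (i j : Fin n) (r : ℕ) :
    antipodeLin n (t i j r) = PowerSeries.coeff r (Tinv n i j) := by
  simp [antipodeLin, antipodeHom, lift_t]

theorem antipodeLin_mul {n : ℕ} (a b : Yangian n) :
    antipodeLin n (a * b) = antipodeLin n b * antipodeLin n a := by
  simp [antipodeLin]

theorem antipodeLin_one (n : ℕ) : antipodeLin n 1 = 1 := by
  simp [antipodeLin]

theorem sum_antidiagonal_assoc {M : Type*} [AddCommMonoid M] (r : ℕ) (f : ℕ → ℕ → ℕ → M) :
    ∑ p ∈ Finset.HasAntidiagonal.antidiagonal r,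
      ∑ q ∈ Finset.HasAntidiagonal.antidiagonal p.1, f q.1 q.2 p.2 =
    ∑ p ∈ Finset.HasAntidiagonal.antidiagonal r,
      ∑ q ∈ Finset.HasAntidiagonal.antidiagonal p.2, f p.1 q.1 q.2 := by
  rw [Finset.sum_sigma', Finset.sum_sigma']
  refine Finset.sum_nbij' (fun x => ⟨(x.2.1, x.2.2 + x.1.2), (x.2.2, x.1.2)⟩)
    (fun x => ⟨(x.1.1 + x.2.1, x.2.2), (x.1.1, x.2.1)⟩) ?_ ?_ ?_ ?_ ?_
  · rintro ⟨⟨a, b⟩, ⟨c, d⟩⟩ h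
    simp only [Finset.mem_sigma, Finset.HasAntidiagonal.mem_antidiagonal] at h ⊢
    obtain ⟨h1, h2⟩ := h
    exact ⟨by omega, trivial⟩
  · rintro ⟨⟨a, b⟩, ⟨c, d⟩⟩ h
    simp only [Finset.mem_sigma, Finset.HasAntidiagonal.mem_antidiagonal] at h ⊢
    obtain ⟨h1, h2⟩ := h
    exact ⟨by omega, trivial⟩
  · rintro ⟨⟨a, b⟩, ⟨c, d⟩⟩ h
    simp only [Finset.mem_sigma, Finset.HasAntidiagonal.mem_antidiagonal] at h
    obtain ⟨h1, rfl⟩ := h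
    rfl
  · rintro ⟨⟨a, b⟩, ⟨c, d⟩⟩ h
    simp only [Finset.mem_sigma, Finset.HasAntidiagonal.mem_antidiagonal] at h
    obtain ⟨h1, rfl⟩ := h
    rfl
  · rintro ⟨⟨a, b⟩, ⟨c, d⟩⟩ h
    rfl

theorem comulHom_coassoc (n : ℕ) :
    (Algebra.TensorProduct.assoc ℂ ℂ ℂ (Yangian n) (Yangian n) (Yangian n)).toAlgHom.comp
      ((Algebra.TensorProduct.map (comulHom n) (.id ℂ (Yangian n))).comp (comulHom n)) =
    (Algebra.TensorProduct.map (.id ℂ (Yangian n)) (comulHom n)).comp (comulHom n) := by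
  apply algHom_ext
  intro i j r
  simp only [AlgHom.comp_apply, comulHom_t, map_sum, Algebra.TensorProduct.map_tmul, AlgHom.id_apply,
    TensorProduct.sum_tmul, TensorProduct.tmul_sum]
  have e : ∀ x y w : Yangian n, (Algebra.TensorProduct.assoc ℂ ℂ ℂ (Yangian n) (Yangian n)
      (Yangian n)).toAlgHom ((x ⊗ₜ[ℂ] y) ⊗ₜ[ℂ] w) = x ⊗ₜ[ℂ] (y ⊗ₜ[ℂ] w) := fun _ _ _ => rfl
  simp only [e]
  calc _ = ∑ a, ∑ b, ∑ p ∈ Finset.HasAntidiagonal.antidiagonal r,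
        ∑ q ∈ Finset.HasAntidiagonal.antidiagonal p.1,
          t i b q.1 ⊗ₜ[ℂ] (t b a q.2 ⊗ₜ[ℂ] t a j p.2) :=
        Finset.sum_congr rfl fun a _ => Finset.sum_comm
    _ = ∑ b, ∑ a, ∑ p ∈ Finset.HasAntidiagonal.antidiagonal r,
        ∑ q ∈ Finset.HasAntidiagonal.antidiagonal p.2,
          t i b p.1 ⊗ₜ[ℂ] (t b a q.1 ⊗ₜ[ℂ] t a j q.2) := by
        rw [Finset.sum_comm]
        refine Finset.sum_congr rfl fun b _ => Finset.sum_congr rfl fun a _ => ?_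
        exact sum_antidiagonal_assoc r fun p q s => t i b p ⊗ₜ[ℂ] (t b a q ⊗ₜ[ℂ] t a j s)
    _ = _ := Finset.sum_congr rfl fun b _ => Finset.sum_comm

theorem comulHom_rTensor (n : ℕ) :
    (Algebra.TensorProduct.map (counitHom n) (.id ℂ (Yangian n))).comp (comulHom n) =
      (Algebra.TensorProduct.lid ℂ (Yangian n)).symm := by
  apply algHom_ext
  intro i j r
  simp only [AlgHom.comp_apply, comulHom_t, map_sum, Algebra.TensorProduct.map_tmul, AlgHom.id_apply,
    counitHom_t]
  rw [Finset.sum_eq_single i]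
  · rw [Finset.sum_eq_single (0, r)]
    · simp
    · rintro ⟨p, q⟩ h hne
      rw [Finset.HasAntidiagonal.mem_antidiagonal] at h
      rw [if_neg, TensorProduct.zero_tmul]
      rintro rfl
      simp_all
    · simp
  · intro b _ hb
    simp [hb.symm]
  · simp

theorem comulHom_lTensor (n : ℕ) :
    (Algebra.TensorProduct.map (.id ℂ (Yangian n)) (counitHom n)).comp (comulHom n) =
      (Algebra.TensorProduct.rid ℂ ℂ (Yangian n)).symm := by
  apply algHom_ext
  intro i j r
  simp only [AlgHom.comp_apply, comulHom_t, map_sum, Algebra.TensorProduct.map_tmul, AlgHom.id_apply,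
    counitHom_t]
  rw [Finset.sum_eq_single j]
  · rw [Finset.sum_eq_single (r, 0)]
    · simp
    · rintro ⟨p, q⟩ h hne
      rw [Finset.HasAntidiagonal.mem_antidiagonal] at h
      rw [if_neg, TensorProduct.tmul_zero]
      rintro rfl
      simp_all
    · simp
  · intro b _ hb
    simp [hb]
  · simp

/-- The coproduct and the counit make the Yangian a bialgebra. -/
instance (n : ℕ) : Bialgebra ℂ (Yangian n) :=
  Bialgebra.ofAlgHom (comulHom n) (counitHom n) (comulHom_coassoc n) (comulHom_rTensor n)
    (comulHom_lTensor n)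

theorem comul_t {n : ℕ} (i j : Fin n) (r : ℕ) : Coalgebra.comul (R := ℂ) (t i j r) =
    ∑ a, ∑ p ∈ Finset.HasAntidiagonal.antidiagonal r, t i a p.1 ⊗ₜ[ℂ] t a j p.2 := comulHom_t i j r

theorem counit_t {n : ℕ} (i j : Fin n) (r : ℕ) : Coalgebra.counit (R := ℂ) (t i j r) =
    if r = 0 then (if i = j then 1 else 0) else 0 := counitHom_t i j r

theorem mul_antipode_rTensor (n : ℕ) :
    LinearMap.mul' ℂ (Yangian n) ∘ₗ (antipodeLin n).rTensor (Yangian n) ∘ₗ Coalgebra.comul =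
      Algebra.linearMap ℂ (Yangian n) ∘ₗ Coalgebra.counit := by
  set G : Yangian n ⊗[ℂ] Yangian n →ₗ[ℂ] Yangian n :=
    LinearMap.mul' ℂ (Yangian n) ∘ₗ (antipodeLin n).rTensor (Yangian n) with hG
  have hGt : ∀ x y, G (x ⊗ₜ y) = antipodeLin n x * y := fun x y => by simp [hG]
  have hm : ∀ (x y : Yangian n) (p), G (p * (x ⊗ₜ y)) = antipodeLin n x * G p * y := by
    intro x y p
    induction p using TensorProduct.induction_on with
    | zero => simp
    | tmul a b =>
      rw [Algebra.TensorProduct.tmul_mul_tmul, hGt, hGt, antipodeLin_mul]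
      simp only [mul_assoc]
    | add p q hp hq => rw [add_mul, map_add, hp, hq, map_add, mul_add, add_mul]
  have hs : ∀ (p q) (c : ℂ), G p = algebraMap ℂ _ c → G (p * q) = algebraMap ℂ _ c * G q := by
    intro p q c hp
    induction q using TensorProduct.induction_on with
    | zero => simp
    | tmul x y => rw [hm, hp, hGt, ← Algebra.commutes, mul_assoc]
    | add q q' h h' => rw [mul_add, map_add, h, h', map_add, mul_add]
  have main : ∀ x : Yangian n, G (Coalgebra.comul (R := ℂ) x) =
      algebraMap ℂ _ (Coalgebra.counit (R := ℂ) x) := by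
    intro x
    let S : Subalgebra ℂ (Yangian n) :=
      { carrier := {x | G (Coalgebra.comul (R := ℂ) x) =
          algebraMap ℂ _ (Coalgebra.counit (R := ℂ) x)}
        mul_mem' := fun {a b} ha hb => by
          simp only [Set.mem_ofPred_eq] at ha hb ⊢
          rw [Bialgebra.comul_mul, hs _ _ _ ha, hb, Bialgebra.counit_mul, map_mul]
        add_mem' := fun {a b} ha hb => by
          simp only [Set.mem_ofPred_eq] at ha hb ⊢
          rw [map_add, map_add, ha, hb, map_add, map_add]
        algebraMap_mem' := fun c => by
          simp only [Set.mem_ofPred_eq]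
          rw [Bialgebra.comul_algebraMap, Algebra.TensorProduct.algebraMap_apply, hGt,
            mul_one, Bialgebra.counit_algebraMap, Algebra.algebraMap_eq_smul_one, map_smul,
            antipodeLin_one] }
    refine t_induction S (fun i j r => ?_) x
    change G _ = _
    rw [comul_t, counit_t]
    simp only [map_sum, hGt, antipodeLin_t]
    have := congrArg (PowerSeries.coeff r) (congrFun (congrFun (Tinv_mul_T n) i) j)
    simp only [Matrix.mul_apply, map_sum, PowerSeries.coeff_mul, coeff_T, Matrix.one_apply] at this
    rw [this]
    split_ifs <;> simp_all [PowerSeries.coeff_one]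
  exact LinearMap.ext main

theorem mul_antipode_lTensor (n : ℕ) :
    LinearMap.mul' ℂ (Yangian n) ∘ₗ (antipodeLin n).lTensor (Yangian n) ∘ₗ Coalgebra.comul =
      Algebra.linearMap ℂ (Yangian n) ∘ₗ Coalgebra.counit := by
  set G : Yangian n ⊗[ℂ] Yangian n →ₗ[ℂ] Yangian n :=
    LinearMap.mul' ℂ (Yangian n) ∘ₗ (antipodeLin n).lTensor (Yangian n) with hG
  have hGt : ∀ x y, G (x ⊗ₜ y) = x * antipodeLin n y := fun x y => by simp [hG]
  have hm : ∀ (x y : Yangian n) (p), G ((x ⊗ₜ y) * p) = x * G p * antipodeLin n y := by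
    intro x y p
    induction p using TensorProduct.induction_on with
    | zero => simp
    | tmul a b =>
      rw [Algebra.TensorProduct.tmul_mul_tmul, hGt, hGt, antipodeLin_mul]
      simp only [mul_assoc]
    | add p q hp hq => rw [mul_add, map_add, hp, hq, map_add, mul_add, add_mul]
  have hs : ∀ (p q) (c : ℂ), G q = algebraMap ℂ _ c → G (p * q) = algebraMap ℂ _ c * G p := by
    intro p q c hq
    induction p using TensorProduct.induction_on with
    | zero => simp
    | tmul x y => rw [hm, hq, hGt, ← Algebra.commutes, mul_assoc]
    | add q q' h h' => rw [add_mul, map_add, h, h', map_add, mul_add]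
  have main : ∀ x : Yangian n, G (Coalgebra.comul (R := ℂ) x) =
      algebraMap ℂ _ (Coalgebra.counit (R := ℂ) x) := by
    intro x
    let S : Subalgebra ℂ (Yangian n) :=
      { carrier := {x | G (Coalgebra.comul (R := ℂ) x) =
          algebraMap ℂ _ (Coalgebra.counit (R := ℂ) x)}
        mul_mem' := fun {a b} ha hb => by
          simp only [Set.mem_ofPred_eq] at ha hb ⊢
          rw [Bialgebra.comul_mul, hs _ _ _ hb, ha, Bialgebra.counit_mul, map_mul,
            Algebra.commutes]
        add_mem' := fun {a b} ha hb => by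
          simp only [Set.mem_ofPred_eq] at ha hb ⊢
          rw [map_add, map_add, ha, hb, map_add, map_add]
        algebraMap_mem' := fun c => by
          simp only [Set.mem_ofPred_eq]
          rw [Bialgebra.comul_algebraMap, Algebra.TensorProduct.algebraMap_apply, hGt,
            antipodeLin_one, mul_one, Bialgebra.counit_algebraMap] }
    refine t_induction S (fun i j r => ?_) x
    change G _ = _
    rw [comul_t, counit_t]
    simp only [map_sum, hGt, antipodeLin_t]
    have := congrArg (PowerSeries.coeff r) (congrFun (congrFun (T_mul_Tinv n) i) j)
    simp only [Matrix.mul_apply, map_sum, PowerSeries.coeff_mul, coeff_T, Matrix.one_apply] at this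
    rw [this]
    split_ifs <;> simp_all [PowerSeries.coeff_one]
  exact LinearMap.ext main

/-- The Hopf algebra structure of the Yangian, with antipode `T(u) ↦ T⁻¹(u)`. -/
instance (n : ℕ) : HopfAlgebra ℂ (Yangian n) where
  antipode := antipodeLin n
  mul_antipode_rTensor_comul := mul_antipode_rTensor n
  mul_antipode_lTensor_comul := mul_antipode_lTensor n

theorem antipode_t {n : ℕ} (i j : Fin n) (r : ℕ) :
    HopfAlgebra.antipode ℂ (t i j r) = PowerSeries.coeff r (Tinv n i j) := antipodeLin_t i j r

end GLYangian

end

/-!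
Contracting the RTT relation with `T⁻¹(u - n)`, the shift at which the entries of `T` and `T⁻¹`
contract to a scalar, shows that `z(u)` is central. Cancelling factors in the relation that defines
`qdet T(u)` gives `t_ij(u) qdet T(u - 1) = qdet T(u) z(u) t_ij(u)`, so that the defect of the
Liouville formula is a commutator with `t_ii(u)` times `t_ii(u)⁻¹`, for every `i`. If the first
coefficients of `qdet T(u)` are central, the next coefficient of the defect vanishes on summing over
`i`, because `∑ t_ii^(1)` is central; the formula in that degree then expresses the next coefficient
of `qdet T(u)` through those of `z(u)`, so it is central too.

That nothing else is central is seen from symbols: a filtration of the Yangian is compared with a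
polynomial ring on the generators, on which commutators induce the Poisson bracket of the current
algebra of `gl_n`. Symbols are well defined because tensor products of evaluation representations
on polynomials separate them, to leading order in a deformation parameter. The symbol of a central
element is in the Poisson center, which is generated by the traces `∑ t_ii^(r)`, and these are the
symbols of the coefficients of `qdet T(u)`. The coefficients of `z(u)` are independent because in
the representation `T(u) ↦ f(u) 1` the series `z(u)` acts by `f(u - n) / f(u)`, an arbitrary series
without term in `u⁻¹` and with constant term `1`.

Finally `S² T(u)` and `z(u + n) T(u + n)` have the same product with `T⁻¹(u)` in transposed order.
The endomorphism `S²` is unipotent for the filtration, hence bijective, and it fixes `qdet T(u)`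
because the central factors `z(u + n), …, z(u + 1)` turn `qdet T(u + n)` into `qdet T(u)`.
-/

noncomputable section

open PowerSeries TensorProduct

namespace GLYangian

/-! ### Substitution of central series into power series -/

section Substitution

variable {R S : Type*} [Ring R] [Ring S] {φ : R →+* S⟦X⟧} {g : S⟦X⟧}

theorem coeff_mul_pow_eq_zero (hg : constantCoeff g = 0) (x : S⟦X⟧) {m r : ℕ} (h : m < r) :
    coeff m (x * g ^ r) = 0 := by
  obtain ⟨g, rfl⟩ := X_dvd_iff.2 hg
  rw [(commute_X g).symm.mul_pow, ← mul_assoc, ((commute_X x).pow_right r).eq, mul_assoc,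
    coeff_X_pow_mul', if_neg h.not_ge]

theorem coeff_eval₂_congr (hg : constantCoeff g = 0) {p q : Polynomial R} {m : ℕ}
    (h : ∀ k ≤ m, p.coeff k = q.coeff k) : coeff m (p.eval₂ φ g) = coeff m (q.eval₂ φ g) := by
  rw [Polynomial.eval₂_eq_sum_range' φ (Nat.lt_succ_of_le (le_max_left _ q.natDegree)),
    Polynomial.eval₂_eq_sum_range' φ (Nat.lt_succ_of_le (le_max_right p.natDegree _)),
    map_sum, map_sum]
  refine Finset.sum_congr rfl fun r _ => ?_
  obtain hr | hr := le_or_gt r m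
  · rw [h r hr]
  · rw [coeff_mul_pow_eq_zero hg _ hr, coeff_mul_pow_eq_zero hg _ hr]

/-- The substitution `∑ f_r X^r ↦ ∑ φ(f_r) g^r` of a central series `g` without constant term. -/
def substHom (φ : R →+* S⟦X⟧) (g : S⟦X⟧) (hg : constantCoeff g = 0) (hc : ∀ x, Commute g x) :
    R⟦X⟧ →+* S⟦X⟧ where
  toFun f := PowerSeries.mk fun m => coeff m ((trunc (m + 1) f).eval₂ φ g)
  map_zero' := by ext m; simp
  map_add' a b := by ext m; simp [Polynomial.eval₂_add]
  map_one' := by ext m; simp [trunc_one]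
  map_mul' a b := by
    have coeff_mk_trunc (f : R⟦X⟧) {k m : ℕ} (hk : k < m + 1) :
        coeff k ((trunc (k + 1) f).eval₂ φ g) = coeff k ((trunc (m + 1) f).eval₂ φ g) :=
      coeff_eval₂_congr hg fun i hi => by rw [coeff_trunc, coeff_trunc, if_pos, if_pos] <;> omega
    ext m
    rw [coeff_mk, coeff_eval₂_congr (q := trunc (m + 1) a * trunc (m + 1) b) hg fun k hk => ?_,
      Polynomial.eval₂_mul_noncomm _ _ fun _ => (hc _).symm, coeff_mul, coeff_mul]
    · refine Finset.sum_congr rfl fun p hp => ?_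
      rw [Finset.HasAntidiagonal.mem_antidiagonal] at hp
      rw [coeff_mk, coeff_mk, coeff_mk_trunc a (m := m) (by omega),
        coeff_mk_trunc b (m := m) (by omega)]
    · rw [coeff_trunc, if_pos (by omega), coeff_mul, Polynomial.coeff_mul]
      refine Finset.sum_congr rfl fun p hp => ?_
      rw [Finset.HasAntidiagonal.mem_antidiagonal] at hp
      rw [coeff_trunc, coeff_trunc, if_pos (by omega), if_pos (by omega)]

variable (hg : constantCoeff g = 0) (hc : ∀ x, Commute g x)

theorem coeff_substHom_eq_coeff_eval₂ (f : R⟦X⟧) (m : ℕ) :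
    coeff m (substHom φ g hg hc f) = coeff m ((trunc (m + 1) f).eval₂ φ g) :=
  coeff_mk m fun m => coeff m ((trunc (m + 1) f).eval₂ φ g)

theorem coeff_substHom (f : R⟦X⟧) {m N : ℕ} (h : m < N) :
    coeff m (substHom φ g hg hc f) = ∑ r ∈ Finset.range N, coeff m (φ (coeff r f) * g ^ r) := by
  rw [← map_sum, ← eval₂_trunc_eq_sum_range, coeff_substHom_eq_coeff_eval₂]
  refine coeff_eval₂_congr hg fun k hk => ?_
  rw [coeff_trunc, coeff_trunc, if_pos (by omega), if_pos (by omega)]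

theorem substHom_C (x : R) : substHom φ g hg hc (C x) = φ x := by
  ext m
  rw [coeff_substHom_eq_coeff_eval₂, trunc_C, Polynomial.eval₂_C]

theorem substHom_X : substHom φ g hg hc X = g := by
  ext m
  rw [coeff_substHom hg hc X (show m < m + 2 by omega), ← map_sum, ← eval₂_trunc_eq_sum_range,
    trunc_X, Polynomial.eval₂_X]

end Substitution

/-! ### Shifts of the spectral parameter -/

section Shift

variable {A : Type*} [Ring A] [Algebra ℂ A]

/-- The series `(u + a)⁻¹`. -/
def invShift (a : ℂ) : ℂ⟦X⟧ := X * (1 + C a * X)⁻¹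

theorem constantCoeff_invShift (a : ℂ) : constantCoeff (invShift a) = 0 := by simp [invShift]

theorem invShift_zero : invShift 0 = X := by simp [invShift]

theorem invShift_mul (a : ℂ) : invShift a * (1 + C a * X) = X := by
  rw [invShift, mul_assoc, PowerSeries.inv_mul_cancel _ (by simp), mul_one]

theorem coeff_invShift_pow_self (a : ℂ) (r : ℕ) : coeff r (invShift a ^ r) = 1 := by
  rw [invShift, mul_pow, coeff_X_pow_mul']
  simp

theorem coeff_invShift_pow_succ (a : ℂ) (r : ℕ) :
    coeff (r + 1) (invShift a ^ r) = -(r * a) := by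
  have coeff_one_inv : coeff 1 ((1 + C a * X : ℂ⟦X⟧)⁻¹) = -a := by
    have h := congrArg (coeff 1) (PowerSeries.inv_mul_cancel (1 + C a * X : ℂ⟦X⟧) (by simp))
    rw [mul_add, mul_one, ← mul_assoc, map_add, coeff_succ_mul_X] at h
    simpa [coeff_one, add_eq_zero_iff_eq_neg] using h
  rw [invShift, mul_pow, coeff_X_pow_mul', if_pos (by omega), Nat.add_sub_cancel_left,
    coeff_one_pow, coeff_one_inv]
  simp

theorem commute_map_algebraMap (g : ℂ⟦X⟧) (x : A⟦X⟧) :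
    Commute (PowerSeries.map (algebraMap ℂ A) g) x := by
  ext m
  rw [coeff_mul, coeff_mul, ← Finset.Nat.sum_antidiagonal_swap]
  refine Finset.sum_congr rfl fun p _ => ?_
  simp only [coeff_map, Prod.fst_swap, Prod.snd_swap, Algebra.commutes]

/-- The shift `f(u) ↦ f(u + a)` as a ring homomorphism. -/
def shiftHom (A : Type*) [Ring A] [Algebra ℂ A] (a : ℂ) : A⟦X⟧ →+* A⟦X⟧ :=
  substHom C (PowerSeries.map (algebraMap ℂ A) (invShift a))
    (by rw [← coeff_zero_eq_constantCoeff_apply, coeff_map, coeff_zero_eq_constantCoeff_apply,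
      constantCoeff_invShift, map_zero]) (commute_map_algebraMap _)

theorem coeff_shift_of_lt (a : ℂ) (f : A⟦X⟧) {m N : ℕ} (h : m < N) :
    coeff m (shift a f) = ∑ r ∈ Finset.range N, coeff m (invShift a ^ r) • coeff r f := by
  rw [shift, coeff_mk, ← invShift]
  refine Finset.sum_subset (Finset.range_subset_range.2 h) fun r _ hr => ?_
  rw [Finset.mem_range, not_lt] at hr
  rw [← one_mul (_ ^ r), coeff_mul_pow_eq_zero (constantCoeff_invShift a) 1 hr, zero_smul]

theorem coeff_shift (a : ℂ) (f : A⟦X⟧) (m : ℕ) : coeff m (shift a f) =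
    ∑ r ∈ Finset.range (m + 1), coeff m (invShift a ^ r) • coeff r f :=
  coeff_shift_of_lt a f m.lt_succ_self

theorem shiftHom_apply (a : ℂ) (f : A⟦X⟧) : shiftHom A a f = shift a f := by
  ext m
  rw [shiftHom, coeff_substHom _ _ f m.lt_succ_self, coeff_shift]
  refine Finset.sum_congr rfl fun r _ => ?_
  rw [coeff_C_mul, ← map_pow, coeff_map, Algebra.smul_def, Algebra.commutes]

theorem shift_mul (a : ℂ) (f g : A⟦X⟧) : shift a (f * g) = shift a f * shift a g := by
  simp only [← shiftHom_apply, map_mul]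

theorem shift_add (a : ℂ) (f g : A⟦X⟧) : shift a (f + g) = shift a f + shift a g := by
  simp only [← shiftHom_apply, map_add]

theorem shift_one (a : ℂ) : shift a (1 : A⟦X⟧) = 1 := by
  simp only [← shiftHom_apply, map_one]

theorem shift_zero_series (a : ℂ) : shift a (0 : A⟦X⟧) = 0 := by
  simp only [← shiftHom_apply, map_zero]

theorem shift_sum {ι : Type*} (a : ℂ) (s : Finset ι) (f : ι → A⟦X⟧) :
    shift a (∑ i ∈ s, f i) = ∑ i ∈ s, shift a (f i) := by
  simp only [← shiftHom_apply, map_sum]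

theorem shift_C (a : ℂ) (x : A) : shift a (C x) = C x := by
  rw [← shiftHom_apply, shiftHom, substHom_C]

theorem shift_X (a : ℂ) : shift a (X : A⟦X⟧) = PowerSeries.map (algebraMap ℂ A) (invShift a) := by
  rw [← shiftHom_apply, shiftHom, substHom_X]

theorem shift_X_mul_comm (a : ℂ) (x : A⟦X⟧) : shift a X * x = x * shift a X := by
  rw [shift_X, (commute_map_algebraMap _ x).eq]

theorem shift_X_mul (a : ℂ) : shift a (X : A⟦X⟧) * (1 + a • X) = X := by
  have map_one_add : PowerSeries.map (algebraMap ℂ A) (1 + C a * X) = 1 + a • X := by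
    ext m
    simp [coeff_one, coeff_X, Algebra.algebraMap_eq_smul_one]
  rw [shift_X, ← map_one_add, ← map_mul, invShift_mul, map_X]

theorem coeff_one_shift (a : ℂ) (f : A⟦X⟧) : coeff 1 (shift a f) = coeff 1 f := by
  rw [coeff_shift, Finset.sum_range_succ, Finset.sum_range_one, coeff_invShift_pow_self,
    pow_zero, coeff_one, if_neg one_ne_zero, zero_smul, one_smul, zero_add]

theorem coeff_shift_succ (a : ℂ) (f : A⟦X⟧) (m : ℕ) : coeff (m + 1) (shift a f) =
    ∑ r ∈ Finset.range m, coeff (m + 1) (invShift a ^ r) • coeff r f +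
      (-(m * a)) • coeff m f + coeff (m + 1) f := by
  rw [coeff_shift, Finset.sum_range_succ, Finset.sum_range_succ, coeff_invShift_pow_self,
    coeff_invShift_pow_succ, one_smul]

theorem shift_zero (f : A⟦X⟧) : shift 0 f = f := by
  ext m
  rw [coeff_shift, invShift_zero, Finset.sum_eq_single m]
  · rw [coeff_X_pow_self, one_smul]
  · intro r _ hr
    rw [coeff_X_pow, if_neg hr.symm, zero_smul]
  · simp

theorem shift_invShift (a b : ℂ) : shift a (invShift b) = invShift (a + b) := by
  have hX : shift a (X : ℂ⟦X⟧) = invShift a := by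
    rw [shift_X, Algebra.algebraMap_self, PowerSeries.map_id, id_eq]
  have hb := congrArg (shift a) (invShift_mul b)
  rw [shift_mul, shift_add, shift_one, shift_mul, hX, shift_C] at hb
  have shift_mul_denom : shift a (invShift b) * (1 + C (a + b) * X) = X := by
    rw [map_add]
    linear_combination (1 + C a * X) * hb + (1 - shift a (invShift b) * C b) * invShift_mul a
  have denom_ne_zero : (1 + C (a + b) * X : ℂ⟦X⟧) ≠ 0 := fun h => by
    simpa using congrArg constantCoeff h
  exact mul_right_cancel₀ denom_ne_zero (shift_mul_denom.trans (invShift_mul (a + b)).symm)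

theorem shift_shift (a b : ℂ) (f : A⟦X⟧) : shift a (shift b f) = shift (a + b) f := by
  have shift_invShift_pow (s : ℕ) : shift a (invShift b ^ s) = invShift (a + b) ^ s := by
    rw [← shift_invShift, ← shiftHom_apply, ← shiftHom_apply, map_pow]
  ext m
  calc coeff m (shift a (shift b f))
      = ∑ r ∈ Finset.range (m + 1), ∑ s ∈ Finset.range (m + 1),
          (coeff m (invShift a ^ r) * coeff r (invShift b ^ s)) • coeff s f := by
        rw [coeff_shift]
        refine Finset.sum_congr rfl fun r hr => ?_
        simp only [coeff_shift_of_lt b f (Finset.mem_range.1 hr), Finset.smul_sum, smul_smul]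
    _ = ∑ s ∈ Finset.range (m + 1), coeff m (shift a (invShift b ^ s)) • coeff s f := by
        rw [Finset.sum_comm]
        simp only [coeff_shift a (invShift b ^ _), Finset.sum_smul, smul_eq_mul]
    _ = coeff m (shift (a + b) f) := by simp only [shift_invShift_pow, coeff_shift]

theorem map_shift {A' : Type*} [Ring A'] [Algebra ℂ A'] (φ : A →ₐ[ℂ] A') (a : ℂ) (f : A⟦X⟧) :
    PowerSeries.map (φ : A →+* A') (shift a f) = shift a (PowerSeries.map (φ : A →+* A') f) := by
  ext m
  simp [coeff_shift, map_sum]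

theorem coeff_shift_mem (S : Submodule ℂ A) (a : ℂ) {f : A⟦X⟧} (hf : ∀ r, coeff r f ∈ S)
    (r : ℕ) : coeff r (shift a f) ∈ S := by
  rw [coeff_shift]
  exact S.sum_mem fun s _ => S.smul_mem _ (hf s)

end Shift

/-! ### Specialization of identities in two variables -/

section Specialization

variable {A : Type*} [Ring A]

theorem inV_X : inV (X : A⟦X⟧) = X := by simp [inV]

theorem inU_X : inU (X : A⟦X⟧) = C X := by simp [inU]

theorem eq_zero_of_X_mul {x : A⟦X⟧} (h : X * x = 0) : x = 0 := by
  ext m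
  simpa [coeff_succ_X_mul] using congrArg (coeff (m + 1)) h

/-- The specialization `v = u` of a series in `u⁻¹` and `v⁻¹`. -/
def diag (A : Type*) [Ring A] : A⟦X⟧⟦X⟧ →+* A⟦X⟧ :=
  substHom (RingHom.id _) X (by simp) fun x => (PowerSeries.commute_X x).symm

theorem diag_inU (f : A⟦X⟧) : diag A (inU f) = f := by
  rw [diag, inU, substHom_C, RingHom.id_apply]

theorem diag_inV (f : A⟦X⟧) : diag A (inV f) = f := by
  ext m
  rw [diag, coeff_substHom _ _ _ m.lt_succ_self, Finset.sum_eq_single m]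
  · simp [inV, coeff_mul_X_pow']
  · intro r hr hrm
    rw [Finset.mem_range] at hr
    rw [inV, coeff_map, RingHom.id_apply, coeff_mul_X_pow', if_pos (by omega), coeff_C,
      if_neg (by omega)]
  · simp

variable [Algebra ℂ A]

theorem shift_inU (a : ℂ) (f : A⟦X⟧) : shift a (inU f) = inU f := shift_C a f

theorem shift_inV (a : ℂ) (f : A⟦X⟧) : shift a (inV f) = inV (shift a f) := by
  ext q p
  simp only [coeff_shift, inV, coeff_map, map_sum, coeff_smul, coeff_C, smul_ite, smul_zero]

/-- Both sides are divided by `ee`, that is by `1 / (u (u - a))`, after setting `v = u - a`. -/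
theorem smul_diag_shift_eq {b c : A⟦X⟧⟦X⟧} (h : dd A * b = ee A * c) (a : ℂ) :
    a • diag A (shift (-a) b) = diag A (shift (-a) c) := by
  set g : A⟦X⟧ := shift (-a) X
  have diag_X : diag A (shift (-a) X) = g := by rw [← inV_X, shift_inV, diag_inV]
  have diag_C_X : diag A (shift (-a) (C X)) = X := by rw [← inU_X, shift_inU, diag_inU]
  have hdiag := congrArg (fun x => diag A (shiftHom _ (-a) x)) h
  simp only [dd, ee, map_mul, map_sub, shiftHom_apply, diag_X, diag_C_X] at hdiag
  have g_mul : g * (1 + (-a) • X) = X := shift_X_mul (-a)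
  have g_sub_X : g - X = a • (g * X) := by
    rw [mul_add, mul_one, mul_smul_comm, neg_smul, add_neg_eq_iff_eq_add] at g_mul
    rw [sub_eq_iff_eq_add', ← g_mul]
  have X_mul_X_mul : X * (X * (a • diag A (shift (-a) b) - diag A (shift (-a) c))) = 0 := by
    nth_rewrite 1 [← g_mul]
    rw [shift_X_mul_comm, mul_assoc, ← mul_assoc g, mul_sub (g * X), ← hdiag, g_sub_X,
      mul_smul_comm, smul_mul_assoc, sub_self, mul_zero]
  exact sub_eq_zero.1 (eq_zero_of_X_mul (eq_zero_of_X_mul X_mul_X_mul))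

theorem dd_add_smul_ee_mul_shift {b c : A⟦X⟧⟦X⟧} (h : dd A * b = ee A * c) (a : ℂ) :
    (dd A + a • ee A) * shift (-a) b = ee A * shift (-a) c := by
  have hshift := congrArg (fun x => (1 + (-a) • X) * shiftHom _ (-a) x) h
  have mul_shift_X : (1 + (-a) • X) * shift (-a) (X : A⟦X⟧⟦X⟧) = X := by
    rw [← shift_X_mul_comm, shift_X_mul]
  simp only [dd, ee, map_mul, map_sub, shiftHom_apply, shift_C] at hshift
  rw [← mul_assoc, ← mul_assoc, mul_sub, ← mul_assoc, mul_shift_X] at hshift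
  rw [dd, ee, ← hshift]
  congr 1
  simp only [add_mul, one_mul, neg_smul, neg_mul, smul_mul_assoc]
  abel

/-- In terms of the outer variable, `dd A + a • ee A` is `-C X` plus a multiple of `X`. -/
theorem eq_zero_of_dd_add_mul {b : A⟦X⟧⟦X⟧} {a : ℂ} (h : (dd A + a • ee A) * b = 0) : b = 0 := by
  have dd_add_eq : dd A + a • ee A = X * (1 + a • C X) - C X := by
    rw [dd, ee, mul_add, mul_one, mul_smul_comm]
    abel
  rw [dd_add_eq, sub_mul, sub_eq_zero, mul_assoc] at h
  ext1 q
  induction q with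
  | zero =>
    refine eq_zero_of_X_mul ?_
    rw [← coeff_C_mul, ← h, coeff_zero_X_mul]
  | succ q ih =>
    refine eq_zero_of_X_mul ?_
    rw [← coeff_C_mul, ← h, coeff_succ_X_mul, add_mul, one_mul, smul_mul_assoc, map_add,
      coeff_smul, coeff_C_mul, ih]
    simp

end Specialization

/-! ### Centrality of `z(u)` -/

section Contraction

variable {K B : Type*} [CommRing K] [Ring B] [Algebra K B] {n : ℕ} {D E : K}
  {Z t m : Matrix (Fin n) (Fin n) B} {w : B}

theorem smul_Z_mul_t
    (hZt : ∀ a b i j, D • (Z a b * t i j - t i j * Z a b) = E • (Z i b * t a j - t i b * Z a j))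
    (a b i : Fin n) : (D ^ 2 - E ^ 2) • (Z a b * t i b) =
      (D - E) • (D • (t i b * Z a b) + E • (t a b * Z i b)) := by
  linear_combination (norm := module) D • hZt a b i b + E • hZt i b a b

/-- The term through which the left multiplication by `Z` fails to commute with the contraction
`∑ i, t i b * m i b`; it cancels in `contraction_commutes`. -/
def contractionDefect (D E : K) (Z m : Matrix (Fin n) (Fin n) B) (b : Fin n) : B :=
  D • ∑ c, m c b * Z c b + E • ∑ d, ∑ c, m c d * Z c d

theorem smul_Z_mul_m
    (hZm : ∀ a b i k, (D + n * E) • (Z a b * m i k - m i k * Z a b) =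
      E • ((if k = b then ∑ c, Z a c * m i c else 0) - if a = i then ∑ c, m c k * Z c b else 0))
    (a b i : Fin n) : ((D + n * E) * D) • (Z a b * m i b) =
      ((D + n * E) * D) • (m i b * Z a b) + ((D + n * E) * E) • ∑ c, m i c * Z a c -
        if a = i then E • contractionDefect D E Z m b else 0 := by
  have smul_row : D • ∑ c, Z a c * m i c = (D + n * E) • ∑ c, m i c * Z a c -
      E • if a = i then ∑ d, ∑ c, m c d * Z c d else 0 := by
    have h := Finset.sum_congr rfl fun c (_ : c ∈ Finset.univ) => hZm a c i c
    simp only [if_true, ← Finset.smul_sum, Finset.sum_sub_distrib, Finset.sum_const,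
      Finset.card_univ, Fintype.card_fin, ← Nat.cast_smul_eq_nsmul K] at h
    split_ifs at h ⊢
    · linear_combination (norm := module) h
    · simp only [Finset.sum_const_zero] at h
      linear_combination (norm := module) h
  have h := hZm a b i b
  simp only [if_true] at h
  rw [contractionDefect]
  split_ifs at smul_row h ⊢ <;> linear_combination (norm := module) D • h + E • smul_row

theorem smul_sum_t_mul_Z_mul_m
    (hZm : ∀ a b i k, (D + n * E) • (Z a b * m i k - m i k * Z a b) =
      E • ((if k = b then ∑ c, Z a c * m i c else 0) - if a = i then ∑ c, m c k * Z c b else 0))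
    (htm : ∀ j k, ∑ i, t i j * m i k = if j = k then w else 0) (a b : Fin n) :
    ((D + n * E) * D) • ∑ i, t i b * (Z a b * m i b) =
      ((D + n * E) * (D + E)) • (w * Z a b) - E • (t a b * contractionDefect D E Z m b) := by
  have sum_row : ∑ i, t i b * ∑ c, m i c * Z a c = w * Z a b := by
    simp only [Finset.mul_sum, ← mul_assoc]
    rw [Finset.sum_comm]
    simp only [← Finset.sum_mul, htm, ite_mul, zero_mul, Finset.sum_ite_eq, Finset.mem_univ,
      if_true]
  have sum_column : ∑ i, t i b * (m i b * Z a b) = w * Z a b := by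
    simp only [← mul_assoc, ← Finset.sum_mul, htm, if_true]
  simp only [Finset.smul_sum, ← mul_smul_comm, smul_Z_mul_m hZm a b, mul_sub, mul_add,
    Finset.sum_sub_distrib, Finset.sum_add_distrib, mul_ite, mul_zero, Finset.sum_ite_eq,
    Finset.mem_univ, if_true]
  simp only [mul_smul_comm, ← Finset.smul_sum, sum_row, sum_column]
  module

theorem smul_sum_Z_mul_m
    (hZm : ∀ a b i k, (D + n * E) • (Z a b * m i k - m i k * Z a b) =
      E • ((if k = b then ∑ c, Z a c * m i c else 0) - if a = i then ∑ c, m c k * Z c b else 0))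
    (b : Fin n) :
    ((D + n * E) * D) • ∑ i, Z i b * m i b = D • contractionDefect D E Z m b := by
  simp only [Finset.smul_sum, smul_Z_mul_m hZm, if_true, Finset.sum_sub_distrib,
    Finset.sum_add_distrib, Finset.sum_const, Finset.card_univ, Fintype.card_fin]
  simp only [← Finset.smul_sum, ← Nat.cast_smul_eq_nsmul K, contractionDefect]
  rw [Finset.sum_comm]
  module

theorem contraction_commutes
    (hZt : ∀ a b i j, D • (Z a b * t i j - t i j * Z a b) = E • (Z i b * t a j - t i b * Z a j))
    (hZm : ∀ a b i k, (D + n * E) • (Z a b * m i k - m i k * Z a b) =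
      E • ((if k = b then ∑ c, Z a c * m i c else 0) - if a = i then ∑ c, m c k * Z c b else 0))
    (htm : ∀ j k, ∑ i, t i j * m i k = if j = k then w else 0) (a b : Fin n) :
    ((D + n * E) * D * (D ^ 2 - E ^ 2)) • (Z a b * w - w * Z a b) = 0 := by
  have smul_Z_mul_w : (D ^ 2 - E ^ 2) • (Z a b * w) =
      (D - E) • (D • ∑ i, t i b * (Z a b * m i b) + E • (t a b * ∑ i, Z i b * m i b)) := by
    have hw : w = ∑ i, t i b * m i b := by rw [htm, if_pos rfl]
    simp only [hw, Finset.mul_sum, Finset.smul_sum, ← Finset.sum_add_distrib, ← mul_assoc,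
      ← smul_mul_assoc, ← add_mul, smul_Z_mul_t hZt]
  have h := congrArg (t a b * ·) (smul_sum_Z_mul_m hZm b)
  simp only [mul_smul_comm] at h
  linear_combination (norm := module) ((D + n * E) * D) • smul_Z_mul_w +
    ((D - E) * D) • smul_sum_t_mul_Z_mul_m hZm htm a b + ((D - E) * E) • h

end Contraction

section ExchangeWithInverse

variable {n : ℕ} {B : Type*} [Ring B] {D E : B}

theorem leg2_mul_Rmat_mul_leg1_apply (hD : ∀ b, D * b = b * D) (hE : ∀ b, E * b = b * E)
    (U V : Matrix (Fin n) (Fin n) B) (i j k l : Fin n) :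
    (leg2 V * (Rmat n D E * leg1 U)) (i, k) (j, l) =
      D * (V k l * U i j) - E * if i = l then (V * U) k j else 0 := by
  simp only [leg2_mul_apply, Rmat_mul]
  simp only [leg1, Matrix.of_apply, Prod.swap, Matrix.mul_apply, mul_ite, mul_sub, mul_zero,
    ← mul_assoc, ← hD, ← hE, Finset.sum_sub_distrib, Finset.sum_ite_eq', Finset.mem_univ, if_true,
    Finset.mul_sum]
  split_ifs <;> simp

theorem leg1_mul_Rmat_mul_leg2_apply (hD : ∀ b, D * b = b * D) (hE : ∀ b, E * b = b * E)
    (U V : Matrix (Fin n) (Fin n) B) (i j k l : Fin n) :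
    (leg1 U * (Rmat n D E * leg2 V)) (i, k) (j, l) =
      D * (U i j * V k l) - E * if k = j then (U * V) i l else 0 := by
  simp only [leg1_mul_apply, Rmat_mul]
  simp only [leg2, Matrix.of_apply, Prod.swap, Matrix.mul_apply, mul_ite, mul_sub, mul_zero,
    ← mul_assoc, ← hD, ← hE, Finset.sum_sub_distrib, Finset.sum_ite_eq', Finset.mem_univ, if_true,
    Finset.mul_sum]
  split_ifs <;> simp

theorem RTT.inv_right (hD : ∀ b, D * b = b * D) (hE : ∀ b, E * b = b * E)
    {U V V' : Matrix (Fin n) (Fin n) B} (h : RTT D E U V) (hV : V * V' = 1) (hV' : V' * V = 1)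
    (i j k l : Fin n) : D * (U i j * V' k l - V' k l * U i j) =
      E * ((if k = j then (U * V') i l else 0) - if i = l then (V' * U) k j else 0) := by
  rw [RTT_iff hD hE] at h
  have hleg : leg2 V * leg2 V' = 1 := by rw [← leg2_mul, hV, leg2_one]
  have hleg' : leg2 V' * leg2 V = 1 := by rw [← leg2_mul, hV', leg2_one]
  have conj : leg2 V' * (Rmat n D E * leg1 U) = leg1 U * (Rmat n D E * leg2 V') := by
    calc leg2 V' * (Rmat n D E * leg1 U)
        = leg2 V' * (Rmat n D E * (leg1 U * leg2 V)) * leg2 V' := by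
          simp only [mul_assoc, hleg, mul_one]
      _ = (leg2 V' * leg2 V) * leg1 U * Rmat n D E * leg2 V' := by
          rw [h]; simp only [mul_assoc]
      _ = leg1 U * (Rmat n D E * leg2 V') := by rw [hleg', one_mul, mul_assoc]
  have entry := congrFun (congrFun conj (i, k)) (j, l)
  rw [leg2_mul_Rmat_mul_leg1_apply hD hE, leg1_mul_Rmat_mul_leg2_apply hD hE] at entry
  rw [mul_sub, mul_sub, sub_eq_sub_iff_sub_eq_sub, entry]

end ExchangeWithInverse

section CentralSeries

variable {A : Type*} [Ring A] [Algebra ℂ A]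

theorem shift_sub_series (a : ℂ) (f g : A⟦X⟧) : shift a (f - g) = shift a f - shift a g := by
  simp only [← shiftHom_apply, map_sub]

theorem diag_shift_inU_mul_inV (f g : A⟦X⟧) (a : ℂ) :
    diag A (shift a (inU f * inV g)) = f * shift a g := by
  rw [shift_mul, shift_inU, shift_inV, map_mul, diag_inU, diag_inV]

theorem diag_shift_inV_mul_inU (f g : A⟦X⟧) (a : ℂ) :
    diag A (shift a (inV g * inU f)) = shift a g * f := by
  rw [shift_mul, shift_inU, shift_inV, map_mul, diag_inU, diag_inV]

theorem commute_of_coeff_mem_center {f : A⟦X⟧} (hf : ∀ r, coeff r f ∈ Subalgebra.center ℂ A)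
    (g : A⟦X⟧) : f * g = g * f := by
  ext m
  rw [coeff_mul, coeff_mul, ← Finset.Nat.sum_antidiagonal_swap]
  exact Finset.sum_congr rfl fun p _ => (Subalgebra.mem_center_iff.1 (hf _) _).symm

theorem coeff_mem_center_of_commute {f : A⟦X⟧} (hf : ∀ x : A, f * C x = C x * f) (r : ℕ) :
    coeff r f ∈ Subalgebra.center ℂ A := by
  refine Subalgebra.mem_center_iff.2 fun b => ?_
  simpa using (congrArg (coeff r) (hf b)).symm

end CentralSeries

section ZCentral

variable {n : ℕ}

theorem dd_mul_T_Tinv (i j k l : Fin n) :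
    dd (Yangian n) * (inU (T n i j) * inV (Tinv n k l) - inV (Tinv n k l) * inU (T n i j)) =
      ee (Yangian n) * ((if k = j then ∑ p, inU (T n i p) * inV (Tinv n p l) else 0) -
        if i = l then ∑ p, inV (Tinv n k p) * inU (T n p j) else 0) :=
  (rtt_T n).inv_right dd_comm ee_comm (V' := (Tinv n).map inV)
    (by rw [← Matrix.map_mul, T_mul_Tinv, Matrix.map_one _ (map_zero _) (map_one _)])
    (by rw [← Matrix.map_mul, Tinv_mul_T, Matrix.map_one _ (map_zero _) (map_one _)]) i j k l

theorem dd_add_smul_ee_mul_T_Tinv_shift (a : ℂ) (i j k l : Fin n) :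
    (dd (Yangian n) + a • ee (Yangian n)) * (inU (T n i j) * inV (shift (-a) (Tinv n k l)) -
      inV (shift (-a) (Tinv n k l)) * inU (T n i j)) =
      ee (Yangian n) * ((if k = j then ∑ p, inU (T n i p) * inV (shift (-a) (Tinv n p l)) else 0) -
        if i = l then ∑ p, inV (shift (-a) (Tinv n k p)) * inU (T n p j) else 0) := by
  have h := dd_add_smul_ee_mul_shift (dd_mul_T_Tinv i j k l) a
  simpa only [shift_sub_series, shift_mul, shift_inU, shift_inV, apply_ite (shift (-a)), shift_sum,
    shift_zero_series] using h

theorem smul_T_Tinv_shift (i j k l : Fin n) (a : ℂ) :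
    a • (T n i j * shift (-a) (Tinv n k l) - shift (-a) (Tinv n k l) * T n i j) =
      (if k = j then ∑ p, T n i p * shift (-a) (Tinv n p l) else 0) -
        if i = l then ∑ p, shift (-a) (Tinv n k p) * T n p j else 0 := by
  have h := smul_diag_shift_eq (dd_mul_T_Tinv i j k l) a
  simpa only [shift_sub_series, map_sub, diag_shift_inU_mul_inV, diag_shift_inV_mul_inU,
    apply_ite (shift (-a)), apply_ite (diag _), shift_sum, map_sum, shift_zero_series, map_zero]
    using h

theorem smul_T_T_shift (i j k l : Fin n) (a : ℂ) :
    a • (T n i j * shift (-a) (T n k l) - shift (-a) (T n k l) * T n i j) =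
      T n k j * shift (-a) (T n i l) - shift (-a) (T n k j) * T n i l := by
  simpa only [Matrix.map_apply, shift_sub_series, map_sub, diag_shift_inU_mul_inV,
    diag_shift_inV_mul_inU] using smul_diag_shift_eq (rtt_T n i j k l) a

theorem sum_T_mul_Tinv_shift (hn : 0 < n) (j k : Fin n) :
    ∑ i, T n i j * shift (-(n : ℂ)) (Tinv n k i) = if j = k then zInv n else 0 := by
  have h := Finset.sum_congr rfl fun i (_ : i ∈ Finset.univ) => smul_T_Tinv_shift i j k i n
  simp only [if_true, Finset.sum_sub_distrib, ← Finset.smul_sum, Finset.sum_const,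
    Finset.card_univ, Fintype.card_fin, ← Nat.cast_smul_eq_nsmul ℂ, smul_sub] at h
  have hn' : (n : ℂ) ≠ 0 := by exact_mod_cast hn.ne'
  rw [← smul_right_inj hn', sub_left_inj.1 h, zInv, smul_ite, smul_smul, mul_one_div_cancel hn',
    one_smul, smul_zero]
  obtain rfl | hjk := eq_or_ne j k
  · simp [Matrix.trace, Matrix.mul_apply]
  · simp [hjk, hjk.symm]

theorem sum_Tinv_shift_mul_T (hn : 0 < n) (i l : Fin n) :
    ∑ j, shift (-(n : ℂ)) (Tinv n j l) * T n i j =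
      if i = l then (1 / n : ℂ) • ((Tinv n).map (shift (-(n : ℂ))) * T n).trace else 0 := by
  have h := Finset.sum_congr rfl fun j (_ : j ∈ Finset.univ) => smul_T_Tinv_shift i j j l n
  simp only [if_true, Finset.sum_sub_distrib, ← Finset.smul_sum, Finset.sum_const,
    Finset.card_univ, Fintype.card_fin, ← Nat.cast_smul_eq_nsmul ℂ, smul_sub] at h
  have hn' : (n : ℂ) ≠ 0 := by exact_mod_cast hn.ne'
  rw [← smul_right_inj hn', sub_right_inj.1 h, smul_ite, smul_smul, mul_one_div_cancel hn',
    one_smul, smul_zero]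
  split_ifs <;> simp [Matrix.trace, Matrix.mul_apply]

theorem inU_T_mul_inV_zInv (hn : 0 < n) (i j : Fin n) :
    inU (T n i j) * inV (zInv n) = inV (zInv n) * inU (T n i j) := by
  let K := Subring.center (Yangian n)⟦X⟧⟦X⟧
  let D : K := ⟨dd _, Subring.mem_center_iff.2 fun x => (dd_comm x).symm⟩
  let E : K := ⟨ee _, Subring.mem_center_iff.2 fun x => (ee_comm x).symm⟩
  have add_smul_eq (a : ℕ) (x : (Yangian n)⟦X⟧⟦X⟧) :
      (D + a * E) • x = (dd (Yangian n) + (a : ℂ) • ee (Yangian n)) * x := by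
    rw [add_smul, mul_smul, Nat.cast_smul_eq_nsmul, Nat.cast_smul_eq_nsmul, add_mul,
      smul_mul_assoc]
    rfl
  have sub_smul_eq (x : (Yangian n)⟦X⟧⟦X⟧) :
      (D - E) • x = (dd (Yangian n) + (-1 : ℂ) • ee (Yangian n)) * x := by
    rw [sub_smul, add_mul, neg_smul, one_smul, neg_mul, ← sub_eq_add_neg]
    rfl
  have h := contraction_commutes (D := D) (E := E) (Z := (T n).map inU) (t := (T n).map inV)
    (m := Matrix.of fun i k => inV (shift (-(n : ℂ)) (Tinv n k i))) (w := inV (zInv n))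
    (rtt_T n)
    (fun a b i k => (add_smul_eq n _).trans (dd_add_smul_ee_mul_T_Tinv_shift n a b k i))
    (fun j k => by
      simpa only [map_sum, map_mul, apply_ite inV, map_zero, Matrix.map_apply,
        Matrix.of_apply] using congrArg inV (sum_T_mul_Tinv_shift hn j k)) i j
  have factor : (D + n * E) * D * (D ^ 2 - E ^ 2) =
      (D + n * E) * ((D + (0 : ℕ) * E) * ((D + (1 : ℕ) * E) * (D - E))) := by
    push_cast; ring
  rw [factor, mul_smul, mul_smul, mul_smul, add_smul_eq, add_smul_eq, add_smul_eq, sub_smul_eq] at h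
  exact sub_eq_zero.1 <| eq_zero_of_dd_add_mul <| eq_zero_of_dd_add_mul <|
    eq_zero_of_dd_add_mul <| eq_zero_of_dd_add_mul h

theorem mem_center_of_commute_t {x : Yangian n} (h : ∀ i j r, t i j r * x = x * t i j r) :
    x ∈ Subalgebra.center ℂ (Yangian n) := by
  refine Subalgebra.mem_center_iff.2 fun b => ?_
  have hb := t_induction (Subalgebra.centralizer ℂ {x}) (fun i j r => by
    simpa [Subalgebra.mem_centralizer_iff] using (h i j r).symm) b
  exact (Subalgebra.mem_centralizer_iff ℂ |>.1 hb x rfl).symm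

theorem coeff_zInv_mem_center (hn : 0 < n) (r : ℕ) :
    coeff r (zInv n) ∈ Subalgebra.center ℂ (Yangian n) :=
  mem_center_of_commute_t fun i j s => by
    simpa only [coeff_uv, coeff_vu, coeff_T] using
      congrArg (fun b => coeff s (coeff r b)) (inU_T_mul_inV_zInv hn i j)

theorem z_mul_zInv (hn : 0 < n) : z n * zInv n = 1 := Ring.inverse_mul_cancel _ (isUnit_zInv n hn)

theorem zInv_mul_z (hn : 0 < n) : zInv n * z n = 1 := Ring.mul_inverse_cancel _ (isUnit_zInv n hn)

theorem coeff_z_mem_center (hn : 0 < n) (r : ℕ) :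
    coeff r (z n) ∈ Subalgebra.center ℂ (Yangian n) := by
  refine coeff_mem_center_of_commute (fun x => ?_) r
  have h := commute_of_coeff_mem_center (coeff_zInv_mem_center hn) (C x)
  calc z n * C x = z n * (C x * zInv n) * z n := by
        rw [mul_assoc, mul_assoc, zInv_mul_z hn, mul_one]
    _ = C x * z n := by rw [← h, ← mul_assoc, z_mul_zInv hn, one_mul]

theorem constantCoeff_z (hn : 0 < n) : constantCoeff (z n) = 1 := by
  have h := congrArg constantCoeff (z_mul_zInv hn)
  rwa [map_mul, constantCoeff_zInv n hn, mul_one, map_one] at h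

end ZCentral

/-! ### The quantum determinant -/

section Alternating

theorem leg_mul_apply {n m : ℕ} {R : Type*} [Ring R] (a : Fin m) (M : Matrix (Fin n) (Fin n) R)
    (P : Matrix (Fin m → Fin n) (Fin m → Fin n) R) (I J : Fin m → Fin n) :
    (leg a M * P) I J = ∑ c, M (I a) c * P (Function.update I a c) J := by
  classical
  rw [Matrix.mul_apply]
  symm
  refine Finset.sum_of_injOn (Function.update I a) ((Function.update_injective I a).injOn)
    (fun _ _ => Finset.mem_coe.2 (Finset.mem_univ _)) (fun K _ hK => ?_) fun c _ => ?_
  · rw [leg, Matrix.of_apply, if_neg, zero_mul]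
    refine fun h => hK ⟨K a, by simp, funext fun b => ?_⟩
    obtain rfl | hb := eq_or_ne b a
    · simp
    · simp [hb, h b hb]
  · rw [leg, Matrix.of_apply, if_pos, Function.update_self]
    exact fun b hb => (Function.update_of_ne hb _ _).symm

theorem prod_leg_apply {n m : ℕ} {R : Type*} [Ring R] (M : Fin m → Matrix (Fin n) (Fin n) R)
    (l : List (Fin m)) (hl : l.Nodup) (I J : Fin m → Fin n) :
    (l.map fun a => leg a (M a)).prod I J =
      open Classical in
      if ∀ b, b ∉ l → I b = J b then (l.map fun a => M a (I a) (J a)).prod else 0 := by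
  classical
  induction l generalizing I with
  | nil =>
    simp only [List.map_nil, List.prod_nil, Matrix.one_apply, List.not_mem_nil, not_false_eq_true,
      forall_const, funext_iff]
  | cons a l ih =>
    rw [List.nodup_cons] at hl
    rw [List.map_cons, List.prod_cons, leg_mul_apply, Finset.sum_eq_single (J a)]
    · have update_eq_iff : (∀ b, b ∉ l → Function.update I a (J a) b = J b) ↔
          ∀ b, b ∉ a :: l → I b = J b := by
        refine forall_congr' fun b => ?_
        obtain rfl | hb := eq_or_ne b a
        · simp
        · simp [hb]
      have map_update : (l.map fun b => M b (Function.update I a (J a) b) (J b)) =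
          l.map fun b => M b (I b) (J b) :=
        List.map_congr_left fun b hb => by
          rw [Function.update_of_ne (ne_of_mem_of_not_mem hb hl.1)]
      simp only [ih hl.2, List.map_cons, List.prod_cons, map_update, update_eq_iff, mul_ite,
        mul_zero]
    · intro c _ hc
      rw [ih hl.2, if_neg, mul_zero]
      exact fun h => hc (by simpa using h a hl.1)
    · simp

theorem antisymmetrizer_mul_apply {n m : ℕ} {R : Type*} [Ring R]
    (M : Matrix (Fin m → Fin n) (Fin m → Fin n) R) (K J : Fin m → Fin n) :
    (antisymmetrizer n m R * M) K J =
      ∑ σ : Equiv.Perm (Fin m), (σ.sign : ℤ) • M (K ∘ σ) J := by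
  have eq_comp_inv_iff (σ : Equiv.Perm (Fin m)) (I : Fin m → Fin n) :
      K = I ∘ (σ⁻¹ : Equiv.Perm (Fin m)) ↔ I = K ∘ σ := by
    constructor <;> rintro rfl <;> funext a <;> simp
  rw [Matrix.mul_apply]
  simp only [antisymmetrizer, Matrix.of_apply, Finset.sum_mul]
  rw [Finset.sum_comm, ← Equiv.sum_comp (Equiv.inv _)]
  refine Finset.sum_congr rfl fun σ _ => ?_
  simp only [Equiv.inv_apply, eq_comp_inv_iff, Equiv.Perm.sign_inv, ite_mul, zero_mul,
    Finset.sum_ite_eq', Finset.mem_univ, if_true, zsmul_eq_mul]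

theorem antisymmetrizer_mul_comp {n m : ℕ} {R : Type*} [Ring R]
    (M : Matrix (Fin m → Fin n) (Fin m → Fin n) R) (K J : Fin m → Fin n)
    (τ : Equiv.Perm (Fin m)) :
    (antisymmetrizer n m R * M) (K ∘ τ) J = (τ.sign : ℤ) • (antisymmetrizer n m R * M) K J := by
  rw [antisymmetrizer_mul_apply, antisymmetrizer_mul_apply, ← Equiv.sum_comp (Equiv.mulLeft τ⁻¹),
    Finset.smul_sum]
  refine Finset.sum_congr rfl fun σ _ => ?_
  have comp_eq : (K ∘ τ) ∘ (τ⁻¹ * σ : Equiv.Perm (Fin m)) = K ∘ σ := by funext a; simp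
  rw [smul_smul, Equiv.coe_mulLeft, comp_eq, Equiv.Perm.sign_mul, Equiv.Perm.sign_inv,
    Units.val_mul]

/-- The Levi-Civita symbol: the sign of a map from `Fin n` to itself, `0` if it is not a
permutation. -/
def leviCivita {n : ℕ} (K : Fin n → Fin n) : ℤ :=
  ((1 : Matrix (Fin n) (Fin n) ℤ).submatrix K id).det

theorem leviCivita_comp {n : ℕ} (K : Fin n → Fin n) (τ : Equiv.Perm (Fin n)) :
    leviCivita (K ∘ τ) = τ.sign * leviCivita K :=
  Matrix.det_permute τ ((1 : Matrix (Fin n) (Fin n) ℤ).submatrix K id)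

theorem leviCivita_id (n : ℕ) : leviCivita (id : Fin n → Fin n) = 1 := by
  simp [leviCivita]

theorem leviCivita_perm {n : ℕ} (σ : Equiv.Perm (Fin n)) : leviCivita σ = σ.sign := by
  simpa [leviCivita_id] using leviCivita_comp id σ

theorem leviCivita_of_not_injective {n : ℕ} {K : Fin n → Fin n} (h : ¬ K.Injective) :
    leviCivita K = 0 := by
  obtain ⟨a, b, hab, hne⟩ := Function.not_injective_iff.1 h
  exact Matrix.det_zero_of_row_eq hne
    (congrArg (fun i x => (1 : Matrix (Fin n) (Fin n) ℤ) i x) hab)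

theorem leviCivita_mul_self {n : ℕ} {K : Fin n → Fin n} (h : K.Injective) :
    leviCivita K * leviCivita K = 1 := by
  have hK := leviCivita_perm (Equiv.ofBijective K (Finite.injective_iff_bijective.1 h))
  rw [Equiv.coe_ofBijective] at hK
  rw [hK, ← Units.val_mul, Int.units_mul_self, Units.val_one]

theorem eq_leviCivita_smul {n : ℕ} {R : Type*} [AddCommGroup R] [IsAddTorsionFree R]
    (F : (Fin n → Fin n) → R)
    (h : ∀ K (τ : Equiv.Perm (Fin n)), F (K ∘ τ) = (τ.sign : ℤ) • F K)
    (K : Fin n → Fin n) : F K = leviCivita K • F id := by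
  by_cases hK : K.Injective
  · obtain ⟨σ, rfl⟩ : ∃ σ : Equiv.Perm (Fin n), σ = K :=
      ⟨Equiv.ofBijective K (Finite.injective_iff_bijective.1 hK), rfl⟩
    simpa only [leviCivita_perm, Function.id_comp] using h id σ
  · rw [leviCivita_of_not_injective hK, zero_smul]
    obtain ⟨a, b, hab, hne⟩ := Function.not_injective_iff.1 hK
    have comp_swap : K ∘ Equiv.swap a b = K := by
      rw [Equiv.comp_swap_eq_update, hab, Function.update_eq_self, ← hab, Function.update_eq_self]
    have eq_neg := h K (Equiv.swap a b)
    rw [comp_swap, Equiv.Perm.sign_swap hne, Units.val_neg, Units.val_one, neg_one_smul] at eq_neg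
    exact self_eq_neg.1 eq_neg

theorem comp_perm_eq_sign_smul {m : ℕ} {ι R : Type*} [AddCommGroup R] (F : (Fin m → ι) → R)
    (h : ∀ K (a b : Fin m), (a : ℕ) + 1 = b → F (K ∘ Equiv.swap a b) = -F K)
    (K : Fin m → ι) (τ : Equiv.Perm (Fin m)) : F (K ∘ τ) = (τ.sign : ℤ) • F K := by
  obtain _ | m := m
  · simp [Subsingleton.elim τ 1]
  have hτ : τ ∈ Submonoid.closure
      (Set.range fun i : Fin m => Equiv.swap i.castSucc i.succ) := by
    rw [Equiv.Perm.mclosure_swap_castSucc_succ]; trivial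
  induction hτ using Submonoid.closure_induction generalizing K with
  | mem x hx =>
    obtain ⟨i, rfl⟩ := hx
    rw [h K _ _ (by simp), Equiv.Perm.sign_swap Fin.castSucc_lt_succ.ne, Units.val_neg,
      Units.val_one, neg_one_smul]
  | one => simp
  | mul x y _ _ hx hy =>
    rw [Equiv.Perm.coe_mul, ← Function.comp_assoc, hy, hx, smul_smul, Equiv.Perm.sign_mul,
      Units.val_mul, mul_comm]

theorem finRange_eq_append_cons_cons {m : ℕ} (a b : Fin m) (hab : (a : ℕ) + 1 = b) :
    List.finRange m =
      (List.finRange m).take a ++ a :: b :: (List.finRange m).drop (b + 1) := by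
  conv_lhs => rw [← List.take_append_drop a (List.finRange m)]
  congr 1
  rw [List.drop_eq_getElem_cons (by simp), hab, List.drop_eq_getElem_cons (by simp)]
  simp

theorem exists_prod_finRange_eq_mul_mul {m : ℕ} {R : Type*} [Monoid R] (F : Fin m → R)
    (a b : Fin m) (hab : (a : ℕ) + 1 = b) :
    ∃ p q : R, ∀ G : Fin m → R, (∀ x, x ≠ a → x ≠ b → G x = F x) →
      ((List.finRange m).map G).prod = p * (G a * G b) * q := by
  have split := finRange_eq_append_cons_cons a b hab
  have nodup := List.nodup_finRange m
  rw [split] at nodup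
  simp only [List.nodup_append, List.nodup_cons, List.mem_cons, not_or] at nodup
  obtain ⟨-, ⟨⟨-, ha⟩, hb, -⟩, disjoint⟩ := nodup
  refine ⟨(((List.finRange m).take a).map F).prod, (((List.finRange m).drop (b + 1)).map F).prod,
    fun G hG => ?_⟩
  have map_take : ((List.finRange m).take a).map G = ((List.finRange m).take a).map F :=
    List.map_congr_left fun x hx =>
      hG x (disjoint x hx a (Or.inl rfl)) (disjoint x hx b (Or.inr (Or.inl rfl)))
  have map_drop : ((List.finRange m).drop (b + 1)).map G = ((List.finRange m).drop (b + 1)).map F :=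
    List.map_congr_left fun x hx => hG x (ne_of_mem_of_not_mem hx ha) (ne_of_mem_of_not_mem hx hb)
  conv_lhs => rw [split]
  simp only [List.map_append, List.map_cons, List.prod_append, List.prod_cons, map_take, map_drop,
    mul_assoc]

end Alternating

section QuantumDeterminant

/-- The product `t_{I 0, J 0}(u) t_{I 1, J 1}(u - 1) ⋯`. -/
def shiftedProd {n m : ℕ} (I J : Fin m → Fin n) : (Yangian n)⟦X⟧ :=
  ((List.finRange m).map fun a : Fin m => shift (-((a : ℕ) : ℂ)) (T n (I a) (J a))).prod

theorem antisymT_apply {n m : ℕ} (K J : Fin m → Fin n) :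
    antisymT n m K J = ∑ σ : Equiv.Perm (Fin m), (σ.sign : ℤ) • shiftedProd (K ∘ σ) J := by
  rw [antisymT, antisymmetrizer_mul_apply]
  refine Finset.sum_congr rfl fun σ _ => ?_
  rw [List.ofFn_eq_map, prod_leg_apply (fun a : Fin m => (T n).map (shift (-((a : ℕ) : ℂ)))) _
    (List.nodup_finRange m), if_pos fun b hb => (hb (List.mem_finRange b)).elim]
  rfl

theorem T_mul_T_shift_antisymm {n : ℕ} (i j k l : Fin n) (c : ℂ) :
    shift c (T n i j) * shift (c - 1) (T n k l) - shift c (T n k j) * shift (c - 1) (T n i l) +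
      (shift c (T n i l) * shift (c - 1) (T n k j) -
        shift c (T n k l) * shift (c - 1) (T n i j)) = 0 := by
  have exchange₁ := smul_T_T_shift i j k l 1
  have exchange₂ := smul_T_T_shift i l k j 1
  rw [one_smul] at exchange₁ exchange₂
  have antisymm_zero : T n i j * shift (-1) (T n k l) - T n k j * shift (-1) (T n i l) +
      (T n i l * shift (-1) (T n k j) - T n k l * shift (-1) (T n i j)) = 0 := by
    linear_combination (norm := abel) exchange₁ + exchange₂
  simpa only [shift_add, shift_sub_series, shift_mul, shift_shift, shift_zero_series,
    ← sub_eq_add_neg] using congrArg (shift c) antisymm_zero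

theorem shiftedProd_antisymm {n m : ℕ} (I J : Fin m → Fin n) (a b : Fin m)
    (hab : (a : ℕ) + 1 = b) :
    shiftedProd I J - shiftedProd (I ∘ Equiv.swap a b) J +
      (shiftedProd I (J ∘ Equiv.swap a b) -
        shiftedProd (I ∘ Equiv.swap a b) (J ∘ Equiv.swap a b)) = 0 := by
  obtain ⟨p, q, hpq⟩ := exists_prod_finRange_eq_mul_mul
    (fun x : Fin m => shift (-((x : ℕ) : ℂ)) (T n (I x) (J x))) a b hab
  have shift_b : -((b : ℕ) : ℂ) = -((a : ℕ) : ℂ) - 1 := by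
    rw [← hab]; push_cast; ring
  simp only [shiftedProd]
  rw [hpq, hpq, hpq, hpq]
  · simp only [Function.comp_apply, Equiv.swap_apply_left, Equiv.swap_apply_right, shift_b,
      ← mul_sub, ← sub_mul, ← mul_add, ← add_mul, T_mul_T_shift_antisymm, mul_zero, zero_mul]
  all_goals
    intro x ha hb
    simp only [Function.comp_apply, Equiv.swap_apply_of_ne_of_ne ha hb]

theorem antisymT_comp_swap {n m : ℕ} (K J : Fin m → Fin n) (a b : Fin m) (hab : (a : ℕ) + 1 = b) :
    antisymT n m K (J ∘ Equiv.swap a b) = -antisymT n m K J := by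
  have hne : a ≠ b := by rintro rfl; omega
  have sign_mul_swap (σ : Equiv.Perm (Fin m)) : (σ * Equiv.swap a b).sign = -σ.sign := by
    rw [Equiv.Perm.sign_mul, Equiv.Perm.sign_swap hne, mul_neg_one]
  rw [antisymT_apply, antisymT_apply, eq_neg_iff_add_eq_zero, ← Finset.sum_add_distrib]
  refine Finset.sum_involution (fun σ _ => σ * Equiv.swap a b) (fun σ _ => ?_) (fun σ _ _ h => ?_)
    (fun _ _ => Finset.mem_univ _) fun σ _ => by simp
  · rw [sign_mul_swap, Equiv.Perm.coe_mul, ← Function.comp_assoc, Units.val_neg]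
    have antisymm := congrArg ((σ.sign : ℤ) • ·) (shiftedProd_antisymm (K ∘ σ) J a b hab)
    simp only [smul_zero, smul_add, smul_sub] at antisymm
    rw [← antisymm]
    simp only [neg_smul]
    abel
  · exact absurd ((sign_mul_swap σ).symm.trans (congrArg Equiv.Perm.sign h))
      (neg_units_ne_self _)

instance (n : ℕ) : IsAddTorsionFree (Yangian n)⟦X⟧ := .of_isTorsionFree ℂ _

theorem antisymT_eq {n : ℕ} (K J : Fin n → Fin n) :
    antisymT n n K J = leviCivita K • leviCivita J • qdet n := by
  rw [eq_leviCivita_smul (fun K => antisymT n n K J)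
      (fun K τ => antisymmetrizer_mul_comp _ K J τ) K,
    eq_leviCivita_smul (fun J => antisymT n n id J)
      (comp_perm_eq_sign_smul _ fun J a b hab => antisymT_comp_swap _ J a b hab) J]
  rfl

theorem antisymmetrizer_apply {n m : ℕ} {R : Type*} [Ring R] (K J : Fin m → Fin n) :
    antisymmetrizer n m R K J =
      ∑ σ : Equiv.Perm (Fin m), (σ.sign : ℤ) • if K ∘ σ = J then (1 : R) else 0 := by
  rw [← mul_one (antisymmetrizer n m R), antisymmetrizer_mul_apply]
  simp only [Matrix.one_apply]

theorem antisymmetrizer_eq {n : ℕ} {R : Type*} [Ring R] [IsAddTorsionFree R]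
    (K J : Fin n → Fin n) :
    antisymmetrizer n n R K J = leviCivita K • leviCivita J • (1 : R) := by
  have comp_left (K J : Fin n → Fin n) (τ : Equiv.Perm (Fin n)) :
      antisymmetrizer n n R (K ∘ τ) J = (τ.sign : ℤ) • antisymmetrizer n n R K J := by
    simpa only [mul_one] using antisymmetrizer_mul_comp (1 : Matrix _ _ R) K J τ
  have comp_right (K J : Fin n → Fin n) (τ : Equiv.Perm (Fin n)) :
      antisymmetrizer n n R K (J ∘ τ) = (τ.sign : ℤ) • antisymmetrizer n n R K J := by
    rw [antisymmetrizer_apply, antisymmetrizer_apply, ← Equiv.sum_comp (Equiv.mulRight τ),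
      Finset.smul_sum]
    refine Finset.sum_congr rfl fun σ _ => ?_
    simp only [Equiv.coe_mulRight, Equiv.Perm.coe_mul, ← Function.comp_assoc,
      τ.surjective.injective_comp_right.eq_iff, smul_smul, Equiv.Perm.sign_mul, Units.val_mul,
      mul_comm (σ.sign : ℤ)]
  have id_id : antisymmetrizer n n R id id = 1 := by
    rw [antisymmetrizer_apply, Finset.sum_eq_single 1]
    · simp
    · intro σ _ hσ
      rw [if_neg, smul_zero]
      exact fun h => hσ (Equiv.ext (congrFun h))
    · simp
  rw [← id_id, eq_leviCivita_smul (fun K => antisymmetrizer n n R K J)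
      (fun K τ => comp_left K J τ) K,
    eq_leviCivita_smul (fun J => antisymmetrizer n n R id J) (fun J τ => comp_right id J τ) J]

theorem isQuantumDeterminant_qdet (n : ℕ) : IsQuantumDeterminant n (qdet n) := by
  ext1 K J
  rw [antisymT_eq, Matrix.mul_diagonal, antisymmetrizer_eq]
  simp only [smul_mul_assoc, one_mul]

theorem sum_sign_smul_shiftedProd {n : ℕ} (J : Fin n → Fin n) :
    ∑ σ : Equiv.Perm (Fin n), (σ.sign : ℤ) • shiftedProd σ J = leviCivita J • qdet n := by
  rw [← one_smul ℤ (leviCivita J • qdet n), ← leviCivita_id n, ← antisymT_eq, antisymT_apply]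
  rfl

theorem qdet_eq_sum (n : ℕ) :
    qdet n = ∑ σ : Equiv.Perm (Fin n), (σ.sign : ℤ) • shiftedProd σ id := by
  rw [sum_sign_smul_shiftedProd, leviCivita_id, one_smul]

theorem constantCoeff_shiftedProd {n m : ℕ} (I J : Fin m → Fin n) :
    constantCoeff (shiftedProd I J) = if I = J then 1 else 0 := by
  have factors : constantCoeff (shiftedProd I J) =
      ((List.finRange m).map fun a => if I a = J a then (1 : Yangian n) else 0).prod := by
    rw [shiftedProd, map_list_prod, List.map_map]
    refine congrArg List.prod (List.map_congr_left fun a _ => ?_)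
    rw [Function.comp_apply, constantCoeff_shift, ← coeff_zero_eq_constantCoeff_apply, coeff_T,
      t_zero]
  rw [factors]
  split_ifs with hIJ
  · simp [hIJ]
  · obtain ⟨a, ha⟩ := Function.ne_iff.1 hIJ
    exact List.prod_eq_zero (List.mem_map.2 ⟨a, List.mem_finRange a, if_neg ha⟩)

theorem constantCoeff_qdet (n : ℕ) : constantCoeff (qdet n) = 1 := by
  rw [qdet_eq_sum, map_sum, Finset.sum_eq_single 1]
  · simp [constantCoeff_shiftedProd]
  · intro σ _ hσ
    rw [map_zsmul, constantCoeff_shiftedProd, if_neg, smul_zero]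
    exact fun h => hσ (Equiv.ext (congrFun h))
  · simp

theorem shiftedProd_snoc {n m : ℕ} (I : Fin (m + 1) → Fin n) (J : Fin m → Fin n) (c : Fin n) :
    shiftedProd I (Fin.snoc J c : Fin (m + 1) → Fin n) =
      shiftedProd (I ∘ Fin.castSucc) J * shift (-(m : ℂ)) (T n (I (Fin.last m)) c) := by
  rw [shiftedProd, List.finRange_succ_last, List.map_append, List.prod_append, List.map_map]
  simp [shiftedProd, Function.comp_def]

theorem shiftedProd_cons {n m : ℕ} (I : Fin (m + 1) → Fin n) (J : Fin m → Fin n) (c : Fin n) :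
    shiftedProd I (Fin.cons c J : Fin (m + 1) → Fin n) =
      T n (I 0) c * shift (-1) (shiftedProd (I ∘ Fin.succ) J) := by
  rw [shiftedProd, List.finRange_succ, List.map_cons, List.prod_cons, List.map_map, shiftedProd,
    ← shiftHom_apply (-1), map_list_prod, List.map_map]
  congr 1
  · simp [shift_zero]
  · refine congrArg List.prod (List.map_congr_left fun a _ => ?_)
    simp [shiftHom_apply, shift_shift]

variable {m : ℕ}

theorem sum_sign_smul_T_mul_shift_shiftedProd (J : Fin m → Fin (m + 1)) (c : Fin (m + 1)) :
    ∑ σ : Equiv.Perm (Fin (m + 1)),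
        (σ.sign : ℤ) • (T (m + 1) (σ 0) c * shift (-1) (shiftedProd (σ ∘ Fin.succ) J)) =
      leviCivita (Fin.cons c J : Fin (m + 1) → Fin (m + 1)) • qdet (m + 1) := by
  simp only [← sum_sign_smul_shiftedProd, shiftedProd_cons]

/-- The last column is moved to the front by `finRotate`, whose sign appears on both sides. -/
theorem sum_sign_smul_shiftedProd_mul_shift_T (J : Fin m → Fin (m + 1)) (c : Fin (m + 1)) :
    ∑ σ : Equiv.Perm (Fin (m + 1)),
        (σ.sign : ℤ) • (shiftedProd (σ ∘ Fin.succ) J * shift (-(m : ℂ)) (T (m + 1) (σ 0) c)) =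
      leviCivita (Fin.cons c J : Fin (m + 1) → Fin (m + 1)) • qdet (m + 1) := by
  let ρ := finRotate (m + 1)
  have snoc_eq : (Fin.snoc J c : Fin (m + 1) → Fin (m + 1)) =
      (Fin.cons c J : Fin (m + 1) → Fin (m + 1)) ∘ ρ := Fin.snoc_eq_cons_rotate J c
  have comp_castSucc (σ : Equiv.Perm (Fin (m + 1))) :
      (σ * ρ : Equiv.Perm _) ∘ Fin.castSucc = σ ∘ Fin.succ := by
    funext a
    simp [ρ]
  have apply_last (σ : Equiv.Perm (Fin (m + 1))) : (σ * ρ) (Fin.last m) = σ 0 := by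
    simp [ρ]
  have expansion := sum_sign_smul_shiftedProd (Fin.snoc J c : Fin (m + 1) → Fin (m + 1))
  rw [← Equiv.sum_comp (Equiv.mulRight ρ), snoc_eq, leviCivita_comp, ← snoc_eq, mul_smul]
    at expansion
  simp only [Equiv.coe_mulRight, shiftedProd_snoc, comp_castSucc, apply_last, Equiv.Perm.sign_mul,
    Units.val_mul, mul_comm _ (ρ.sign : ℤ), mul_smul, ← Finset.smul_sum] at expansion
  exact ρ.sign.isUnit.smul_left_cancel.1 expansion

/-- The quantum minor of `T(u)` on the columns `J` and all rows but `i`, with the sign it has in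
the expansion of the quantum determinant along a column placed before those in `J`. -/
def quantumCofactor (J : Fin m → Fin (m + 1)) (i : Fin (m + 1)) : (Yangian (m + 1))⟦X⟧ :=
  ∑ σ : Equiv.Perm (Fin (m + 1)),
    if σ 0 = i then (σ.sign : ℤ) • shiftedProd (σ ∘ Fin.succ) J else 0

theorem sum_T_mul_shift_quantumCofactor (J : Fin m → Fin (m + 1)) (c : Fin (m + 1)) :
    ∑ i, T (m + 1) i c * shift (-1) (quantumCofactor J i) =
      leviCivita (Fin.cons c J : Fin (m + 1) → Fin (m + 1)) • qdet (m + 1) := by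
  simp only [← sum_sign_smul_T_mul_shift_shiftedProd, quantumCofactor, shift_sum, Finset.mul_sum]
  rw [Finset.sum_comm]
  refine Finset.sum_congr rfl fun σ _ => ?_
  simp only [← shiftHom_apply (-1), apply_ite (shiftHom (Yangian (m + 1)) (-1)),
    map_zero, map_zsmul, mul_ite, mul_zero, mul_smul_comm, Finset.sum_ite_eq, Finset.mem_univ,
    if_true]

theorem sum_shift_T_mul_shift_Tinv {n : ℕ} (a : ℂ) (i j : Fin n) :
    ∑ c, shift a (T n i c) * shift a (Tinv n c j) = if i = j then 1 else 0 := by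
  have entry := congrArg (shift a) (congrFun₂ (T_mul_Tinv n) i j)
  rw [Matrix.mul_apply, shift_sum, Matrix.one_apply, apply_ite (shift a), shift_one,
    shift_zero_series] at entry
  simpa only [shift_mul] using entry

theorem quantumCofactor_eq (J : Fin m → Fin (m + 1)) (i : Fin (m + 1)) :
    quantumCofactor J i = ∑ c, leviCivita (Fin.cons c J : Fin (m + 1) → Fin (m + 1)) •
      (qdet (m + 1) * shift (-(m : ℂ)) (Tinv (m + 1) c i)) := by
  simp only [← smul_mul_assoc, ← sum_sign_smul_shiftedProd_mul_shift_T, Finset.sum_mul]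
  rw [Finset.sum_comm]
  refine Finset.sum_congr rfl fun σ _ => ?_
  simp only [smul_mul_assoc, mul_assoc, ← Finset.smul_sum, ← Finset.mul_sum,
    sum_shift_T_mul_shift_Tinv, mul_ite, mul_one, mul_zero, smul_ite, smul_zero]

theorem leviCivita_cons_succAbove {c k : Fin (m + 1)} (hc : c ≠ k) :
    leviCivita (Fin.cons c k.succAbove : Fin (m + 1) → Fin (m + 1)) = 0 :=
  leviCivita_of_not_injective fun h =>
    (Fin.cons_injective_iff.1 h).1 (by simpa using hc)

theorem quantumCofactor_succAbove (k i : Fin (m + 1)) :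
    quantumCofactor k.succAbove i =
      leviCivita (Fin.cons k k.succAbove : Fin (m + 1) → Fin (m + 1)) •
        (qdet (m + 1) * shift (-(m : ℂ)) (Tinv (m + 1) k i)) := by
  rw [quantumCofactor_eq, Finset.sum_eq_single k]
  · intro c _ hc
    rw [leviCivita_cons_succAbove hc, zero_smul]
  · simp

theorem sum_T_mul_shift_qdet_mul_Tinv (j k : Fin (m + 1)) :
    ∑ i, T (m + 1) i j * (shift (-1) (qdet (m + 1)) *
      shift (-((m + 1 : ℕ) : ℂ)) (Tinv (m + 1) k i)) = if j = k then qdet (m + 1) else 0 := by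
  set e : ℤ := leviCivita (Fin.cons k k.succAbove : Fin (m + 1) → Fin (m + 1)) with he
  have e_mul_self : e * e = 1 := leviCivita_mul_self <|
    Fin.cons_injective_iff.2 ⟨by simp, Fin.succAbove_right_injective⟩
  have shift_shift_Tinv (i : Fin (m + 1)) :
      shift (-1) (shift (-(m : ℂ)) (Tinv (m + 1) k i)) =
        shift (-((m + 1 : ℕ) : ℂ)) (Tinv (m + 1) k i) := by
    rw [shift_shift]; congr 1; push_cast; ring
  have expansion := congrArg (e • ·) (sum_T_mul_shift_quantumCofactor k.succAbove j)
  simp only [quantumCofactor_succAbove, ← he, ← shiftHom_apply (-1), map_zsmul, map_mul,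
    mul_smul_comm, ← Finset.smul_sum, smul_smul, e_mul_self, one_smul] at expansion
  simp only [shiftHom_apply, shift_shift_Tinv] at expansion
  rw [expansion]
  obtain rfl | hjk := eq_or_ne j k
  · rw [← he, e_mul_self, one_smul, if_pos rfl]
  · rw [leviCivita_cons_succAbove hjk, mul_zero, zero_smul, if_neg hjk]

end QuantumDeterminant

/-! ### The quantum Liouville formula -/

section CommutatorOrder

variable {A : Type*} [Ring A] [Algebra ℂ A]

theorem exists_commutator_eq_X_pow_mul {e f : A⟦X⟧} {r : ℕ}
    (he : ∀ q < r, coeff q e ∈ Subalgebra.center ℂ A) (hf : constantCoeff f = 1) :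
    ∃ y : A⟦X⟧, e * f - f * e = X ^ (r + 1) * y ∧
      constantCoeff y = coeff r e * coeff 1 f - coeff 1 f * coeff r e := by
  obtain ⟨c, e', e_eq, hc, he'⟩ : ∃ c e' : A⟦X⟧, e = X ^ r * e' + c ∧
      (∀ q, coeff q c ∈ Subalgebra.center ℂ A) ∧ constantCoeff e' = coeff r e := by
    refine ⟨trunc r e, mk fun i => coeff (i + r) e, eq_X_pow_mul_shift_add_trunc r e, fun q => ?_,
      by simp [← coeff_zero_eq_constantCoeff_apply]⟩
    rw [Polynomial.coeff_coe, coeff_trunc]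
    split_ifs with hq
    · exact he q hq
    · exact zero_mem _
  obtain ⟨f', f_eq, hf'⟩ : ∃ f' : A⟦X⟧, f = X * f' + 1 ∧ constantCoeff f' = coeff 1 f := by
    refine ⟨mk fun p => coeff (p + 1) f, ?_, by simp [← coeff_zero_eq_constantCoeff_apply]⟩
    rw [← map_one C, ← hf, ← eq_X_mul_shift_add_const]
  refine ⟨e' * f' - f' * e', ?_, by rw [map_sub, map_mul, map_mul, he', hf']⟩
  have comm_c := commute_of_coeff_mem_center hc f'
  have X_pow_left (x y : A⟦X⟧) : X ^ r * x * (X * y) = X ^ (r + 1) * (x * y) := by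
    rw [mul_assoc, ← mul_assoc x, (commute_X x).eq, pow_succ, mul_assoc, mul_assoc]
  have X_pow_right (x y : A⟦X⟧) : X * y * (X ^ r * x) = X ^ (r + 1) * (y * x) := by
    rw [mul_assoc, ← mul_assoc y, (commute_X_pow y r).eq, pow_succ', mul_assoc, mul_assoc]
  have X_comm_c : c * (X * f') = X * f' * c := by
    rw [← mul_assoc, (commute_X c).eq, mul_assoc, mul_assoc, comm_c]
  rw [e_eq, f_eq]
  simp only [mul_add, add_mul, mul_one, one_mul, mul_sub, X_pow_left, X_pow_right, X_comm_c]
  abel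

end CommutatorOrder

section Liouville

variable {n : ℕ}

theorem constantCoeff_T_diag (i : Fin n) : constantCoeff (T n i i) = 1 := by
  rw [← coeff_zero_eq_constantCoeff_apply, coeff_T, t_zero, if_pos rfl]

theorem isUnit_T_diag (i : Fin n) : IsUnit (T n i i) := by
  rw [PowerSeries.isUnit_iff_constantCoeff, constantCoeff_T_diag]
  exact isUnit_one

theorem constantCoeff_inverse_T_diag (i : Fin n) :
    constantCoeff (Ring.inverse (T n i i)) = 1 := by
  have h := congrArg constantCoeff (Ring.mul_inverse_cancel _ (isUnit_T_diag i))
  rwa [map_mul, constantCoeff_T_diag, one_mul, map_one] at h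

theorem trace_Tinv_shift_mul_T (hn : 0 < n) :
    (1 / n : ℂ) • ((Tinv n).map (shift (-(n : ℂ))) * T n).trace = zInv n := by
  let i : Fin n := ⟨0, hn⟩
  set w := (1 / n : ℂ) • ((Tinv n).map (shift (-(n : ℂ))) * T n).trace with hw
  have T_mul_w : T n i i * w = zInv n * T n i i := by
    calc T n i i * w = ∑ l, T n l i * ∑ k, shift (-(n : ℂ)) (Tinv n k l) * T n i k := by
          simp [sum_Tinv_shift_mul_T hn, hw]
      _ = ∑ k, (∑ l, T n l i * shift (-(n : ℂ)) (Tinv n k l)) * T n i k := by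
          simp only [Finset.mul_sum, Finset.sum_mul, mul_assoc]
          exact Finset.sum_comm
      _ = zInv n * T n i i := by simp [sum_T_mul_Tinv_shift hn]
  rw [commute_of_coeff_mem_center (coeff_zInv_mem_center hn)] at T_mul_w
  exact (isUnit_T_diag i).mul_left_cancel T_mul_w

theorem T_mul_shift_qdet (hn : 0 < n) (l j : Fin n) :
    T n l j * shift (-1) (qdet n) = qdet n * z n * T n l j := by
  obtain ⟨m, rfl⟩ : ∃ m, n = m + 1 := ⟨n - 1, by omega⟩
  have qdet_mul_T : qdet (m + 1) * T (m + 1) l j =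
      T (m + 1) l j * shift (-1) (qdet (m + 1)) * zInv (m + 1) := by
    calc qdet (m + 1) * T (m + 1) l j
        = ∑ k, (∑ i, T (m + 1) i j * (shift (-1) (qdet (m + 1)) *
            shift (-((m + 1 : ℕ) : ℂ)) (Tinv (m + 1) k i))) * T (m + 1) l k := by
          simp only [sum_T_mul_shift_qdet_mul_Tinv, ite_mul, zero_mul, Finset.sum_ite_eq,
            Finset.mem_univ, if_true]
      _ = ∑ i, T (m + 1) i j * (shift (-1) (qdet (m + 1)) *
            ∑ k, shift (-((m + 1 : ℕ) : ℂ)) (Tinv (m + 1) k i) * T (m + 1) l k) := by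
          simp only [Finset.mul_sum, Finset.sum_mul, mul_assoc]
          exact Finset.sum_comm
      _ = T (m + 1) l j * shift (-1) (qdet (m + 1)) * zInv (m + 1) := by
          simp only [sum_Tinv_shift_mul_T hn, trace_Tinv_shift_mul_T hn, mul_ite, mul_zero,
            Finset.sum_ite_eq, Finset.mem_univ, if_true, mul_assoc]
  have z_comm := commute_of_coeff_mem_center (coeff_z_mem_center hn) (T (m + 1) l j)
  rw [mul_assoc, z_comm, ← mul_assoc, qdet_mul_T, mul_assoc _ (zInv _), zInv_mul_z hn, mul_one]

theorem sum_t_one_mem_center : ∑ i : Fin n, t i i 1 ∈ Subalgebra.center ℂ (Yangian n) := by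
  refine mem_center_of_commute_t fun k l s => ?_
  have commutator (i : Fin n) : t i i 1 * t k l s - t k l s * t i i 1 =
      (if k = i then t i l s else 0) - if i = l then t k i s else 0 := by
    have rel := t_rel i i k l 0 s
    simp only [t_zero, zero_add, if_true, one_mul, mul_one, sub_self, sub_zero] at rel
    rw [rel]
    split_ifs <;> simp
  have sum_commutator := Finset.sum_congr rfl fun i (_ : i ∈ Finset.univ) => commutator i
  rw [Finset.sum_sub_distrib, Finset.sum_sub_distrib, ← Finset.sum_mul, ← Finset.mul_sum]
    at sum_commutator
  simp only [Finset.sum_ite_eq, Finset.sum_ite_eq', Finset.mem_univ, if_true, sub_self]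
    at sum_commutator
  exact (sub_eq_zero.1 sum_commutator).symm

/-- The defect of the Liouville formula is `[qdet T(u - 1), t_ii(u)] t_ii(u)⁻¹` for every `i`. -/
theorem exists_shift_qdet_sub_eq_X_pow_mul (hn : 0 < n) {r : ℕ}
    (hr : ∀ q < r, coeff q (qdet n) ∈ Subalgebra.center ℂ (Yangian n)) (i : Fin n) :
    ∃ y, shift (-1) (qdet n) - qdet n * z n = X ^ (r + 1) * y ∧
      constantCoeff y = coeff r (shift (-1) (qdet n)) * t i i 1 -
        t i i 1 * coeff r (shift (-1) (qdet n)) := by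
  have shift_mem_center (q : ℕ) (hq : q < r) :
      coeff q (shift (-1) (qdet n)) ∈ Subalgebra.center ℂ (Yangian n) := by
    rw [coeff_shift]
    exact Subalgebra.sum_mem _ fun s hs => Subalgebra.smul_mem _
      (hr s (by rw [Finset.mem_range] at hs; omega)) _
  obtain ⟨y, hy, constantCoeff_y⟩ :=
    exists_commutator_eq_X_pow_mul shift_mem_center (constantCoeff_T_diag i)
  refine ⟨y * Ring.inverse (T n i i), ?_, ?_⟩
  · rw [← mul_assoc, ← hy, T_mul_shift_qdet hn, ← sub_mul, mul_assoc,
      Ring.mul_inverse_cancel _ (isUnit_T_diag i), mul_one]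
  · rw [map_mul, constantCoeff_inverse_T_diag, mul_one, constantCoeff_y, coeff_T]

theorem coeff_one_z (hn : 0 < n) : coeff 1 (z n) = 0 := by
  have coeff_lt_one_mem (q : ℕ) (hq : q < 1) :
      coeff q (qdet n) ∈ Subalgebra.center ℂ (Yangian n) := by
    rw [Nat.lt_one_iff.1 hq, coeff_zero_eq_constantCoeff_apply, constantCoeff_qdet]
    exact one_mem _
  obtain ⟨y, hy, -⟩ := exists_shift_qdet_sub_eq_X_pow_mul hn coeff_lt_one_mem ⟨0, hn⟩
  have h := congrArg (coeff 1) hy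
  rw [coeff_X_pow_mul', if_neg (by omega), map_sub, coeff_one_shift, coeff_mul,
    Finset.Nat.sum_antidiagonal_succ] at h
  simpa [constantCoeff_qdet, constantCoeff_z hn] using h

theorem coeff_succ_qdet_mul_z (hn : 0 < n) (r : ℕ) : coeff (r + 1) (qdet n * z n) =
    coeff (r + 1) (qdet n) +
      ∑ p ∈ Finset.range r, coeff p (qdet n) * coeff (r + 1 - p) (z n) := by
  rw [coeff_mul, Finset.Nat.sum_antidiagonal_eq_sum_range_succ
    (fun p q => coeff p (qdet n) * coeff q (z n)), Finset.sum_range_succ, Finset.sum_range_succ]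
  simp [constantCoeff_z hn, coeff_one_z hn, add_comm]

theorem coeff_qdet_mem_of_coeff_shift_qdet_eq (hn : 0 < n) (S : Subalgebra ℂ (Yangian n))
    (hz : ∀ r, coeff r (z n) ∈ S) {r : ℕ} (hr : 0 < r) (ih : ∀ q < r, coeff q (qdet n) ∈ S)
    (h : coeff (r + 1) (shift (-1) (qdet n)) = coeff (r + 1) (qdet n * z n)) :
    coeff r (qdet n) ∈ S := by
  rw [coeff_shift_succ, coeff_succ_qdet_mul_z hn, add_comm (coeff (r + 1) (qdet n)),
    add_left_inj] at h
  have smul_coeff_eq : (r : ℂ) • coeff r (qdet n) =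
      ∑ p ∈ Finset.range r, coeff p (qdet n) * coeff (r + 1 - p) (z n) -
      ∑ q ∈ Finset.range r, coeff (r + 1) (invShift (-1) ^ q) • coeff q (qdet n) := by
    rw [← h]
    simp
  have hr' : (r : ℂ) ≠ 0 := by exact_mod_cast hr.ne'
  rw [← inv_smul_smul₀ hr' (coeff r (qdet n)), smul_coeff_eq]
  exact S.smul_mem (sub_mem
    (S.sum_mem fun p hp => mul_mem (ih p (Finset.mem_range.1 hp)) (hz _))
    (S.sum_mem fun p hp => S.smul_mem (ih p (Finset.mem_range.1 hp)) _)) _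

theorem coeff_shift_qdet_eq_of_coeff_qdet_mem_center (hn : 0 < n) {r : ℕ}
    (hr : ∀ q < r, coeff q (qdet n) ∈ Subalgebra.center ℂ (Yangian n)) :
    coeff (r + 1) (shift (-1) (qdet n)) = coeff (r + 1) (qdet n * z n) := by
  set c := coeff r (shift (-1) (qdet n))
  have coeff_defect (i : Fin n) :
      coeff (r + 1) (shift (-1) (qdet n) - qdet n * z n) = c * t i i 1 - t i i 1 * c := by
    obtain ⟨y, hy, constantCoeff_y⟩ := exists_shift_qdet_sub_eq_X_pow_mul hn hr i
    rw [hy, coeff_X_pow_mul', if_pos le_rfl, Nat.sub_self, coeff_zero_eq_constantCoeff_apply,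
      constantCoeff_y]
  have smul_coeff_defect :
      (n : ℂ) • coeff (r + 1) (shift (-1) (qdet n) - qdet n * z n) = 0 := by
    have sum_defect := Finset.sum_congr rfl fun i (_ : i ∈ Finset.univ) => coeff_defect i
    rwa [Finset.sum_const, Finset.card_univ, Fintype.card_fin, Finset.sum_sub_distrib,
      ← Finset.mul_sum, ← Finset.sum_mul, Subalgebra.mem_center_iff.1 sum_t_one_mem_center,
      sub_self, ← Nat.cast_smul_eq_nsmul ℂ] at sum_defect
  have hn' : (n : ℂ) ≠ 0 := by exact_mod_cast hn.ne'
  rw [← sub_eq_zero, ← map_sub]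
  exact (smul_eq_zero.1 smul_coeff_defect).resolve_left hn'

theorem coeff_qdet_mem_center (hn : 0 < n) (r : ℕ) :
    coeff r (qdet n) ∈ Subalgebra.center ℂ (Yangian n) := by
  induction r using Nat.strong_induction_on with
  | _ r ih =>
    obtain rfl | hr := Nat.eq_zero_or_pos r
    · rw [coeff_zero_eq_constantCoeff_apply, constantCoeff_qdet]
      exact one_mem _
    · exact coeff_qdet_mem_of_coeff_shift_qdet_eq hn _ (coeff_z_mem_center hn) hr ih
        (coeff_shift_qdet_eq_of_coeff_qdet_mem_center hn ih)

theorem shift_qdet (hn : 0 < n) : shift (-1) (qdet n) = qdet n * z n := by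
  ext (_ | m)
  · simp [constantCoeff_shift, constantCoeff_qdet, constantCoeff_z hn]
  · exact coeff_shift_qdet_eq_of_coeff_qdet_mem_center hn fun q _ => coeff_qdet_mem_center hn q

theorem isUnit_qdet (n : ℕ) : IsUnit (qdet n) := by
  rw [PowerSeries.isUnit_iff_constantCoeff, constantCoeff_qdet]
  exact isUnit_one

theorem z_eq_inverse_qdet_mul_shift (hn : 0 < n) :
    z n = Ring.inverse (qdet n) * shift (-1) (qdet n) := by
  rw [shift_qdet hn, ← mul_assoc, Ring.inverse_mul_cancel _ (isUnit_qdet n), one_mul]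

theorem z_eq_shift_mul_inverse_qdet (hn : 0 < n) :
    z n = shift (-1) (qdet n) * Ring.inverse (qdet n) := by
  rw [shift_qdet hn, ← commute_of_coeff_mem_center (coeff_z_mem_center hn), mul_assoc,
    Ring.mul_inverse_cancel _ (isUnit_qdet n), mul_one]

theorem coeff_qdet_mem_adjoin_coeff_z (hn : 0 < n) (r : ℕ) : coeff r (qdet n) ∈
    Algebra.adjoin ℂ (Set.range fun r => coeff (r + 2) (z n)) := by
  induction r using Nat.strong_induction_on with
  | _ r ih =>
    obtain rfl | hr := Nat.eq_zero_or_pos r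
    · rw [coeff_zero_eq_constantCoeff_apply, constantCoeff_qdet]
      exact one_mem _
    refine coeff_qdet_mem_of_coeff_shift_qdet_eq hn _ (fun q => ?_) hr ih
      (congrArg (coeff (r + 1)) (shift_qdet hn))
    obtain _ | _ | q := q
    · rw [coeff_zero_eq_constantCoeff_apply, constantCoeff_z hn]
      exact one_mem _
    · rw [zero_add, coeff_one_z hn]
      exact zero_mem _
    · exact Algebra.subset_adjoin ⟨q, rfl⟩

end Liouville

/-! ### Filtration and symbols -/

section Filtration

/-- Indices of the generators of the Yangian: `(i, j, r)` stands for `t_{ij}^{(r+1)}`. -/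
abbrev GenIndex (n : ℕ) : Type := Fin n × Fin n × ℕ

variable {n : ℕ}

/-- The generator of the Yangian with a given index. -/
def gen (g : GenIndex n) : Yangian n := t g.1 g.2.1 (g.2.2 + 1)

/-- The weight `2r + 1` of `t_{ij}^{(r+1)}`. These weights make the leading part of a commutator
of generators linear: it is the bracket of the polynomial current algebra of `gl_n`. -/
def genWeight (g : GenIndex n) : ℕ := 2 * g.2.2 + 1

/-- The sum of the weights of the generators in a word. -/
def wordWeight (L : List (GenIndex n)) : ℕ := (L.map genWeight).sum

/-- The product of the generators in a word. -/
def wordProd (L : List (GenIndex n)) : Yangian n := (L.map gen).prod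

/-- The span of the words of weight less than `w`. -/
def filtration (n w : ℕ) : Submodule ℂ (Yangian n) :=
  Submodule.span ℂ (wordProd '' {L | wordWeight L < w})

@[simp] theorem wordWeight_nil : wordWeight ([] : List (GenIndex n)) = 0 := rfl

@[simp] theorem wordWeight_cons (g : GenIndex n) (L : List (GenIndex n)) :
    wordWeight (g :: L) = genWeight g + wordWeight L := by simp [wordWeight]

theorem wordWeight_append (L L' : List (GenIndex n)) :
    wordWeight (L ++ L') = wordWeight L + wordWeight L' := by simp [wordWeight]

@[simp] theorem wordProd_nil : wordProd ([] : List (GenIndex n)) = 1 := rfl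

@[simp] theorem wordProd_cons (g : GenIndex n) (L : List (GenIndex n)) :
    wordProd (g :: L) = gen g * wordProd L := by simp [wordProd]

theorem wordProd_append (L L' : List (GenIndex n)) :
    wordProd (L ++ L') = wordProd L * wordProd L' := by simp [wordProd]

theorem wordProd_mem {L : List (GenIndex n)} {w : ℕ} (h : wordWeight L < w) :
    wordProd L ∈ filtration n w :=
  Submodule.subset_span ⟨L, h, rfl⟩

theorem filtration_le_iff {w : ℕ} {S : Submodule ℂ (Yangian n)} :
    filtration n w ≤ S ↔ ∀ L, wordWeight L < w → wordProd L ∈ S :=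
  Submodule.span_le.trans Set.image_subset_iff

theorem filtration_mono {v w : ℕ} (h : v ≤ w) : filtration n v ≤ filtration n w :=
  filtration_le_iff.2 fun _ hL => wordProd_mem (hL.trans_le h)

theorem filtration_zero : filtration n 0 = ⊥ :=
  le_bot_iff.1 (filtration_le_iff.2 fun _ hL => absurd hL (Nat.not_lt_zero _))

theorem mul_mem_filtration {u v w : ℕ} (h : ∀ a b, a < u → b < v → a + b < w) {x y : Yangian n}
    (hx : x ∈ filtration n u) (hy : y ∈ filtration n v) : x * y ∈ filtration n w := by
  refine Submodule.mul_le.1 ?_ x hx y hy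
  rw [filtration, filtration, Submodule.span_mul_span, Submodule.span_le]
  rintro _ ⟨_, ⟨L, hL, rfl⟩, _, ⟨L', hL', rfl⟩, rfl⟩
  change wordProd L * wordProd L' ∈ _
  rw [← wordProd_append]
  exact wordProd_mem (wordWeight_append L L' ▸ h _ _ hL hL')

theorem mul_mem_filtration_left {v w : ℕ} {x y : Yangian n} (hx : x ∈ filtration n (v + 1))
    (hy : y ∈ filtration n w) : x * y ∈ filtration n (v + w) :=
  mul_mem_filtration (by omega) hx hy

theorem mul_mem_filtration_right {v w : ℕ} {x y : Yangian n} (hx : x ∈ filtration n v)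
    (hy : y ∈ filtration n (w + 1)) : x * y ∈ filtration n (v + w) :=
  mul_mem_filtration (by omega) hx hy

theorem gen_mem (g : GenIndex n) : gen g ∈ filtration n (genWeight g + 1) := by
  simpa using wordProd_mem (L := [g]) (w := genWeight g + 1) (by simp)

theorem one_mem_filtration {w : ℕ} (h : 0 < w) : (1 : Yangian n) ∈ filtration n w :=
  wordProd_mem (L := []) h

theorem exists_mem_filtration (x : Yangian n) : ∃ w, x ∈ filtration n w := by
  let S : Subalgebra ℂ (Yangian n) :=
    { carrier := {x | ∃ w, x ∈ filtration n w}
      mul_mem' := fun ⟨u, hx⟩ ⟨v, hy⟩ => ⟨u + v, mul_mem_filtration (by omega) hx hy⟩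
      add_mem' := fun ⟨u, hx⟩ ⟨v, hy⟩ => ⟨max u v, add_mem (filtration_mono (le_max_left u v) hx)
        (filtration_mono (le_max_right u v) hy)⟩
      algebraMap_mem' := fun c => ⟨1, by
        rw [Algebra.algebraMap_eq_smul_one]
        exact Submodule.smul_mem _ _ (one_mem_filtration one_pos)⟩ }
  refine t_induction S (fun i j r => ?_) x
  rcases r with _ | r
  · rw [t_zero]
    split_ifs
    · exact one_mem S
    · exact zero_mem S
  · exact ⟨_, gen_mem (i, j, r)⟩

theorem gen_mul_gen_sub_mem (i j k l : Fin n) (r s : ℕ) :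
    gen (i, j, r) * gen (k, l, s) - gen (k, l, s) * gen (i, j, r) -
      ((if k = j then gen (i, l, r + s) else 0) - if i = l then gen (k, j, r + s) else 0) ∈
    filtration n (2 * (r + s) + 1) := by
  induction r generalizing s with
  | zero =>
    suffices t i j 1 * t k l (s + 1) - t k l (s + 1) * t i j 1 =
        (if k = j then t i l (s + 1) else 0) - if i = l then t k j (s + 1) else 0 by
      simp only [gen, zero_add, this, sub_self, zero_mem]
    have commute_t_zero : (if i = j then (1 : Yangian n) else 0) * t k l (s + 2) -
        t k l (s + 2) * (if i = j then 1 else 0) = 0 := by split_ifs <;> simp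
    have rel := t_rel i j k l 0 (s + 1)
    rw [t_zero, zero_add, commute_t_zero, sub_zero, t_zero, t_zero] at rel
    rw [rel]
    split_ifs <;> simp
  | succ r ih =>
    have products_mem (a b c d : Fin n) (p q : ℕ) (h : p + q = r + s) :
        gen (a, b, p) * gen (c, d, q) ∈ filtration n (2 * (r + 1 + s) + 1) :=
      mul_mem_filtration (by simp only [genWeight]; omega) (gen_mem _) (gen_mem _)
    have ih := ih (s + 1)
    rw [← add_assoc, add_right_comm] at ih
    have sum_mem := add_mem ih (sub_mem (products_mem k j i l r s rfl)
      (products_mem k j i l s r (add_comm _ _)))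
    simp only [gen, ← t_rel i j k l (r + 1) (s + 1)] at sum_mem ⊢
    convert sum_mem using 1
    abel

theorem gen_mul_gen_sub_mul_mem (g h : GenIndex n) :
    gen g * gen h - gen h * gen g ∈ filtration n (genWeight g + genWeight h) := by
  obtain ⟨i, j, r⟩ := g
  obtain ⟨k, l, s⟩ := h
  have linear_mem (a b : Fin n) (P : Prop) [Decidable P] : (if P then gen (a, b, r + s) else 0) ∈
      filtration n (genWeight (i, j, r) + genWeight (k, l, s)) := by
    split_ifs
    · exact filtration_mono (by simp only [genWeight]; omega) (gen_mem _)
    · exact zero_mem _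
  exact (Submodule.sub_mem_iff_left _ (sub_mem (linear_mem _ _ _) (linear_mem _ _ _))).1
    (filtration_mono (by simp only [genWeight]; omega) (gen_mul_gen_sub_mem i j k l r s))

theorem wordWeight_eq_of_perm {L L' : List (GenIndex n)} (h : L.Perm L') :
    wordWeight L = wordWeight L' :=
  (h.map genWeight).sum_eq

theorem wordProd_sub_mem_of_perm {L L' : List (GenIndex n)} (h : L.Perm L') :
    wordProd L - wordProd L' ∈ filtration n (wordWeight L) := by
  induction h with
  | nil => simp
  | cons g _ ih =>
    rw [wordProd_cons, wordProd_cons, wordWeight_cons, ← mul_sub]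
    exact mul_mem_filtration_left (gen_mem g) ih
  | swap g h L =>
    simp only [wordProd_cons, wordWeight_cons, ← mul_assoc, ← sub_mul, ← add_assoc]
    exact mul_mem_filtration_right (gen_mul_gen_sub_mul_mem h g) (wordProd_mem (Nat.lt_succ_self _))
  | trans h _ ih ih' =>
    exact sub_add_sub_cancel (G := Yangian n) .. ▸ add_mem ih (wordWeight_eq_of_perm h ▸ ih')

theorem algHom_sub_mem_filtration {φ : Yangian n →ₐ[ℂ] Yangian n}
    (hφ : ∀ g, φ (gen g) - gen g ∈ filtration n (genWeight g)) {w : ℕ} {x : Yangian n}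
    (hx : x ∈ filtration n (w + 1)) : φ x - x ∈ filtration n w := by
  suffices filtration n (w + 1) ≤ (filtration n w).comap (φ.toLinearMap - LinearMap.id) from this hx
  refine filtration_le_iff.2 fun L hL => filtration_mono (Nat.lt_succ_iff.1 hL) ?_
  change φ (wordProd L) - wordProd L ∈ _
  clear hL
  induction L with
  | nil => simp
  | cons g L ih =>
    have map_mem : φ (wordProd L) ∈ filtration n (wordWeight L + 1) :=
      (Submodule.sub_mem_iff_left _ (wordProd_mem (Nat.lt_succ_self _))).1
        (filtration_mono (Nat.le_succ _) ih)
    rw [wordProd_cons, wordWeight_cons, map_mul, ← sub_add_sub_cancel _ (gen g * φ (wordProd L)),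
      ← sub_mul, ← mul_sub]
    exact add_mem (mul_mem_filtration_right (hφ g) map_mem) (mul_mem_filtration_left (gen_mem g) ih)

theorem algHom_bijective_of_sub_mem_filtration {φ : Yangian n →ₐ[ℂ] Yangian n}
    (hφ : ∀ g, φ (gen g) - gen g ∈ filtration n (genWeight g)) : Function.Bijective φ := by
  constructor
  · rw [injective_iff_map_eq_zero]
    intro x hx
    obtain ⟨w, hw⟩ := exists_mem_filtration x
    induction w with
    | zero => rwa [filtration_zero, Submodule.mem_bot] at hw
    | succ w ih => exact ih (by simpa [hx] using algHom_sub_mem_filtration hφ hw)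
  · intro x
    obtain ⟨w, hw⟩ := exists_mem_filtration x
    induction w generalizing x with
    | zero =>
      rw [filtration_zero, Submodule.mem_bot] at hw
      exact ⟨0, by rw [hw, map_zero]⟩
    | succ w ih =>
      obtain ⟨y, hy⟩ := ih _ (algHom_sub_mem_filtration hφ hw)
      exact ⟨x - y, by rw [map_sub, hy, sub_sub_cancel]⟩

end Filtration

section Symbols

variable {n : ℕ}

/-- The monomial that is the product of the variables in a word. -/
def wordMonomial (L : List (GenIndex n)) : MvPolynomial (GenIndex n) ℂ :=
  (L.map MvPolynomial.X).prod

@[simp] theorem wordMonomial_nil : wordMonomial ([] : List (GenIndex n)) = 1 := rfl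

@[simp] theorem wordMonomial_cons (g : GenIndex n) (L : List (GenIndex n)) :
    wordMonomial (g :: L) = MvPolynomial.X g * wordMonomial L := by simp [wordMonomial]

theorem wordMonomial_append (L L' : List (GenIndex n)) :
    wordMonomial (L ++ L') = wordMonomial L * wordMonomial L' := by simp [wordMonomial]

theorem wordMonomial_eq_monomial (L : List (GenIndex n)) :
    wordMonomial L = MvPolynomial.monomial (Multiset.toFinsupp (L : Multiset (GenIndex n))) 1 := by
  induction L with
  | nil => simp
  | cons g L ih =>
    rw [wordMonomial_cons, ih, ← Multiset.cons_coe, ← Multiset.singleton_add, map_add,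
      Multiset.toFinsupp_singleton, MvPolynomial.X, MvPolynomial.monomial_mul, one_mul]

/-- `HasSymbol w x p` says that `x` is, modulo the words of weight less than `w`, a noncommutative
form of the polynomial `p`, which is homogeneous of weight `w`. -/
inductive HasSymbol (w : ℕ) : Yangian n → MvPolynomial (GenIndex n) ℂ → Prop
  | word (L : List (GenIndex n)) : wordWeight L = w → HasSymbol w (wordProd L) (wordMonomial L)
  | lower {x : Yangian n} : x ∈ filtration n w → HasSymbol w x 0
  | add {x y : Yangian n} {p q : MvPolynomial (GenIndex n) ℂ} :
    HasSymbol w x p → HasSymbol w y q → HasSymbol w (x + y) (p + q)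
  | smul (c : ℂ) {x : Yangian n} {p : MvPolynomial (GenIndex n) ℂ} :
    HasSymbol w x p → HasSymbol w (c • x) (c • p)

namespace HasSymbol

variable {v w : ℕ} {x y : Yangian n} {p q : MvPolynomial (GenIndex n) ℂ}

theorem zero (w : ℕ) : HasSymbol (n := n) w 0 0 := lower (zero_mem _)

theorem gen (g : GenIndex n) : HasSymbol (genWeight g) (gen g) (MvPolynomial.X g) := by
  simpa using word [g] (by simp)

theorem sub (hx : HasSymbol w x p) (hy : HasSymbol w y q) : HasSymbol w (x - y) (p - q) := by
  simpa only [neg_smul, one_smul, ← sub_eq_add_neg] using hx.add (hy.smul (-1))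

theorem sum {ι : Type*} (s : Finset ι) {f : ι → Yangian n}
    {φ : ι → MvPolynomial (GenIndex n) ℂ} (h : ∀ i ∈ s, HasSymbol w (f i) (φ i)) :
    HasSymbol w (∑ i ∈ s, f i) (∑ i ∈ s, φ i) := by
  classical
  induction s using Finset.induction_on with
  | empty => exact zero w
  | insert i s hi ih =>
    rw [Finset.sum_insert hi, Finset.sum_insert hi]
    exact (h i (Finset.mem_insert_self i s)).add
      (ih fun j hj => h j (Finset.mem_insert_of_mem hj))

theorem of_sub_mem (hy : HasSymbol w y p) (hxy : x - y ∈ filtration n w) : HasSymbol w x p := by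
  simpa using hy.add (lower hxy)

theorem mem_filtration (hx : HasSymbol w x p) : x ∈ filtration n (w + 1) := by
  induction hx with
  | word L hL => exact wordProd_mem (hL ▸ Nat.lt_succ_self _)
  | lower hx => exact filtration_mono (Nat.le_succ w) hx
  | add _ _ hx hy => exact add_mem hx hy
  | smul c _ hx => exact Submodule.smul_mem _ c hx

theorem mul (hx : HasSymbol v x p) (hy : HasSymbol w y q) :
    HasSymbol (v + w) (x * y) (p * q) := by
  induction hx with
  | word L hL =>
    induction hy with
    | word L' hL' =>
      rw [← wordProd_append, ← wordMonomial_append]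
      exact word _ (by rw [wordWeight_append, hL, hL'])
    | lower hy =>
      rw [mul_zero]
      exact lower (mul_mem_filtration_left (wordProd_mem (hL ▸ Nat.lt_succ_self _)) hy)
    | add _ _ hx hy => simpa only [mul_add] using hx.add hy
    | smul c _ hx => simpa only [mul_smul_comm] using hx.smul c
  | lower hx =>
    rw [zero_mul]
    exact lower (mul_mem_filtration_right hx hy.mem_filtration)
  | add _ _ hx hy => simpa only [add_mul] using hx.add hy
  | smul c _ hx => simpa only [smul_mul_assoc] using hx.smul c

end HasSymbol

theorem exists_hasSymbol {w : ℕ} {x : Yangian n} (hx : x ∈ filtration n (w + 1)) :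
    ∃ p, HasSymbol w x p := by
  induction hx using Submodule.span_induction with
  | mem x hx =>
    obtain ⟨L, hL, rfl⟩ := hx
    rcases (Nat.lt_succ_iff.1 hL).lt_or_eq with h | h
    · exact ⟨0, .lower (wordProd_mem h)⟩
    · exact ⟨_, .word L h⟩
  | zero => exact ⟨0, .zero w⟩
  | add x y _ _ hx hy => exact ⟨_, hx.choose_spec.add hy.choose_spec⟩
  | smul c x _ hx => exact ⟨_, hx.choose_spec.smul c⟩

/-- The linear map that sends a monomial to the product of the corresponding generators of the
Yangian in an arbitrarily chosen order. -/
def orderedProd (n : ℕ) : MvPolynomial (GenIndex n) ℂ →ₗ[ℂ] Yangian n :=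
  (MvPolynomial.basisMonomials _ ℂ).constr ℂ fun s => wordProd (Finsupp.toMultiset s).toList

theorem wordProd_sub_orderedProd_mem (L : List (GenIndex n)) :
    wordProd L - orderedProd n (wordMonomial L) ∈ filtration n (wordWeight L) := by
  have monomial_eq_basis (s : GenIndex n →₀ ℕ) :
      MvPolynomial.monomial s 1 = MvPolynomial.basisMonomials _ ℂ s := by
    rw [MvPolynomial.coe_basisMonomials]
  rw [wordMonomial_eq_monomial, monomial_eq_basis, orderedProd, Module.Basis.constr_basis]
  refine wordProd_sub_mem_of_perm (Multiset.coe_eq_coe.1 ?_)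
  rw [Multiset.coe_toList, Multiset.toFinsupp_toMultiset]

theorem HasSymbol.sub_orderedProd_mem {w : ℕ} {x : Yangian n} {p : MvPolynomial (GenIndex n) ℂ}
    (h : HasSymbol w x p) : x - orderedProd n p ∈ filtration n w := by
  induction h with
  | word L hL => exact hL ▸ wordProd_sub_orderedProd_mem L
  | lower hx => simpa using hx
  | add _ _ hx hy =>
    rw [map_add, add_sub_add_comm]
    exact add_mem hx hy
  | smul c _ hx =>
    rw [map_smul, ← smul_sub]
    exact Submodule.smul_mem _ c hx

theorem HasSymbol.sub_mem_filtration {w : ℕ} {x y : Yangian n} {p : MvPolynomial (GenIndex n) ℂ}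
    (hx : HasSymbol w x p) (hy : HasSymbol w y p) : x - y ∈ filtration n w := by
  simpa using (hx.sub hy).sub_orderedProd_mem

/-- The derivation of the polynomial ring of symbols induced by the commutator with
`t_{ij}^{(s+1)}`, where `g = (i, j, s)`. -/
def poissonBracket (g : GenIndex n) :
    Derivation ℂ (MvPolynomial (GenIndex n) ℂ) (MvPolynomial (GenIndex n) ℂ) :=
  MvPolynomial.mkDerivation ℂ fun h =>
    (if h.1 = g.2.1 then MvPolynomial.X (g.1, h.2.1, g.2.2 + h.2.2) else 0) -
      if g.1 = h.2.1 then MvPolynomial.X (h.1, g.2.1, g.2.2 + h.2.2) else 0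

theorem poissonBracket_X (i j k l : Fin n) (s r : ℕ) :
    poissonBracket (i, j, s) (MvPolynomial.X (k, l, r)) =
      (if k = j then MvPolynomial.X (i, l, s + r) else 0) -
        if i = l then MvPolynomial.X (k, j, s + r) else 0 := by
  rw [poissonBracket, MvPolynomial.mkDerivation_X]

theorem hasSymbol_commutator_gen (g h : GenIndex n) :
    HasSymbol (genWeight h + 2 * g.2.2) (gen g * gen h - gen h * gen g)
      (poissonBracket g (MvPolynomial.X h)) := by
  obtain ⟨i, j, s⟩ := g
  obtain ⟨k, l, r⟩ := h
  have weight_eq : genWeight (k, l, r) + 2 * s = 2 * (s + r) + 1 := by simp only [genWeight]; ring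
  have hasSymbol_ite (a b : Fin n) (P : Prop) [Decidable P] :
      HasSymbol (2 * (s + r) + 1) (if P then gen (a, b, s + r) else 0)
        (if P then MvPolynomial.X (a, b, s + r) else 0) := by
    split_ifs
    · exact .gen (a, b, s + r)
    · exact .zero _
  rw [poissonBracket_X, weight_eq]
  exact ((hasSymbol_ite i l (k = j)).sub (hasSymbol_ite k j (i = l))).of_sub_mem
    (gen_mul_gen_sub_mem i j k l s r)

theorem hasSymbol_commutator_wordProd (g : GenIndex n) (L : List (GenIndex n)) :
    HasSymbol (wordWeight L + 2 * g.2.2) (gen g * wordProd L - wordProd L * gen g)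
      (poissonBracket g (wordMonomial L)) := by
  induction L with
  | nil => simpa using HasSymbol.zero (n := n) _
  | cons h L ih =>
    have leibniz : gen g * (gen h * wordProd L) - gen h * wordProd L * gen g =
        gen h * (gen g * wordProd L - wordProd L * gen g) +
          (gen g * gen h - gen h * gen g) * wordProd L := by
      noncomm_ring
    rw [wordProd_cons, leibniz, wordMonomial_cons, Derivation.leibniz, smul_eq_mul, smul_eq_mul,
      mul_comm (wordMonomial L), wordWeight_cons]
    refine .add ?_ ?_
    · rw [add_assoc]
      exact (HasSymbol.gen h).mul ih
    · rw [add_right_comm]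
      exact (hasSymbol_commutator_gen g h).mul (.word L rfl)

theorem commutator_mem_filtration (g : GenIndex n) {w : ℕ} {x : Yangian n}
    (hx : x ∈ filtration n w) : gen g * x - x * gen g ∈ filtration n (w + 2 * g.2.2) := by
  suffices filtration n w ≤ (filtration n (w + 2 * g.2.2)).comap
    (LinearMap.mulLeft ℂ (gen g) - LinearMap.mulRight ℂ (gen g)) from this hx
  exact filtration_le_iff.2 fun L hL => filtration_mono (by omega)
    (hasSymbol_commutator_wordProd g L).mem_filtration

theorem HasSymbol.commutator (g : GenIndex n) {w : ℕ} {x : Yangian n}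
    {p : MvPolynomial (GenIndex n) ℂ} (h : HasSymbol w x p) :
    HasSymbol (w + 2 * g.2.2) (GLYangian.gen g * x - x * GLYangian.gen g)
      (poissonBracket g p) := by
  induction h with
  | word L hL => exact hL ▸ hasSymbol_commutator_wordProd g L
  | lower hx => simpa using lower (commutator_mem_filtration g hx)
  | add _ _ hx hy => simpa only [mul_add, add_mul, map_add, add_sub_add_comm] using hx.add hy
  | smul c _ hx =>
    simpa only [mul_smul_comm, smul_mul_assoc, Derivation.map_smul, ← smul_sub] using hx.smul c

end Symbols

/-! ### Faithfulness of the symbols -/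

section Lax

variable {n : ℕ} {A : Type*} [Ring A]

/-- The commutation relations of the matrix units of `gl_n`. -/
def GLRelations (E : Fin n → Fin n → A) : Prop :=
  ∀ i j k l, E i j * E k l - E k l * E i j =
    (if k = j then E i l else 0) - if i = l then E k j else 0

theorem glRelations_of_weyl {x D : Fin n → A} (hx : ∀ i j, Commute (x i) (x j))
    (hD : ∀ i j, Commute (D i) (D j))
    (hDx : ∀ i j, D i * x j = x j * D i + if i = j then 1 else 0) :
    GLRelations fun i j => x i * D j := by
  have normal_order (i j k l : Fin n) : x i * D j * (x k * D l) =
      x i * x k * (D j * D l) + if k = j then x i * D l else 0 := by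
    rw [mul_assoc, ← mul_assoc (D j), hDx, add_mul, mul_add, mul_assoc, mul_assoc]
    by_cases h : k = j
    · simp [h]
    · simp [h, Ne.symm h]
  intro i j k l
  simp only [normal_order]
  rw [(hx i k).eq, (hD j l).eq, add_sub_add_left_eq_sub]

/-- The matrix `1 + E (u - a)⁻¹`. -/
def lax (E : Fin n → Fin n → A) (a : A) : Matrix (Fin n) (Fin n) A⟦X⟧ :=
  Matrix.of fun i j => PowerSeries.mk fun
    | 0 => if i = j then 1 else 0
    | r + 1 => a ^ r * E i j

theorem coeff_zero_lax (E : Fin n → Fin n → A) (a : A) (i j : Fin n) :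
    coeff 0 (lax E a i j) = if i = j then 1 else 0 := by
  rw [lax, Matrix.of_apply, coeff_mk]

theorem coeff_succ_lax (E : Fin n → Fin n → A) (a : A) (i j : Fin n) (r : ℕ) :
    coeff (r + 1) (lax E a i j) = a ^ r * E i j := by
  rw [lax, Matrix.of_apply, coeff_mk]

theorem map_constantCoeff_lax (E : Fin n → Fin n → A) (a : A) :
    (lax E a).map constantCoeff = 1 := by
  ext i j
  rw [Matrix.map_apply, ← coeff_zero_eq_constantCoeff_apply, coeff_zero_lax, Matrix.one_apply]

theorem coeff_lax_mem {S : Subring A} {E : Fin n → Fin n → A} {a : A} (ha : a ∈ S)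
    (hE : ∀ i j, E i j ∈ S) (i j : Fin n) (r : ℕ) : coeff r (lax E a i j) ∈ S := by
  rcases r with _ | r
  · rw [coeff_zero_lax]
    split_ifs
    · exact one_mem S
    · exact zero_mem S
  · rw [coeff_succ_lax]
    exact mul_mem (pow_mem ha r) (hE i j)

theorem rtt_lax {E : Fin n → Fin n → A} {a : A} (ha : ∀ x, Commute a x) (hE : GLRelations E) :
    RTT (dd A) (ee A) ((lax E a).map inU) ((lax E a).map inV) := by
  rw [← coeffRel_iff _ (map_constantCoeff_lax E a)]
  have pow_mul_mul (i j k l : Fin n) (p q : ℕ) :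
      a ^ p * E i j * (a ^ q * E k l) = a ^ (p + q) * (E i j * E k l) := by
    rw [pow_add, mul_assoc, ← mul_assoc (E i j), ← ((ha (E i j)).pow_left q).eq]
    simp only [mul_assoc]
  intro i j k l r s
  rcases r with _ | r <;> rcases s with _ | s <;>
    simp only [coeff_zero_lax, coeff_succ_lax, pow_mul_mul]
  · split_ifs <;> simp
  · rw [zero_add, add_zero, ← mul_sub, hE, mul_sub]
    split_ifs <;> simp
  · rw [zero_add, add_zero, ← mul_sub, hE, mul_sub]
    split_ifs <;> simp
  · rw [show r + 1 + s = r + (s + 1) by ring, show s + (r + 1) = r + (s + 1) by ring,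
      show s + 1 + r = r + (s + 1) by ring, add_comm s r, ← mul_sub, ← mul_sub, hE, sub_self,
      sub_self, mul_zero]

variable {K : Type*}

/-- The product of the matrices `1 + E_k (u - a_k)⁻¹` over a list. -/
def laxProd (E : K → Fin n → Fin n → A) (a : K → A) (l : List K) : Matrix (Fin n) (Fin n) A⟦X⟧ :=
  (l.map fun k => lax (E k) (a k)).prod

theorem laxProd_nil (E : K → Fin n → Fin n → A) (a : K → A) : laxProd E a [] = 1 := rfl

theorem laxProd_cons (E : K → Fin n → Fin n → A) (a : K → A) (k : K) (l : List K) :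
    laxProd E a (k :: l) = lax (E k) (a k) * laxProd E a l := by
  rw [laxProd, List.map_cons, List.prod_cons, laxProd]

theorem map_constantCoeff_laxProd (E : K → Fin n → Fin n → A) (a : K → A) (l : List K) :
    (laxProd E a l).map constantCoeff = 1 := by
  induction l with
  | nil => exact Matrix.map_one _ (map_zero _) (map_one _)
  | cons k l ih => rw [laxProd_cons, Matrix.map_mul, map_constantCoeff_lax, one_mul, ih]

theorem coeff_laxProd_mem {S : Subring A} {E : K → Fin n → Fin n → A} {a : K → A} {l : List K}
    (ha : ∀ k, a k ∈ S) (hE : ∀ k ∈ l, ∀ i j, E k i j ∈ S) (i j : Fin n) (r : ℕ) :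
    coeff r (laxProd E a l i j) ∈ S := by
  induction l generalizing i j r with
  | nil =>
    rw [laxProd_nil, Matrix.one_apply]
    split_ifs
    · rw [coeff_one]
      split_ifs
      · exact one_mem S
      · exact zero_mem S
    · rw [map_zero]
      exact zero_mem S
  | cons k l ih =>
    rw [laxProd_cons, Matrix.mul_apply, map_sum]
    refine sum_mem fun b _ => ?_
    rw [coeff_mul]
    refine sum_mem fun p _ => mul_mem ?_ ?_
    · exact coeff_lax_mem (ha k) (hE k List.mem_cons_self) i b p.1
    · exact ih (fun k hk => hE k (List.mem_cons_of_mem _ hk)) b j p.2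

theorem commute_coeff_laxProd_coeff_lax {E : K → Fin n → Fin n → A} {a : K → A}
    (ha : ∀ k x, Commute (a k) x) {c : K} {l : List K}
    (hE : ∀ d ∈ l, ∀ i j i' j', Commute (E d i j) (E c i' j')) (i j i' j' : Fin n) (p q : ℕ) :
    Commute (coeff p (laxProd E a l i j)) (coeff q (lax (E c) (a c) i' j')) := by
  have mem_centralizer_singleton {x y : A} (h : Commute y x) : x ∈ Subring.centralizer {y} :=
    Subring.mem_centralizer_iff.2 fun z hz => Set.mem_singleton_iff.1 hz ▸ h
  have commute_of_mem {x y : A} (h : x ∈ Subring.centralizer {y}) : Commute x y :=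
    (Subring.mem_centralizer_iff.1 h y rfl).symm
  refine commute_of_mem (coeff_laxProd_mem ?_ ?_ i j p)
  · exact fun k => mem_centralizer_singleton (ha k _).symm
  · exact fun d hd i j => mem_centralizer_singleton (commute_of_mem (coeff_lax_mem
      (mem_centralizer_singleton (ha c _).symm)
      (fun i' j' => mem_centralizer_singleton (hE d hd i j i' j')) i' j' q))

theorem rtt_laxProd {E : K → Fin n → Fin n → A} {a : K → A} (ha : ∀ k x, Commute (a k) x)
    (hE : ∀ c, GLRelations (E c))
    (hcomm : ∀ c d, c ≠ d → ∀ i j k l, Commute (E c i j) (E d k l)) {l : List K} (hl : l.Nodup) :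
    RTT (dd A) (ee A) ((laxProd E a l).map inU) ((laxProd E a l).map inV) := by
  induction l with
  | nil =>
    intro i j k l
    simp only [laxProd_nil, Matrix.map_apply, Matrix.one_apply]
    split_ifs <;> simp
  | cons c l ih =>
    rw [List.nodup_cons] at hl
    have commute_coeff := commute_coeff_laxProd_coeff_lax (E := E) ha (c := c) (l := l)
      fun d hd => hcomm d c fun h => hl.1 (h ▸ hd)
    rw [laxProd_cons, Matrix.map_mul, Matrix.map_mul]
    refine RTT.mul dd_comm ee_comm (rtt_lax (ha c) (hE c)) (ih hl.2) ?_ ?_ <;> intro i j k l' <;>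
      ext q p <;> simp only [Matrix.map_apply, coeff_uv, coeff_vu]
    · exact commute_coeff _ _ _ _ _ _
    · exact (commute_coeff _ _ _ _ _ _).symm

end Lax

section TopCoeff

variable {B : Type*} [Ring B]

/-- `f` has degree at most `d`, with coefficient `b` in degree `d`. -/
def HasTopCoeff (f : Polynomial B) (d : ℕ) (b : B) : Prop := f.natDegree ≤ d ∧ f.coeff d = b

namespace HasTopCoeff

variable {f g : Polynomial B} {d e : ℕ} {b c : B}

theorem mul (hf : HasTopCoeff f d b) (hg : HasTopCoeff g e c) :
    HasTopCoeff (f * g) (d + e) (b * c) :=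
  ⟨Polynomial.natDegree_mul_le_of_le hf.1 hg.1, by
    rw [Polynomial.coeff_mul_add_eq_of_natDegree_le hf.1 hg.1, hf.2, hg.2]⟩

theorem add (hf : HasTopCoeff f d b) (hg : HasTopCoeff g d c) : HasTopCoeff (f + g) d (b + c) :=
  ⟨Polynomial.natDegree_add_le_of_degree_le hf.1 hg.1, by rw [Polynomial.coeff_add, hf.2, hg.2]⟩

theorem smul {R : Type*} [CommRing R] [Algebra R B] (r : R) (hf : HasTopCoeff f d b) :
    HasTopCoeff (r • f) d (r • b) :=
  ⟨(Polynomial.natDegree_smul_le r f).trans hf.1, by rw [Polynomial.coeff_smul, hf.2]⟩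

theorem zero (d : ℕ) : HasTopCoeff (0 : Polynomial B) d 0 := by simp [HasTopCoeff]

theorem one : HasTopCoeff (1 : Polynomial B) 0 1 := by simp [HasTopCoeff]

theorem C (b : B) : HasTopCoeff (Polynomial.C b) 0 b :=
  ⟨(Polynomial.natDegree_C b).le, Polynomial.coeff_C_zero⟩

theorem X_pow (d : ℕ) : HasTopCoeff (Polynomial.X ^ d : Polynomial B) d 1 :=
  ⟨Polynomial.natDegree_X_pow_le d, by simp⟩

theorem of_lt (h : f.natDegree < d) : HasTopCoeff f d 0 :=
  ⟨h.le, Polynomial.coeff_eq_zero_of_natDegree_lt h⟩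

theorem pow (hf : HasTopCoeff f d b) (r : ℕ) : HasTopCoeff (f ^ r) (d * r) (b ^ r) := by
  induction r with
  | zero => simpa using one
  | succ r ih =>
    rw [pow_succ, pow_succ, Nat.mul_succ]
    exact ih.mul hf

end HasTopCoeff

theorem natDegree_coeff_succ_mul_le {f g : (Polynomial B)⟦X⟧} (hf₀ : coeff 0 f = 0)
    (hg₀ : coeff 0 g = 0) (hf : ∀ r, (coeff (r + 1) f).natDegree ≤ 2 * r + 1)
    (hg : ∀ r, (coeff (r + 1) g).natDegree ≤ 2 * r + 1) (r : ℕ) :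
    (coeff (r + 1) (f * g)).natDegree ≤ 2 * r := by
  rw [coeff_mul]
  refine Polynomial.natDegree_sum_le_of_forall_le _ _ ?_
  rintro ⟨_ | p, _ | q⟩ hpq
  · rw [hf₀, zero_mul, Polynomial.natDegree_zero]
    exact Nat.zero_le _
  · rw [hf₀, zero_mul, Polynomial.natDegree_zero]
    exact Nat.zero_le _
  · rw [hg₀, mul_zero, Polynomial.natDegree_zero]
    exact Nat.zero_le _
  · refine (Polynomial.natDegree_mul_le_of_le (hf p) (hg q)).trans ?_
    rw [Finset.HasAntidiagonal.mem_antidiagonal] at hpq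
    omega

variable {n : ℕ}

theorem hasTopCoeff_coeff_mul {M N : Matrix (Fin n) (Fin n) (Polynomial B)⟦X⟧}
    {μ ν : Fin n → Fin n → ℕ → B} (hM₀ : M.map constantCoeff = 1) (hN₀ : N.map constantCoeff = 1)
    (hM : ∀ i j r, HasTopCoeff (coeff (r + 1) (M i j)) (2 * r + 1) (μ i j r))
    (hN : ∀ i j r, HasTopCoeff (coeff (r + 1) (N i j)) (2 * r + 1) (ν i j r)) (i j : Fin n)
    (r : ℕ) :
    HasTopCoeff (coeff (r + 1) ((M * N) i j)) (2 * r + 1) (μ i j r + ν i j r) := by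
  have coeff_zero_sub_one {L : Matrix (Fin n) (Fin n) (Polynomial B)⟦X⟧}
      (hL : L.map constantCoeff = 1) (k l : Fin n) : coeff 0 ((L - 1) k l) = 0 := by
    have entry := congrFun (congrFun hL k) l
    rw [Matrix.map_apply, Matrix.one_apply] at entry
    rw [Matrix.sub_apply, Matrix.one_apply, coeff_zero_eq_constantCoeff_apply, map_sub, entry]
    split_ifs <;> simp
  have coeff_succ_one (k l : Fin n) (r : ℕ) :
      coeff (r + 1) ((1 : Matrix (Fin n) (Fin n) (Polynomial B)⟦X⟧) k l) = 0 := by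
    rw [Matrix.one_apply]
    split_ifs
    · rw [coeff_one, if_neg r.succ_ne_zero]
    · exact map_zero _
  have natDegree_sub_one {L : Matrix (Fin n) (Fin n) (Polynomial B)⟦X⟧} {l : Fin n → Fin n → ℕ → B}
      (hL : ∀ i j r, HasTopCoeff (coeff (r + 1) (L i j)) (2 * r + 1) (l i j r)) (i j : Fin n)
      (r : ℕ) : (coeff (r + 1) ((L - 1) i j)).natDegree ≤ 2 * r + 1 := by
    rw [Matrix.sub_apply, map_sub, coeff_succ_one, sub_zero]
    exact (hL i j r).1
  have mul_eq : M * N = M + N + (M - 1) * (N - 1) - 1 := by noncomm_ring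
  rw [mul_eq, Matrix.sub_apply, Matrix.add_apply, Matrix.add_apply, map_sub, map_add, map_add,
    coeff_succ_one, sub_zero, ← add_zero (μ i j r + ν i j r)]
  refine ((hM i j r).add (hN i j r)).add (HasTopCoeff.of_lt (Nat.lt_succ_of_le ?_))
  rw [Matrix.mul_apply, map_sum]
  exact Polynomial.natDegree_sum_le_of_forall_le _ _ fun b _ =>
    natDegree_coeff_succ_mul_le (coeff_zero_sub_one hM₀ i b) (coeff_zero_sub_one hN₀ b j)
      (natDegree_sub_one hM i b) (natDegree_sub_one hN b j) r

theorem hasTopCoeff_coeff_laxProd {K : Type*} {E : K → Fin n → Fin n → Polynomial B}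
    {a : K → Polynomial B} {ε : K → Fin n → Fin n → B} {α : K → B}
    (hE : ∀ k i j, HasTopCoeff (E k i j) 1 (ε k i j)) (ha : ∀ k, HasTopCoeff (a k) 2 (α k))
    (l : List K) (i j : Fin n) (r : ℕ) :
    HasTopCoeff (coeff (r + 1) (laxProd E a l i j)) (2 * r + 1)
      (l.map fun k => α k ^ r * ε k i j).sum := by
  induction l generalizing i j r with
  | nil =>
    rw [laxProd_nil, Matrix.one_apply, List.map_nil, List.sum_nil]
    split_ifs
    · rw [coeff_one, if_neg r.succ_ne_zero]
      exact .zero _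
    · rw [map_zero]
      exact .zero _
  | cons k l ih =>
    rw [laxProd_cons, List.map_cons, List.sum_cons]
    refine hasTopCoeff_coeff_mul (μ := fun i j r => α k ^ r * ε k i j) (map_constantCoeff_lax _ _)
      (map_constantCoeff_laxProd _ _ _) (fun i j r => ?_) ih i j r
    rw [coeff_succ_lax]
    exact ((ha k).pow r).mul (hE k i j)

end TopCoeff

section Operators

variable {σ : Type*}

/-- The operator of multiplication by a polynomial. -/
def mulEnd : MvPolynomial σ ℂ →ₐ[ℂ] Module.End ℂ (MvPolynomial σ ℂ) := Algebra.lmul ℂ _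

theorem mulEnd_apply (p q : MvPolynomial σ ℂ) : mulEnd p q = p * q := rfl

/-- The operator of partial differentiation. -/
def derEnd (a : σ) : Module.End ℂ (MvPolynomial σ ℂ) :=
  (MvPolynomial.pderiv a : Derivation ℂ (MvPolynomial σ ℂ) (MvPolynomial σ ℂ)).toLinearMap

theorem derEnd_apply (a : σ) (p : MvPolynomial σ ℂ) : derEnd a p = MvPolynomial.pderiv a p := rfl

theorem commute_mulEnd (p q : MvPolynomial σ ℂ) : Commute (mulEnd p) (mulEnd q) :=
  (Commute.all p q).map mulEnd

theorem lie_pderiv_pderiv (a b : σ) :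
    ⁅(MvPolynomial.pderiv a : Derivation ℂ (MvPolynomial σ ℂ) (MvPolynomial σ ℂ)),
      (MvPolynomial.pderiv b : Derivation ℂ (MvPolynomial σ ℂ) (MvPolynomial σ ℂ))⁆ = 0 := by
  classical
  apply MvPolynomial.derivation_ext
  intro i
  rw [Derivation.commutator_apply, MvPolynomial.pderiv_X, MvPolynomial.pderiv_X]
  simp only [Pi.single_apply]
  split_ifs <;> simp

theorem commute_derEnd (a b : σ) : Commute (derEnd a) (derEnd b) :=
  LinearMap.ext fun p => by
    have lie_apply := DFunLike.congr_fun (lie_pderiv_pderiv a b) p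
    rw [Derivation.commutator_apply] at lie_apply
    exact sub_eq_zero.1 lie_apply

theorem derEnd_mul_mulEnd_X [DecidableEq σ] (a b : σ) :
    derEnd a * mulEnd (MvPolynomial.X b) = mulEnd (MvPolynomial.X b) * derEnd a +
      if a = b then 1 else 0 := by
  refine LinearMap.ext fun p => ?_
  rw [LinearMap.add_apply, Module.End.mul_apply, Module.End.mul_apply, mulEnd_apply, mulEnd_apply,
    derEnd_apply, derEnd_apply, MvPolynomial.pderiv_mul, MvPolynomial.pderiv_X, add_comm,
    Pi.single_apply]
  congr 1
  by_cases h : a = b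
  · simp [h]
  · simp [h, Ne.symm h]

end Operators

section Representation

/-- The homomorphism out of the Yangian that sends `T(u)` to the matrix `M`. -/
def liftMat {n : ℕ} {A : Type*} [Ring A] [Algebra ℂ A] (M : Matrix (Fin n) (Fin n) A⟦X⟧)
    (h₀ : M.map constantCoeff = 1) (h : RTT (dd A) (ee A) (M.map inU) (M.map inV)) :
    Yangian n →ₐ[ℂ] A :=
  lift (fun i j r => coeff r (M i j))
    (fun i j => by
      have entry := congrFun (congrFun h₀ i) j
      rwa [Matrix.map_apply, Matrix.one_apply, ← coeff_zero_eq_constantCoeff_apply] at entry)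
    ((coeffRel_iff M h₀).2 h)

theorem liftMat_t {n : ℕ} {A : Type*} [Ring A] [Algebra ℂ A] (M : Matrix (Fin n) (Fin n) A⟦X⟧)
    (h₀) (h) (i j : Fin n) (r : ℕ) : liftMat M h₀ h (t i j r) = coeff r (M i j) :=
  lift_t _ _ _ _ _ _

/-- The indices of the tensor factors of the representation: one factor for each column `j` of
matrix units and each evaluation point `0, …, R - 1`, repeated `n` times. -/
abbrev Legs (n R : ℕ) : Type := Fin n × Fin n × Fin R

/-- The polynomial functions on which the representation acts. -/
abbrev Fock (n R : ℕ) : Type := MvPolynomial (Legs n R × Fin n) ℂ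

variable {n R : ℕ}

/-- The operator of multiplication by a variable. -/
def mulOp (k : Legs n R) (i : Fin n) : Polynomial (Module.End ℂ (Fock n R)) :=
  Polynomial.C (mulEnd (MvPolynomial.X (k, i)))

/-- The partial derivative `∂_j`, translated by the deformation parameter if `j` is the second
entry of `k`. -/
def derOp (k : Legs n R) (j : Fin n) : Polynomial (Module.End ℂ (Fock n R)) :=
  Polynomial.C (derEnd (k, j)) + if j = k.2.1 then Polynomial.X else 0

/-- The operators `x_i (∂_j + λ δ_{jb})`, where `λ` is the deformation parameter. -/
def glOp (k : Legs n R) (i j : Fin n) : Polynomial (Module.End ℂ (Fock n R)) :=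
  mulOp k i * derOp k j

/-- The evaluation points of the representation. -/
def evalPt (k : Legs n R) : Polynomial (Module.End ℂ (Fock n R)) :=
  Polynomial.C (algebraMap ℂ _ ((k.2.2 : ℕ) : ℂ)) * Polynomial.X ^ 2

theorem commute_mulOp (k l : Legs n R) (i j : Fin n) : Commute (mulOp k i) (mulOp l j) :=
  (commute_mulEnd _ _).map Polynomial.C

theorem commute_ite_X {A : Type*} [Ring A] (P : Prop) [Decidable P] (f : Polynomial A) :
    Commute (if P then Polynomial.X else 0) f := by
  split_ifs
  · exact Polynomial.commute_X f
  · exact Commute.zero_left _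

theorem commute_derOp (k l : Legs n R) (i j : Fin n) : Commute (derOp k i) (derOp l j) :=
  Commute.add_left (Commute.add_right ((commute_derEnd _ _).map Polynomial.C)
    (commute_ite_X _ _).symm) (commute_ite_X _ _)

theorem derOp_mul_mulOp (k l : Legs n R) (i j : Fin n) :
    derOp k i * mulOp l j = mulOp l j * derOp k i + if (k, i) = (l, j) then 1 else 0 := by
  rw [derOp, mulOp, add_mul, mul_add, ← Polynomial.C_mul, ← Polynomial.C_mul, derEnd_mul_mulEnd_X,
    (commute_ite_X _ _).eq, Polynomial.C_add, add_right_comm]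
  congr 1
  split_ifs
  · exact Polynomial.C_1
  · exact Polynomial.C_0

theorem commute_evalPt (k : Legs n R) (f : Polynomial (Module.End ℂ (Fock n R))) :
    Commute (evalPt k) f :=
  Commute.mul_left (Algebra.commutes ((k.2.2 : ℕ) : ℂ) f) ((Polynomial.commute_X f).pow_left 2)

theorem glRelations_glOp (k : Legs n R) : GLRelations (glOp k) :=
  glRelations_of_weyl (commute_mulOp k k) (commute_derOp k k) fun i j => by
    simp [derOp_mul_mulOp]

theorem commute_glOp (c d : Legs n R) (hcd : c ≠ d) (i j k l : Fin n) :
    Commute (glOp c i j) (glOp d k l) := by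
  have commute_derOp_mulOp {c d : Legs n R} (hcd : c ≠ d) (i j : Fin n) :
      Commute (derOp c i) (mulOp d j) := by
    rw [Commute, SemiconjBy, derOp_mul_mulOp, if_neg (by simp [hcd]), add_zero]
  exact ((commute_mulOp _ _ _ _).mul_right (commute_derOp_mulOp hcd.symm _ _).symm).mul_left
    ((commute_derOp_mulOp hcd _ _).mul_right (commute_derOp _ _ _ _))

variable (n R) in
/-- The tensor product of evaluation representations `T(u) ↦ ∏ₖ (1 + Eₖ (u - aₖ)⁻¹)`. -/
def rep : Yangian n →ₐ[ℂ] Polynomial (Module.End ℂ (Fock n R)) :=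
  liftMat (laxProd glOp evalPt Finset.univ.toList) (map_constantCoeff_laxProd _ _ _)
    (rtt_laxProd commute_evalPt glRelations_glOp commute_glOp (Finset.nodup_toList _))

theorem hasTopCoeff_glOp (k : Legs n R) (i j : Fin n) :
    HasTopCoeff (glOp k i j) 1 (mulEnd (if j = k.2.1 then MvPolynomial.X (k, i) else 0)) := by
  have hasTopCoeff_derOp : HasTopCoeff (derOp k j) 1 (if j = k.2.1 then 1 else 0) := by
    rw [← zero_add (if j = k.2.1 then (1 : Module.End ℂ (Fock n R)) else 0)]
    refine .add (.of_lt (by simp)) ?_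
    split_ifs
    · exact pow_one (Polynomial.X : Polynomial (Module.End ℂ (Fock n R))) ▸ .X_pow 1
    · exact .zero _
  have hasTopCoeff_mul := (HasTopCoeff.C (mulEnd (MvPolynomial.X (k, i)))).mul hasTopCoeff_derOp
  rwa [zero_add, mul_ite, mul_one, mul_zero, ← map_zero mulEnd, ← apply_ite] at hasTopCoeff_mul

theorem hasTopCoeff_evalPt (k : Legs n R) :
    HasTopCoeff (evalPt k) 2 (algebraMap ℂ (Module.End ℂ (Fock n R)) ((k.2.2 : ℕ) : ℂ)) := by
  simpa only [evalPt, zero_add, mul_one] using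
    (HasTopCoeff.C (algebraMap ℂ (Module.End ℂ (Fock n R)) ((k.2.2 : ℕ) : ℂ))).mul (.X_pow 2)

variable (n R) in
/-- The polynomial by which the leading coefficient of a generator acts in the representation. -/
def topSymbol (g : GenIndex n) : Fock n R :=
  ∑ k : Legs n R, (((k.2.2 : ℕ) : ℂ) ^ g.2.2) •
    if g.2.1 = k.2.1 then MvPolynomial.X (k, g.1) else 0

theorem hasTopCoeff_rep_gen (g : GenIndex n) :
    HasTopCoeff (rep n R (gen g)) (genWeight g) (mulEnd (topSymbol n R g)) := by
  obtain ⟨i, j, r⟩ := g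
  rw [gen, rep, liftMat_t, topSymbol, map_sum]
  convert hasTopCoeff_coeff_laxProd hasTopCoeff_glOp hasTopCoeff_evalPt
    Finset.univ.toList i j r using 1
  · rfl
  rw [Finset.sum_map_toList]
  refine Finset.sum_congr rfl fun k _ => ?_
  rw [map_smul, ← map_pow, Algebra.smul_def]

theorem hasTopCoeff_rep_wordProd (L : List (GenIndex n)) :
    HasTopCoeff (rep n R (wordProd L)) (wordWeight L)
      (mulEnd (MvPolynomial.aeval (topSymbol n R) (wordMonomial L))) := by
  induction L with
  | nil => simpa using HasTopCoeff.one
  | cons g L ih =>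
    rw [wordProd_cons, wordWeight_cons, wordMonomial_cons, map_mul, map_mul, map_mul,
      MvPolynomial.aeval_X]
    exact (hasTopCoeff_rep_gen g).mul ih

theorem hasTopCoeff_rep_of_mem_filtration {w : ℕ} {x : Yangian n} (hx : x ∈ filtration n w) :
    HasTopCoeff (rep n R x) w 0 := by
  induction hx using Submodule.span_induction with
  | mem x hx =>
    obtain ⟨L, hL, rfl⟩ := hx
    exact .of_lt ((hasTopCoeff_rep_wordProd L).1.trans_lt hL)
  | zero => simpa using HasTopCoeff.zero w
  | add x y _ _ hx hy => simpa using hx.add hy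
  | smul c x _ hx => simpa using hx.smul c

theorem HasSymbol.hasTopCoeff_rep {w : ℕ} {x : Yangian n} {p : MvPolynomial (GenIndex n) ℂ}
    (h : HasSymbol w x p) :
    HasTopCoeff (rep n R x) w (mulEnd (MvPolynomial.aeval (topSymbol n R) p)) := by
  induction h with
  | word L hL => exact hL ▸ hasTopCoeff_rep_wordProd L
  | lower hx => simpa using hasTopCoeff_rep_of_mem_filtration hx
  | add _ _ hx hy => simpa using hx.add hy
  | smul c _ hx => simpa using hx.smul c

variable (R) in
theorem exists_eval_topSymbol (v : GenIndex n → ℂ) :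
    ∃ y : Legs n R × Fin n → ℂ, ∀ g : GenIndex n, g.2.2 < R →
      MvPolynomial.eval y (topSymbol n R g) = v g := by
  let V : Matrix (Fin R) (Fin R) ℂ := (Matrix.vandermonde fun l : Fin R => ((l : ℕ) : ℂ)).transpose
  have isUnit_det_V : IsUnit V.det := by
    rw [Matrix.det_transpose, isUnit_iff_ne_zero, Matrix.det_vandermonde_ne_zero_iff]
    exact Nat.cast_injective.comp Fin.val_injective
  let c (i j : Fin n) : Fin R → ℂ := V⁻¹.mulVec fun r => v (i, j, r)
  refine ⟨fun q => if q.2 = q.1.1 then c q.1.1 q.1.2.1 q.1.2.2 else 0, ?_⟩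
  rintro ⟨i, j, r⟩ hr
  have mulVec_c : V.mulVec (c i j) ⟨r, hr⟩ = v (i, j, r) := by
    rw [Matrix.mulVec_mulVec, Matrix.mul_nonsing_inv _ isUnit_det_V, Matrix.one_mulVec]
  rw [← mulVec_c, topSymbol, map_sum]
  simp only [Fintype.sum_prod_type, MvPolynomial.smul_eval, Matrix.mulVec, dotProduct]
  rw [Finset.sum_eq_single i, Finset.sum_eq_single j]
  · refine Finset.sum_congr rfl fun l _ => ?_
    simp [V, Matrix.vandermonde_apply]
  · intro b _ hb
    simp [hb.symm]
  · simp
  · intro a _ ha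
    refine Finset.sum_eq_zero fun b _ => Finset.sum_eq_zero fun l _ => ?_
    split_ifs <;> simp [ha.symm]
  · simp

theorem exists_forall_mem_vars_lt (p : MvPolynomial (GenIndex n) ℂ) :
    ∃ R, ∀ g ∈ p.vars, g.2.2 < R :=
  ⟨p.vars.sup (fun g => g.2.2) + 1, fun _ hg =>
    Nat.lt_succ_of_le (Finset.le_sup (f := fun g : GenIndex n => g.2.2) hg)⟩

theorem HasSymbol.eq_zero {w : ℕ} {p : MvPolynomial (GenIndex n) ℂ} (h : HasSymbol w 0 p) :
    p = 0 := by
  refine MvPolynomial.funext fun v => ?_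
  obtain ⟨R, hR⟩ := exists_forall_mem_vars_lt p
  have aeval_topSymbol : MvPolynomial.aeval (topSymbol n R) p = 0 := by
    have mulEnd_aeval := h.hasTopCoeff_rep (R := R).2
    rw [map_zero, Polynomial.coeff_zero] at mulEnd_aeval
    simpa [mulEnd_apply] using (DFunLike.congr_fun mulEnd_aeval 1).symm
  obtain ⟨y, hy⟩ := exists_eval_topSymbol R v
  rw [map_zero, ← map_zero (MvPolynomial.eval y), ← aeval_topSymbol]
  refine MvPolynomial.hom_congr_vars (f₁ := MvPolynomial.eval v)
    (f₂ := (MvPolynomial.eval y).comp (MvPolynomial.aeval (topSymbol n R)).toRingHom) ?_ ?_ rfl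
  · ext c
    simp
  · intro g hg _
    simpa using (hy g (hR g hg)).symm

end Representation

/-! ### The Poisson center of the ring of symbols -/

section DirectionalDerivative

variable {σ R : Type*} [CommRing R]

theorem derivative_aeval_line (v w : σ → R) (p : MvPolynomial σ R) :
    Polynomial.derivative (MvPolynomial.aeval
        (fun a => Polynomial.C (v a) + Polynomial.C (w a) * Polynomial.X) p) =
      MvPolynomial.aeval (fun a => Polynomial.C (v a) + Polynomial.C (w a) * Polynomial.X)
        (MvPolynomial.mkDerivation R (fun a => MvPolynomial.C (w a)) p) := by
  induction p using MvPolynomial.induction_on with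
  | C c => simp [MvPolynomial.derivation_C]
  | add p q hp hq => simp only [map_add, hp, hq]
  | mul_X p a hp =>
    simp only [map_mul, Polynomial.derivative_mul, hp, Derivation.leibniz, map_add,
      MvPolynomial.mkDerivation_X, MvPolynomial.aeval_X, MvPolynomial.aeval_C, smul_eq_mul,
      Polynomial.derivative_C, Polynomial.derivative_X,
      Polynomial.algebraMap_eq]
    ring

theorem eval_add_eq_of_mkDerivation_eq_zero [IsAddTorsionFree R] {v w : σ → R}
    {p : MvPolynomial σ R}
    (h : MvPolynomial.mkDerivation R (fun a => (MvPolynomial.C (w a) : MvPolynomial σ R)) p = 0) :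
    MvPolynomial.eval (v + w) p = MvPolynomial.eval v p := by
  set line : σ → Polynomial R := fun a =>
    Polynomial.C (v a) + Polynomial.C (w a) * Polynomial.X with line_def
  have eval_line (x : R) : Polynomial.eval x (MvPolynomial.aeval line p) =
      MvPolynomial.eval (v + x • w) p := by
    rw [← Polynomial.coe_aeval_eq_eval, ← AlgHom.comp_apply, MvPolynomial.comp_aeval,
      ← MvPolynomial.aeval_eq_eval]
    congr 2
    ext a
    simp [line_def, mul_comm x]
  have line_const := Polynomial.eq_C_of_derivative_eq_zero
    ((derivative_aeval_line v w p).trans (by rw [h, map_zero]))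
  have eval_zero := eval_line 0
  have eval_one := eval_line 1
  rw [line_const, Polynomial.eval_C] at eval_zero eval_one
  simpa using eval_one.symm.trans eval_zero

theorem mkDerivation_eq_sum_pderiv {p : MvPolynomial σ R} {s : Finset σ} (hs : p.vars ⊆ s)
    (f : σ → MvPolynomial σ R) :
    MvPolynomial.mkDerivation R f p = ∑ a ∈ s, f a * MvPolynomial.pderiv a p := by
  classical
  have sum_apply (q : MvPolynomial σ R) :
      (∑ a ∈ s, f a • MvPolynomial.pderiv a : Derivation R _ _) q =
        ∑ a ∈ s, f a * MvPolynomial.pderiv a q := by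
    rw [← Derivation.coeFnAddMonoidHom_apply, map_sum, Finset.sum_apply]
    rfl
  rw [← sum_apply]
  refine MvPolynomial.derivation_eq_of_forall_mem_vars fun b hb => ?_
  rw [sum_apply, MvPolynomial.mkDerivation_X, Finset.sum_eq_single_of_mem b (hs hb)]
  · rw [MvPolynomial.pderiv_X_self, mul_one]
  · intro a _ hab
    rw [MvPolynomial.pderiv_X_of_ne hab.symm, mul_zero]

end DirectionalDerivative

section PoissonCenter

variable {n : ℕ} {p : MvPolynomial (GenIndex n) ℂ}

theorem lie_pderiv_poissonBracket (i j a b : Fin n) (r s : ℕ) :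
    ⁅(MvPolynomial.pderiv (a, b, s + r) : Derivation ℂ (MvPolynomial (GenIndex n) ℂ) _),
        poissonBracket (i, j, s)⁆ =
      (if i = a then MvPolynomial.pderiv (j, b, r) else 0) -
        if j = b then MvPolynomial.pderiv (a, i, r) else 0 := by
  classical
  refine MvPolynomial.derivation_ext ?_
  rintro ⟨k, l, m⟩
  have poissonBracket_pderiv_X : poissonBracket (i, j, s) (MvPolynomial.pderiv (a, b, s + r)
      (MvPolynomial.X (R := ℂ) (k, l, m))) = 0 := by
    rw [MvPolynomial.pderiv_X, Pi.single_apply]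
    split_ifs <;> simp
  have ite_apply (P : Prop) [Decidable P]
      (D : Derivation ℂ (MvPolynomial (GenIndex n) ℂ) (MvPolynomial (GenIndex n) ℂ)) (q) :
      (if P then D else 0) q = if P then D q else 0 := by split_ifs <;> rfl
  rw [Derivation.commutator_apply, poissonBracket_pderiv_X, poissonBracket_X, sub_zero, map_sub,
    Derivation.sub_apply, ite_apply, ite_apply, apply_ite (MvPolynomial.pderiv _),
    apply_ite (MvPolynomial.pderiv _), map_zero]
  simp only [MvPolynomial.pderiv_X, Pi.single_apply, Prod.mk.injEq, add_right_inj]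
  grind

theorem pderiv_eq_of_poissonBracket_eq_zero (hp : ∀ g, poissonBracket g p = 0) (i j a b : Fin n)
    (r : ℕ) : (if i = a then MvPolynomial.pderiv (j, b, r) p else 0) =
      if j = b then MvPolynomial.pderiv (a, i, r) p else 0 := by
  obtain ⟨s, hs⟩ := exists_forall_mem_vars_lt p
  have pderiv_eq_zero : MvPolynomial.pderiv (a, b, s + r) p = 0 :=
    MvPolynomial.pderiv_eq_zero_of_notMem_vars fun h =>
      absurd (hs _ h) (Nat.not_lt.2 (Nat.le_add_right s r))
  have lie_apply := DFunLike.congr_fun (lie_pderiv_poissonBracket i j a b r s) p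
  rw [Derivation.commutator_apply, hp, pderiv_eq_zero, map_zero, map_zero, sub_zero,
    Derivation.sub_apply] at lie_apply
  have symm_eq := sub_eq_zero.1 lie_apply.symm
  split_ifs at symm_eq ⊢ <;> exact symm_eq

theorem pderiv_eq_zero_of_poissonBracket_eq_zero (hp : ∀ g, poissonBracket g p = 0) {i j : Fin n}
    (hij : i ≠ j) (r : ℕ) : MvPolynomial.pderiv (i, j, r) p = 0 := by
  simpa [hij] using pderiv_eq_of_poissonBracket_eq_zero hp i i i j r

theorem pderiv_diag_eq_of_poissonBracket_eq_zero (hp : ∀ g, poissonBracket g p = 0) (i j : Fin n)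
    (r : ℕ) : MvPolynomial.pderiv (i, i, r) p = MvPolynomial.pderiv (j, j, r) p := by
  simpa using (pderiv_eq_of_poissonBracket_eq_zero hp i j i j r).symm

theorem mkDerivation_eq_zero_of_poissonBracket_eq_zero (hp : ∀ g, poissonBracket g p = 0)
    {f : GenIndex n → MvPolynomial (GenIndex n) ℂ} (hf : ∀ r, ∑ i, f (i, i, r) = 0) :
    MvPolynomial.mkDerivation ℂ f p = 0 := by
  obtain ⟨R, hR⟩ := exists_forall_mem_vars_lt p
  have sum_diag (i : Fin n) (r : ℕ) : ∑ j, f (i, j, r) * MvPolynomial.pderiv (i, j, r) p =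
      f (i, i, r) * MvPolynomial.pderiv (i, i, r) p :=
    Finset.sum_eq_single_of_mem i (Finset.mem_univ i) fun j _ hij => by
      rw [pderiv_eq_zero_of_poissonBracket_eq_zero hp hij.symm, mul_zero]
  rw [mkDerivation_eq_sum_pderiv (s := Finset.univ ×ˢ Finset.univ ×ˢ Finset.range R)
    fun g hg => by simp [hR g hg]]
  simp only [Finset.sum_product]
  simp only [Finset.sum_comm (s := Finset.univ) (t := Finset.range R)]
  refine Finset.sum_eq_zero fun r _ => ?_
  simp only [sum_diag]
  rcases isEmpty_or_nonempty (Fin n) with _ | ⟨⟨j⟩⟩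
  · exact Fintype.sum_empty _
  · simp only [pderiv_diag_eq_of_poissonBracket_eq_zero hp _ j, ← Finset.sum_mul, hf, zero_mul]

/-- The substitution `E^{(r)} ↦ (tr E^{(r)} / n) 1` for the matrices `E^{(r)}` of variables. -/
def average (n : ℕ) : MvPolynomial (GenIndex n) ℂ →ₐ[ℂ] MvPolynomial (GenIndex n) ℂ :=
  MvPolynomial.aeval fun g =>
    if g.1 = g.2.1 then (1 / n : ℂ) • ∑ j, MvPolynomial.X (j, j, g.2.2) else 0

theorem average_X (g : GenIndex n) : average n (MvPolynomial.X g) =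
    if g.1 = g.2.1 then (1 / n : ℂ) • ∑ j, MvPolynomial.X (j, j, g.2.2) else 0 := by
  rw [average, MvPolynomial.aeval_X]

theorem eval_average (v : GenIndex n → ℂ) (p : MvPolynomial (GenIndex n) ℂ) :
    MvPolynomial.eval v (average n p) = MvPolynomial.eval (fun g =>
      if g.1 = g.2.1 then (1 / n : ℂ) * ∑ j, v (j, j, g.2.2) else 0) p := by
  rw [← MvPolynomial.aeval_eq_eval, ← AlgHom.comp_apply, average, MvPolynomial.comp_aeval,
    ← MvPolynomial.aeval_eq_eval]
  congr 2
  ext g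
  split_ifs <;> simp

theorem average_eq_self_of_poissonBracket_eq_zero (hn : 0 < n)
    (hp : ∀ g, poissonBracket g p = 0) : average n p = p := by
  refine MvPolynomial.funext fun v => ?_
  set v' : GenIndex n → ℂ := fun g =>
    if g.1 = g.2.1 then (1 / n : ℂ) * ∑ j, v (j, j, g.2.2) else 0 with v'_def
  have sum_v' (r : ℕ) : ∑ i, v' (i, i, r) = ∑ i, v (i, i, r) := by
    simp only [v'_def, if_true, Finset.sum_const, Finset.card_univ, Fintype.card_fin, nsmul_eq_mul]
    rw [← mul_assoc, mul_one_div_cancel (by exact_mod_cast hn.ne'), one_mul]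
  have directional_eq_zero :
      MvPolynomial.mkDerivation ℂ (fun g => MvPolynomial.C ((v' - v) g)) p = 0 :=
    mkDerivation_eq_zero_of_poissonBracket_eq_zero hp fun r => by
      rw [← map_sum]
      simp only [Pi.sub_apply]
      rw [Finset.sum_sub_distrib, sum_v', sub_self, map_zero]
  rw [eval_average, ← eval_add_eq_of_mkDerivation_eq_zero (v := v) directional_eq_zero,
    add_sub_cancel]

end PoissonCenter

/-! ### The leading terms of the quantum determinant -/

section SeriesFiltration

variable {n : ℕ}

/-- The series `∑ f_r u^{-r}` in which `f_r` has weight at most `2r - k`. The shift by `k` makes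
levels add up in products. -/
def seriesFiltration (n k : ℕ) : Submodule ℂ (Yangian n)⟦X⟧ where
  carrier := {f | ∀ r, coeff r f ∈ filtration n (2 * r + 1 - k)}
  zero_mem' r := by rw [map_zero]; exact zero_mem _
  add_mem' hf hg r := by rw [map_add]; exact add_mem (hf r) (hg r)
  smul_mem' c f hf r := by rw [coeff_smul]; exact Submodule.smul_mem _ c (hf r)

variable {k l : ℕ} {f g : (Yangian n)⟦X⟧}

theorem seriesFiltration_anti (h : k ≤ l) : seriesFiltration n l ≤ seriesFiltration n k :=
  fun _ hf r => filtration_mono (by omega) (hf r)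

theorem mul_mem_seriesFiltration (hf : f ∈ seriesFiltration n k) (hg : g ∈ seriesFiltration n l) :
    f * g ∈ seriesFiltration n (k + l) := by
  intro r
  rw [coeff_mul]
  refine Submodule.sum_mem _ fun p hp => ?_
  rw [Finset.HasAntidiagonal.mem_antidiagonal] at hp
  exact mul_mem_filtration (fun a b ha hb => by omega) (hf p.1) (hg p.2)

theorem one_mem_seriesFiltration : (1 : (Yangian n)⟦X⟧) ∈ seriesFiltration n 0 := by
  intro r
  rw [coeff_one]
  split_ifs
  · exact one_mem_filtration (by omega)
  · exact zero_mem _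

theorem mem_seriesFiltration_zero_of_sub_one_mem (h : f - 1 ∈ seriesFiltration n k) :
    f ∈ seriesFiltration n 0 := by
  simpa using add_mem (seriesFiltration_anti (Nat.zero_le k) h) one_mem_seriesFiltration

theorem mem_seriesFiltration_of_mul (hf : f ∈ seriesFiltration n 0) (hf₁ : constantCoeff f = 1)
    (h : f * g ∈ seriesFiltration n k) : g ∈ seriesFiltration n k := by
  intro r
  induction r using Nat.strong_induction_on with
  | _ r ih =>
    have coeff_mem := h r
    rw [coeff_mul, ← Finset.add_sum_erase _ _
      (show (0, r) ∈ Finset.HasAntidiagonal.antidiagonal r by simp),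
      coeff_zero_eq_constantCoeff_apply, hf₁, one_mul] at coeff_mem
    refine (Submodule.add_mem_iff_left _ (Submodule.sum_mem _ fun p hp => ?_)).1 coeff_mem
    obtain ⟨p, q⟩ := p
    rw [Finset.mem_erase, Finset.HasAntidiagonal.mem_antidiagonal] at hp
    have hpq : p ≠ 0 := by
      rintro rfl
      exact hp.1 (Prod.ext rfl (by simpa using hp.2))
    exact mul_mem_filtration (fun a b ha hb => by omega) (hf p) (ih q (by omega))

theorem shift_mem_seriesFiltration (a : ℂ) (hf : f ∈ seriesFiltration n k) :
    shift a f ∈ seriesFiltration n k := by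
  intro m
  rw [coeff_shift]
  refine Submodule.sum_mem _ fun r hr => Submodule.smul_mem _ _ (filtration_mono ?_ (hf r))
  rw [Finset.mem_range] at hr
  omega

theorem shift_sub_mem_seriesFiltration (a : ℂ) (hf : f ∈ seriesFiltration n k) :
    shift a f - f ∈ seriesFiltration n (k + 2) := by
  intro m
  rw [map_sub, coeff_shift, Finset.sum_range_succ, coeff_invShift_pow_self, one_smul,
    add_sub_cancel_right]
  refine Submodule.sum_mem _ fun r hr => Submodule.smul_mem _ _ (filtration_mono ?_ (hf r))
  rw [Finset.mem_range] at hr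
  omega

theorem list_prod_mem_seriesFiltration {ι : Type*} {f : ι → (Yangian n)⟦X⟧} {k : ι → ℕ}
    (h : ∀ a, f a ∈ seriesFiltration n (k a)) (l : List ι) :
    (l.map f).prod ∈ seriesFiltration n (l.map k).sum := by
  induction l with
  | nil => exact one_mem_seriesFiltration
  | cons a l ih => exact mul_mem_seriesFiltration (h a) ih

theorem list_prod_sub_mem_seriesFiltration {ι : Type*} {f : ι → (Yangian n)⟦X⟧}
    (h : ∀ a, f a - 1 ∈ seriesFiltration n 1) (l : List ι) :
    (l.map f).prod - (1 + (l.map fun a => f a - 1).sum) ∈ seriesFiltration n 2 := by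
  induction l with
  | nil => simp
  | cons a l ih =>
    have sum_mem : (l.map fun a => f a - 1).sum ∈ seriesFiltration n 1 := by
      refine list_sum_mem fun x hx => ?_
      obtain ⟨b, _, rfl⟩ := List.mem_map.1 hx
      exact h b
    have product_mem : (f a - 1) * (l.map fun a => f a - 1).sum ∈ seriesFiltration n 2 :=
      mul_mem_seriesFiltration (k := 1) (l := 1) (h a) sum_mem
    have defect_mem := mul_mem_seriesFiltration (mem_seriesFiltration_zero_of_sub_one_mem (h a)) ih
    rw [zero_add] at defect_mem
    have decomposition : ((a :: l).map f).prod - (1 + ((a :: l).map fun a => f a - 1).sum) =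
        f a * ((l.map f).prod - (1 + (l.map fun a => f a - 1).sum)) +
          (f a - 1) * (l.map fun a => f a - 1).sum := by
      rw [List.map_cons, List.prod_cons, List.map_cons, List.sum_cons]
      noncomm_ring
    rw [decomposition]
    exact add_mem defect_mem product_mem

theorem T_sub_mem_seriesFiltration (i j : Fin n) :
    T n i j - (if i = j then 1 else 0) ∈ seriesFiltration n 1 := by
  rintro (_ | r)
  · rw [map_sub, coeff_T, t_zero]
    split_ifs <;> simp
  · have coeff_ite : coeff (r + 1) (if i = j then (1 : (Yangian n)⟦X⟧) else 0) = 0 := by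
      split_ifs
      · rw [coeff_one, if_neg (Nat.succ_ne_zero r)]
      · rw [map_zero]
    rw [map_sub, coeff_ite, sub_zero, coeff_T]
    exact filtration_mono (by simp only [genWeight]; omega) (gen_mem (i, j, r))

theorem T_diag_sub_one_mem_seriesFiltration (i : Fin n) : T n i i - 1 ∈ seriesFiltration n 1 := by
  simpa using T_sub_mem_seriesFiltration i i

theorem T_mem_seriesFiltration (i j : Fin n) :
    T n i j ∈ seriesFiltration n (if i = j then 0 else 1) := by
  split_ifs with hij
  · exact hij ▸ mem_seriesFiltration_zero_of_sub_one_mem (T_diag_sub_one_mem_seriesFiltration i)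
  · simpa [hij] using T_sub_mem_seriesFiltration i j

theorem shiftedProd_id_sub_mem_seriesFiltration (n : ℕ) :
    shiftedProd (id : Fin n → Fin n) id - (1 + ∑ i, (T n i i - 1)) ∈ seriesFiltration n 2 := by
  have shift_T_sub_one_mem (i : Fin n) :
      shift (-((i : ℕ) : ℂ)) (T n i i) - 1 ∈ seriesFiltration n 1 := by
    simpa only [shift_sub_series, shift_one] using
      shift_mem_seriesFiltration (-((i : ℕ) : ℂ)) (T_diag_sub_one_mem_seriesFiltration i)
  have sum_shift_sub_mem :
      ((List.finRange n).map fun i : Fin n => shift (-((i : ℕ) : ℂ)) (T n i i) - 1).sum -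
        ∑ i, (T n i i - 1) ∈ seriesFiltration n 2 := by
    rw [← List.ofFn_eq_map, List.sum_ofFn, ← Finset.sum_sub_distrib]
    refine Submodule.sum_mem _ fun i _ => ?_
    simpa using shift_sub_mem_seriesFiltration (-((i : ℕ) : ℂ)) (T_mem_seriesFiltration i i)
  convert add_mem (list_prod_sub_mem_seriesFiltration shift_T_sub_one_mem (List.finRange n))
    sum_shift_sub_mem using 1
  simp only [shiftedProd, id]
  abel

theorem shiftedProd_perm_mem_seriesFiltration {σ : Equiv.Perm (Fin n)} (hσ : σ ≠ 1) :
    shiftedProd σ id ∈ seriesFiltration n 2 := by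
  refine seriesFiltration_anti ?_ (list_prod_mem_seriesFiltration (fun a : Fin n =>
    shift_mem_seriesFiltration (-((a : ℕ) : ℂ)) (T_mem_seriesFiltration (σ a) a)) (List.finRange n))
  calc 2 ≤ σ.support.card := Equiv.Perm.two_le_card_support_of_ne_one hσ
    _ = ∑ a, if σ a = a then 0 else 1 := by
      rw [Equiv.Perm.support, Finset.card_filter]
      exact Finset.sum_congr rfl fun a _ => by simp only [ne_eq, ite_not]
    _ = _ := by rw [← List.ofFn_eq_map, List.sum_ofFn]

theorem qdet_sub_mem_seriesFiltration (n : ℕ) :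
    qdet n - (1 + ∑ i, (T n i i - 1)) ∈ seriesFiltration n 2 := by
  rw [qdet_eq_sum, ← Finset.add_sum_erase _ _ (Finset.mem_univ 1), Equiv.Perm.sign_one,
    Units.val_one, one_smul, Equiv.Perm.coe_one, add_sub_right_comm]
  refine add_mem (shiftedProd_id_sub_mem_seriesFiltration n) (Submodule.sum_mem _ fun σ hσ => ?_)
  exact zsmul_mem (shiftedProd_perm_mem_seriesFiltration (Finset.ne_of_mem_erase hσ)) _

theorem hasSymbol_coeff_qdet (r : ℕ) :
    HasSymbol (2 * r + 1) (coeff (r + 1) (qdet n)) (∑ i, MvPolynomial.X (i, i, r)) := by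
  refine (HasSymbol.sum Finset.univ fun i _ => HasSymbol.gen (i, i, r)).of_sub_mem ?_
  have coeff_linear : coeff (r + 1) (1 + ∑ i, (T n i i - 1)) = ∑ i, gen (i, i, r) := by
    simp only [map_add, map_sum, map_sub, coeff_one, Nat.succ_ne_zero, if_false, zero_add,
      sub_zero, coeff_T, gen]
  rw [← coeff_linear, ← map_sub]
  exact filtration_mono (by omega) (qdet_sub_mem_seriesFiltration n (r + 1))

theorem qdet_mem_seriesFiltration (n : ℕ) : qdet n ∈ seriesFiltration n 0 := by
  have linear_mem : 1 + ∑ i, (T n i i - 1) ∈ seriesFiltration n 0 :=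
    add_mem one_mem_seriesFiltration (Submodule.sum_mem _ fun i _ =>
      seriesFiltration_anti (Nat.zero_le 1) (T_diag_sub_one_mem_seriesFiltration i))
  exact (Submodule.sub_mem_iff_left _ linear_mem).1
    (seriesFiltration_anti (Nat.zero_le 2) (qdet_sub_mem_seriesFiltration n))

theorem z_sub_one_mem_seriesFiltration (hn : 0 < n) : z n - 1 ∈ seriesFiltration n 2 := by
  refine mem_seriesFiltration_of_mul (qdet_mem_seriesFiltration n) (constantCoeff_qdet n) ?_
  rw [mul_sub, ← shift_qdet hn, mul_one]
  exact shift_sub_mem_seriesFiltration _ (qdet_mem_seriesFiltration n)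

end SeriesFiltration

/-! ### The center -/

section Center

variable {n : ℕ}

/-- The subalgebra generated by the coefficients of the quantum determinant. -/
def qdetAlg (n : ℕ) : Subalgebra ℂ (Yangian n) :=
  Algebra.adjoin ℂ (Set.range fun r => coeff r (qdet n))

theorem coeff_qdet_mem_qdetAlg (r : ℕ) : coeff r (qdet n) ∈ qdetAlg n :=
  Algebra.subset_adjoin (Set.mem_range_self r)

theorem qdetAlg_le_center (hn : 0 < n) : qdetAlg n ≤ Subalgebra.center ℂ (Yangian n) :=
  Algebra.adjoin_le (Set.range_subset_iff.2 (coeff_qdet_mem_center hn))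

theorem exists_mem_qdetAlg_hasSymbol_average_X (g : GenIndex n) :
    ∃ q ∈ qdetAlg n, HasSymbol (genWeight g) q (average n (MvPolynomial.X g)) := by
  rw [average_X]
  split_ifs
  · exact ⟨(1 / n : ℂ) • coeff (g.2.2 + 1) (qdet n),
      Subalgebra.smul_mem _ (coeff_qdet_mem_qdetAlg _) _, (hasSymbol_coeff_qdet g.2.2).smul _⟩
  · exact ⟨0, zero_mem _, HasSymbol.zero _⟩

theorem exists_mem_qdetAlg_hasSymbol_average_wordMonomial (L : List (GenIndex n)) :
    ∃ q ∈ qdetAlg n, HasSymbol (wordWeight L) q (average n (wordMonomial L)) := by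
  induction L with
  | nil => exact ⟨1, one_mem _, by simpa using HasSymbol.word (n := n) [] rfl⟩
  | cons g L ih =>
    obtain ⟨q, hq, symbol_q⟩ := ih
    obtain ⟨q', hq', symbol_q'⟩ := exists_mem_qdetAlg_hasSymbol_average_X g
    rw [wordMonomial_cons, map_mul, wordWeight_cons]
    exact ⟨q' * q, mul_mem hq' hq, symbol_q'.mul symbol_q⟩

theorem HasSymbol.exists_mem_qdetAlg_hasSymbol_average {w : ℕ} {x : Yangian n}
    {p : MvPolynomial (GenIndex n) ℂ} (h : HasSymbol w x p) :
    ∃ q ∈ qdetAlg n, HasSymbol w q (average n p) := by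
  induction h with
  | word L hL => exact hL ▸ exists_mem_qdetAlg_hasSymbol_average_wordMonomial L
  | lower _ => exact ⟨0, zero_mem _, by simpa using HasSymbol.zero (n := n) w⟩
  | add _ _ hx hy =>
    obtain ⟨q, hq, symbol_q⟩ := hx
    obtain ⟨q', hq', symbol_q'⟩ := hy
    exact ⟨q + q', add_mem hq hq', by simpa using symbol_q.add symbol_q'⟩
  | smul c _ hx =>
    obtain ⟨q, hq, symbol_q⟩ := hx
    exact ⟨c • q, Subalgebra.smul_mem _ hq c, by simpa using symbol_q.smul c⟩

theorem HasSymbol.poissonBracket_eq_zero {w : ℕ} {x : Yangian n} {p : MvPolynomial (GenIndex n) ℂ}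
    (h : HasSymbol w x p) (hx : x ∈ Subalgebra.center ℂ (Yangian n)) (g : GenIndex n) :
    poissonBracket g p = 0 := by
  have commutator_symbol := h.commutator g
  rw [Subalgebra.mem_center_iff.1 hx, sub_self] at commutator_symbol
  exact commutator_symbol.eq_zero

theorem center_le_qdetAlg (hn : 0 < n) : Subalgebra.center ℂ (Yangian n) ≤ qdetAlg n := by
  intro x hx
  obtain ⟨w, hw⟩ := exists_mem_filtration x
  induction w generalizing x with
  | zero =>
    rw [filtration_zero, Submodule.mem_bot] at hw
    exact hw ▸ zero_mem _
  | succ w ih =>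
    obtain ⟨p, symbol_x⟩ := exists_hasSymbol hw
    obtain ⟨q, hq, symbol_q⟩ := symbol_x.exists_mem_qdetAlg_hasSymbol_average
    rw [average_eq_self_of_poissonBracket_eq_zero hn (symbol_x.poissonBracket_eq_zero hx)]
      at symbol_q
    have sub_mem_qdetAlg := ih (sub_mem hx (qdetAlg_le_center hn hq))
      (symbol_x.sub_mem_filtration symbol_q)
    simpa only [sub_add_cancel] using add_mem sub_mem_qdetAlg hq

theorem adjoin_coeff_z_eq_center (hn : 0 < n) :
    Algebra.adjoin ℂ (Set.range fun r => coeff (r + 2) (z n)) =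
      Subalgebra.center ℂ (Yangian n) := by
  refine le_antisymm
    (Algebra.adjoin_le (Set.range_subset_iff.2 fun r => coeff_z_mem_center hn _)) ?_
  exact (center_le_qdetAlg hn).trans
    (Algebra.adjoin_le (Set.range_subset_iff.2 (coeff_qdet_mem_adjoin_coeff_z hn)))

end Center

/-! ### Algebraic independence -/

section Independence

theorem coeff_succ_mul_of_coeff_one_eq_zero {R : Type*} [Semiring R] {f g : R⟦X⟧}
    (hg₀ : coeff 0 g = 1) (hg₁ : coeff 1 g = 0) (m : ℕ) : coeff (m + 1) (f * g) =
      ∑ r ∈ Finset.range m, coeff r f * coeff (m + 1 - r) g + coeff (m + 1) f := by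
  rw [coeff_mul, Finset.Nat.sum_antidiagonal_eq_sum_range_succ
    (fun p q => coeff p f * coeff q g), Finset.sum_range_succ, Finset.sum_range_succ,
    Nat.sub_self, hg₀, mul_one, Nat.add_sub_cancel_left, hg₁, mul_zero, add_zero]

variable {n : ℕ} {K : Type*} [CommRing K] [Algebra ℂ K]

/-- The coefficients of a solution of `f(u - n) = f(u) g(u)`, obtained by solving for the
coefficient of `u^{-m-2}`, in which the top coefficients on the two sides differ by a multiple of
the coefficient of index `m + 1` of `f`. -/
def shiftSolution (n : ℕ) (g : K⟦X⟧) : ℕ → K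
  | 0 => 1
  | m + 1 => (1 / ((m + 1 : ℕ) * n) : ℂ) • ∑ r : Fin (m + 1),
      (shiftSolution n g r * coeff (m + 2 - r) g -
        coeff (m + 2) (invShift (-(n : ℂ)) ^ (r : ℕ)) • shiftSolution n g r)

theorem smul_shiftSolution_succ (hn : 0 < n) (g : K⟦X⟧) (m : ℕ) :
    ((m + 1 : ℕ) * n : ℂ) • shiftSolution n g (m + 1) = ∑ r ∈ Finset.range (m + 1),
      (shiftSolution n g r * coeff (m + 2 - r) g -
        coeff (m + 2) (invShift (-(n : ℂ)) ^ r) • shiftSolution n g r) := by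
  have factor_ne_zero : ((m + 1 : ℕ) * (n : ℂ)) ≠ 0 :=
    mul_ne_zero (Nat.cast_ne_zero.2 m.succ_ne_zero) (Nat.cast_ne_zero.2 hn.ne')
  rw [shiftSolution, smul_smul, mul_one_div_cancel factor_ne_zero, one_smul, Finset.sum_range]

theorem exists_shift_eq_mul (hn : 0 < n) {g : K⟦X⟧} (hg₀ : coeff 0 g = 1) (hg₁ : coeff 1 g = 0) :
    ∃ f : K⟦X⟧, constantCoeff f = 1 ∧ shift (-(n : ℂ)) f = f * g := by
  have constantCoeff_mk : constantCoeff (PowerSeries.mk (shiftSolution n g)) = 1 := by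
    rw [← coeff_zero_eq_constantCoeff_apply, coeff_mk, shiftSolution]
  refine ⟨PowerSeries.mk (shiftSolution n g), constantCoeff_mk, ?_⟩
  ext (_ | _ | m)
  · rw [coeff_zero_eq_constantCoeff_apply] at hg₀
    rw [coeff_zero_eq_constantCoeff_apply, coeff_zero_eq_constantCoeff_apply, constantCoeff_shift,
      map_mul, hg₀, mul_one]
  · rw [coeff_shift_succ, coeff_succ_mul_of_coeff_one_eq_zero hg₀ hg₁]
    simp
  · rw [coeff_shift_succ, coeff_succ_mul_of_coeff_one_eq_zero hg₀ hg₁, mul_neg, neg_neg]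
    simp only [coeff_mk]
    rw [smul_shiftSolution_succ hn, Finset.sum_sub_distrib, add_sub_cancel]

theorem rtt_diagonal {K : Type*} [CommRing K] (f : K⟦X⟧) :
    RTT (dd K) (ee K) ((Matrix.diagonal fun _ : Fin n => f).map inU)
      ((Matrix.diagonal fun _ : Fin n => f).map inV) := by
  intro i j k l
  simp only [Matrix.map_apply, Matrix.diagonal_apply]
  rw [mul_comm (inU _), sub_self, mul_zero]
  split_ifs <;> simp [mul_comm]

/-- The representation `T(u) ↦ f(u) 1` of the Yangian in a commutative algebra. -/
def scalarRep (n : ℕ) (f : K⟦X⟧) (hf : constantCoeff f = 1) : Yangian n →ₐ[ℂ] K :=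
  liftMat (Matrix.diagonal fun _ => f)
    (by rw [Matrix.diagonal_map (map_zero _), hf, Matrix.diagonal_one]) (rtt_diagonal f)

theorem map_scalarRep_T {f : K⟦X⟧} (hf : constantCoeff f = 1) (i j : Fin n) :
    PowerSeries.map (scalarRep n f hf : Yangian n →+* K) (T n i j) = if i = j then f else 0 := by
  ext r
  rw [coeff_map, coeff_T, ← Matrix.diagonal_apply (fun _ => f)]
  exact liftMat_t _ _ _ i j r

theorem map_scalarRep_z (hn : 0 < n) {f g : K⟦X⟧} (hf : constantCoeff f = 1)
    (hfg : shift (-(n : ℂ)) f = f * g) :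
    PowerSeries.map (scalarRep n f hf : Yangian n →+* K) (z n) = g := by
  let i : Fin n := ⟨0, hn⟩
  set ψ := PowerSeries.map (scalarRep n f hf : Yangian n →+* K)
  have mul_map_Tinv : f * ψ (Tinv n i i) = 1 := by
    simpa [Matrix.mul_apply, ψ, map_scalarRep_T] using
      congrArg ψ (congrFun (congrFun (T_mul_Tinv n) i) i)
  have map_zInv : f * shift (-(n : ℂ)) (ψ (Tinv n i i)) = ψ (zInv n) := by
    simpa [ψ, map_scalarRep_T, map_shift] using congrArg ψ (sum_T_mul_Tinv_shift hn i i)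
  refine left_inv_eq_right_inv (a := ψ (zInv n)) (by rw [← map_mul, z_mul_zInv hn, map_one]) ?_
  rw [← map_zInv, mul_right_comm, ← hfg, ← shift_mul, mul_map_Tinv, shift_one]

/-- The coefficient of `u^{-r-2}` in `z(u)`, as an element of the center. -/
def zCentral (hn : 0 < n) (r : ℕ) : Subalgebra.center ℂ (Yangian n) :=
  ⟨coeff (r + 2) (z n), coeff_z_mem_center hn _⟩

theorem algebraicIndependent_zCentral (hn : 0 < n) : AlgebraicIndependent ℂ (zCentral hn) := by
  let g : (MvPolynomial ℕ ℂ)⟦X⟧ := PowerSeries.mk fun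
    | 0 => 1
    | 1 => 0
    | r + 2 => MvPolynomial.X r
  obtain ⟨f, hf, hfg⟩ := exists_shift_eq_mul hn (g := g) (by simp [g]) (by simp [g])
  refine AlgebraicIndependent.of_comp
    ((scalarRep n f hf).comp (Subalgebra.center ℂ (Yangian n)).val) ?_
  convert MvPolynomial.algebraicIndependent_X ℕ ℂ using 1
  funext r
  have coeff_eq := congrArg (coeff (r + 2)) (map_scalarRep_z hn hf hfg)
  rw [coeff_map, coeff_mk] at coeff_eq
  exact coeff_eq

theorem adjoin_zCentral (hn : 0 < n) : Algebra.adjoin ℂ (Set.range (zCentral hn)) = ⊤ := by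
  refine Subalgebra.map_injective (f := (Subalgebra.center ℂ (Yangian n)).val)
    Subtype.val_injective ?_
  rw [AlgHom.map_adjoin, ← Set.range_comp, Algebra.map_top, Subalgebra.range_val]
  exact adjoin_coeff_z_eq_center hn

end Independence

/-! ### The square of the antipode -/

section AntipodeSquare

variable {n : ℕ}

/-- The square of the antipode; it preserves products, the antipode being an antihomomorphism. -/
def antipodeSq (n : ℕ) : Yangian n →ₐ[ℂ] Yangian n :=
  AlgHom.ofLinearMap (antipodeLin n ∘ₗ antipodeLin n)
    (by rw [LinearMap.comp_apply, antipodeLin_one, antipodeLin_one])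
    fun x y => by simp only [LinearMap.comp_apply, antipodeLin_mul]

theorem antipodeSq_t (i j : Fin n) (r : ℕ) :
    antipodeSq n (t i j r) = antipodeLin n (coeff r (Tinv n i j)) :=
  congrArg (antipodeLin n) (antipodeLin_t i j r)

theorem sum_map_antipodeSq_T_mul_Tinv (i j : Fin n) :
    ∑ a, PowerSeries.map (antipodeSq n : Yangian n →+* Yangian n) (T n a j) * Tinv n i a =
      if i = j then 1 else 0 := by
  ext r
  calc coeff r (∑ a, PowerSeries.map (antipodeSq n : Yangian n →+* Yangian n) (T n a j) *
          Tinv n i a)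
      = antipodeLin n (coeff r ((T n * Tinv n) i j)) := by
        simp only [Matrix.mul_apply, map_sum, coeff_mul, antipodeLin_mul, coeff_T, antipodeLin_t]
        refine Finset.sum_congr rfl fun a _ => ?_
        rw [← Finset.Nat.sum_antidiagonal_swap]
        simp only [coeff_map, coeff_T, RingHom.coe_coe, antipodeSq_t, Prod.fst_swap, Prod.snd_swap]
    _ = coeff r (if i = j then 1 else 0) := by
        rw [T_mul_Tinv, Matrix.one_apply]
        split_ifs
        · rw [coeff_one, apply_ite (antipodeLin n), antipodeLin_one, map_zero]
        · rw [map_zero, map_zero]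

theorem sum_shift_z_mul_T_mul_Tinv (hn : 0 < n) (i j : Fin n) :
    ∑ a, shift (n : ℂ) (z n * T n a j) * Tinv n i a = if i = j then 1 else 0 := by
  have contraction := congrArg (shift (n : ℂ)) (sum_T_mul_Tinv_shift hn j i)
  simp only [shift_sum, shift_mul, shift_shift, add_neg_cancel, shift_zero] at contraction
  simp only [shift_mul, mul_assoc, ← Finset.mul_sum]
  rw [contraction, ← shift_mul, mul_ite, z_mul_zInv hn, mul_zero, apply_ite (shift (n : ℂ)),
    shift_one, shift_zero_series]
  simp only [eq_comm]

theorem eq_of_sum_mul_Tinv_eq {M N : Matrix (Fin n) (Fin n) (Yangian n)⟦X⟧}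
    (h : ∀ i j, ∑ a, M a j * Tinv n i a = ∑ a, N a j * Tinv n i a) : M = N := by
  have isUnit_transpose : IsUnit (Tinv n).transpose := by
    apply isUnit_of_constantCoeff
    rw [Matrix.transpose_map, Tinv_map_constantCoeff, Matrix.transpose_one]
  refine Matrix.transpose_injective (isUnit_transpose.mul_right_cancel ?_)
  ext1 j i
  exact h i j

theorem map_antipodeSq_T (hn : 0 < n) (i j : Fin n) :
    PowerSeries.map (antipodeSq n : Yangian n →+* Yangian n) (T n i j) =
      shift (n : ℂ) (z n) * shift (n : ℂ) (T n i j) := by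
  rw [← shift_mul]
  refine congrFun (congrFun (eq_of_sum_mul_Tinv_eq
    (M := (T n).map (PowerSeries.map (antipodeSq n : Yangian n →+* Yangian n)))
    (N := (T n).map fun f => shift (n : ℂ) (z n * f)) fun k l => ?_) i) j
  exact (sum_map_antipodeSq_T_mul_Tinv k l).trans (sum_shift_z_mul_T_mul_Tinv hn k l).symm

theorem map_antipodeSq_T_sub_mem_seriesFiltration (hn : 0 < n) (i j : Fin n) :
    PowerSeries.map (antipodeSq n : Yangian n →+* Yangian n) (T n i j) - T n i j ∈
      seriesFiltration n 2 := by
  have T_mem : T n i j ∈ seriesFiltration n 0 :=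
    seriesFiltration_anti (Nat.zero_le _) (T_mem_seriesFiltration i j)
  have z_sub_one_mul_T_mem : (z n - 1) * T n i j ∈ seriesFiltration n 2 := by
    simpa only [add_zero] using
      mul_mem_seriesFiltration (z_sub_one_mem_seriesFiltration hn) T_mem
  have decomposition : PowerSeries.map (antipodeSq n : Yangian n →+* Yangian n) (T n i j) -
      T n i j = shift (n : ℂ) ((z n - 1) * T n i j) + (shift (n : ℂ) (T n i j) - T n i j) := by
    rw [map_antipodeSq_T hn, sub_mul, one_mul, shift_sub_series, shift_mul, sub_add_sub_cancel]
  rw [decomposition]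
  exact add_mem (shift_mem_seriesFiltration _ z_sub_one_mul_T_mem)
    (by simpa only [zero_add] using shift_sub_mem_seriesFiltration (n : ℂ) T_mem)

theorem antipodeSq_gen_sub_mem_filtration (hn : 0 < n) (g : GenIndex n) :
    antipodeSq n (gen g) - gen g ∈ filtration n (genWeight g) := by
  obtain ⟨i, j, r⟩ := g
  have coeff_mem := map_antipodeSq_T_sub_mem_seriesFiltration hn i j (r + 1)
  rw [map_sub, coeff_map, coeff_T] at coeff_mem
  exact filtration_mono (by simp only [genWeight]; omega) coeff_mem

/-- The square of the antipode as an automorphism. -/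
def antipodeSqEquiv (hn : 0 < n) : Yangian n ≃ₐ[ℂ] Yangian n :=
  AlgEquiv.ofBijective (antipodeSq n)
    (algHom_bijective_of_sub_mem_filtration (antipodeSq_gen_sub_mem_filtration hn))

theorem list_prod_map_mul_of_commute {ι M : Type*} [Monoid M] {c g : ι → M}
    (hc : ∀ a b, Commute (c a) b) (l : List ι) :
    (l.map fun a => c a * g a).prod = (l.map c).prod * (l.map g).prod := by
  induction l with
  | nil => simp
  | cons a l ih =>
    have prod_commute : Commute (l.map c).prod (g a) :=
      Commute.list_prod_left _ _ (by simpa using fun b _ => hc b (g a))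
    simp only [List.map_cons, List.prod_cons, ih]
    exact (prod_commute.symm).mul_mul_mul_comm _ _

theorem shift_commute_of_coeff_mem_center {A : Type*} [Ring A] [Algebra ℂ A] {f : A⟦X⟧}
    (hf : ∀ r, coeff r f ∈ Subalgebra.center ℂ A) (a : ℂ) (g : A⟦X⟧) : Commute (shift a f) g :=
  commute_of_coeff_mem_center
    (coeff_shift_mem (Subalgebra.toSubmodule (Subalgebra.center ℂ A)) a hf) g

theorem shift_qdet_mul_prod_shift_z (hn : 0 < n) (b : ℂ) (m : ℕ) :
    shift b (qdet n) * ((List.range m).map fun a : ℕ => shift (b - (a : ℂ)) (z n)).prod =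
      shift (b - (m : ℂ)) (qdet n) := by
  induction m with
  | zero => simp
  | succ m ih =>
    rw [List.range_succ, List.map_append, List.prod_append, ← mul_assoc, ih, List.map_singleton,
      List.prod_singleton, ← shift_mul, ← shift_qdet hn, shift_shift]
    congr 1
    push_cast
    ring

theorem map_antipodeSq_shiftedProd (hn : 0 < n) {m : ℕ} (I J : Fin m → Fin n) :
    PowerSeries.map (antipodeSq n : Yangian n →+* Yangian n) (shiftedProd I J) =
      ((List.range m).map fun a : ℕ => shift ((n : ℂ) - (a : ℂ)) (z n)).prod *
        shift (n : ℂ) (shiftedProd I J) := by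
  have map_factor (a : Fin m) :
      PowerSeries.map (antipodeSq n : Yangian n →+* Yangian n)
          (shift (-((a : ℕ) : ℂ)) (T n (I a) (J a))) =
        shift ((n : ℂ) - ((a : ℕ) : ℂ)) (z n) *
          shift (n : ℂ) (shift (-((a : ℕ) : ℂ)) (T n (I a) (J a))) := by
    rw [map_shift, map_antipodeSq_T hn, shift_mul, shift_shift, shift_shift, shift_shift,
      neg_add_eq_sub, ← sub_eq_add_neg]
  rw [shiftedProd, map_list_prod, ← shiftHom_apply, map_list_prod, ← List.map_coe_finRange_eq_range]
  simp only [List.map_map, Function.comp_def, shiftHom_apply, map_factor]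
  exact list_prod_map_mul_of_commute
    (fun _ => shift_commute_of_coeff_mem_center (coeff_z_mem_center hn) _) _

theorem map_antipodeSq_qdet (hn : 0 < n) :
    PowerSeries.map (antipodeSq n : Yangian n →+* Yangian n) (qdet n) = qdet n := by
  set ζ := ((List.range n).map fun a : ℕ => shift ((n : ℂ) - (a : ℂ)) (z n)).prod
  calc PowerSeries.map (antipodeSq n : Yangian n →+* Yangian n) (qdet n)
      = ζ * shift (n : ℂ) (qdet n) := by
        simp only [qdet_eq_sum, ← shiftHom_apply, map_sum, map_zsmul, Finset.mul_sum,
          mul_smul_comm]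
        simp only [shiftHom_apply, map_antipodeSq_shiftedProd hn, ζ]
    _ = shift (n : ℂ) (qdet n) * ζ :=
        (shift_commute_of_coeff_mem_center (coeff_qdet_mem_center hn) _ _).symm
    _ = qdet n := by rw [shift_qdet_mul_prod_shift_z hn, sub_self, shift_zero]

end AntipodeSquare

end GLYangian

end

theorem mainTheorem5 (n : ℕ) (hn : 0 < n) :
    -- `qdet n` is the quantum determinant, a series that begins with `1`
    ((∀ d : PowerSeries (GLYangian.Yangian n),
        GLYangian.IsQuantumDeterminant n d ↔ d = GLYangian.qdet n) ∧
      PowerSeries.constantCoeff (GLYangian.qdet n) = 1) ∧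
    -- the quantum Liouville formula, for both orders of the factors of the quotient
    (GLYangian.z n =
        GLYangian.shift (-1) (GLYangian.qdet n) * Ring.inverse (GLYangian.qdet n) ∧
      GLYangian.z n =
        Ring.inverse (GLYangian.qdet n) * GLYangian.shift (-1) (GLYangian.qdet n)) ∧
    -- `z(u) = 1 + z₂ u⁻² + z₃ u⁻³ + ⋯`, and `z₂, z₃, …` freely generate the center
    (PowerSeries.coeff 0 (GLYangian.z n) = 1 ∧ PowerSeries.coeff 1 (GLYangian.z n) = 0 ∧
      ∃ c : ℕ → Subalgebra.center ℂ (GLYangian.Yangian n),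
        (∀ r, (c r : GLYangian.Yangian n) = PowerSeries.coeff (r + 2) (GLYangian.z n)) ∧
        AlgebraicIndependent ℂ c ∧ Algebra.adjoin ℂ (Set.range c) = ⊤) ∧
    -- the square of the antipode is the automorphism `T(u) ↦ z(u + n) T(u + n)`
    (∃ φ : GLYangian.Yangian n ≃ₐ[ℂ] GLYangian.Yangian n,
      (∀ x, φ x = HopfAlgebra.antipode ℂ (HopfAlgebra.antipode ℂ x)) ∧
      (∀ i j, PowerSeries.map (φ : GLYangian.Yangian n →+* GLYangian.Yangian n)
          (GLYangian.T n i j) =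
        GLYangian.shift (n : ℂ) (GLYangian.z n) * GLYangian.shift (n : ℂ) (GLYangian.T n i j)) ∧
      PowerSeries.map (φ : GLYangian.Yangian n →+* GLYangian.Yangian n) (GLYangian.qdet n) =
        GLYangian.qdet n) := by
  refine ⟨⟨fun d => ⟨GLYangian.IsQuantumDeterminant.eq_qdet, ?_⟩, GLYangian.constantCoeff_qdet n⟩,
    ⟨GLYangian.z_eq_shift_mul_inverse_qdet hn, GLYangian.z_eq_inverse_qdet_mul_shift hn⟩,
    ⟨?_, GLYangian.coeff_one_z hn, GLYangian.zCentral hn, fun r => rfl,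
      GLYangian.algebraicIndependent_zCentral hn, GLYangian.adjoin_zCentral hn⟩,
    GLYangian.antipodeSqEquiv hn, fun x => rfl, fun i j => ?_, ?_⟩
  · rintro rfl
    exact GLYangian.isQuantumDeterminant_qdet n
  · rw [PowerSeries.coeff_zero_eq_constantCoeff_apply, GLYangian.constantCoeff_z hn]
  · exact GLYangian.map_antipodeSq_T hn i j
  · exact GLYangian.map_antipodeSq_qdet hn
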